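/- **Setting.** Let $\mathbb F_q$ be a finite field, $\alpha_1,\dots,\alpha_n\in\mathbb F_q$ distinct points, $1\le k\le n$, and let $\mathcal C=\{(f(\alpha_1),\dots,f(\alpha_n)) : f\in\mathbb F_q[X],\ \deg f<k\}$ be the $[n,k]_q$ Reed–Solomon code, of rate $k/n$. A uniformly distributed codeword is sent $K$ times, independently, through the $q$-ary symmetric channel, which independently replaces each symbol with probability $p$ by a uniformly chosen other symbol; the receiver sees the $K$ reads $\boldsymbol y_1,\dots,\boldsymbol y_K\in\mathbb F_q^n$. **Reconstruction algorithm** (with integer parameter $\mu\ge1$). 1. Let $M_{v,j}=\mu\cdot|\{i : (\boldsymbol y_i)_j=v\}|$ for $v\in\mathbb F_q$, $1\le j\le n$. For each $j$ such that column $j$ of $M$ has a unique largest entry, at $v_j$ say, and this entry exceeds $1$, replace the column by $\mu K$ at $v_j$ and $0$ elsewhere. 2. (Koetter–Vardy) Compute a nonzero $Q\in\mathbb F_q[X,Y]$ of minimal $(1,k-1)$-weighted degree among those having, for all $v,j$, a zero of multiplicity at least $M_{v,j}$ at $(\alpha_j,v)$. Let $\mathcal L$ be the list of the words $(f(\alpha_1),\dots,f(\alpha_n))$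 with $\deg f<k$ and $Y-f(X)\mid Q(X,Y)$. 3. Output the $\boldsymbol c\in\mathcal L$ of maximal score $\sum_j M_{c_j,j}$ if there is exactly one, and FAILURE otherwise. The error probability $\mathsf P_{\mathrm{err}}$ is the probability that the output is not the transmitted codeword. **Theorem.** (i) *Polynomial time.* A single program performs the reconstruction algorithm for all finite fields, all $K\ge2$, $\mu\ge1$, $1\le k\le n$, all evaluation points and all reads, in a number of steps bounded by a fixed polynomial in $q+n+K+\mu$. The program is written in a language of finite sequences with bounded loops and unary numbers; one step is a field operation, an equality test of field elements, or an elementary list or control operation; the input contains an ordering of $\mathbb F_q$. Now let $p\in(0,1)$ and $K\ge2$ with $p\le K^{-1/(K-1)}$, and put $$R^*=\frac{K\bigl(1-p^K-(K-1)(1-p)p^{K-1}\bigr)^2}{1+(K-1)\bigl(1-p^K-K(1-p)p^{K-1}\bigr)}.$$ (ii) *Rates below the threshold.* For every $R<R^*$ there is $\mu_0$ such that for every integer $\mu\ge\mu_0$ and every $\varepsilon>0$ there is $n_0$ such that for all $n\ge n_0$, all finite fields with $q\ge n$, all $[n,k]_q$ Reed–Solomon codes with $k\ge 1$ and $k/n\le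 R$, and whichever choices of $Q$ are made in step 2, $\mathsf P_{\mathrm{err}}\le\varepsilon$. (iii) *Achievability up to and including the threshold.* For every $0<R\le R^*$ there are sequences $1\le k_n\le n$ with $k_n/n\to R$ and $1\le\mu_n\le n$ such that for every $\varepsilon>0$ there is $n_0$ such that for all $n\ge n_0$, all $q\ge n$, all $[n,k_n]_q$ Reed–Solomon codes, and whichever choices of $Q$ are made, the algorithm with parameter $\mu_n$ has $\mathsf P_{\mathrm{err}}\le\varepsilon$. -/

import Mathlib

open Polynomial

/-! ### A machine model with a step count

Programs are finite syntactic objects of a typed first-order language over finite sequences, with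
bounded loops, whose atoms are elements of a field. A program mentions no field, no code length and
no other parameter (its only field constants are `0` and `1`), so that one and the same program is
run on all inputs, over all fields. -/

/-- Data types of the language. Natural numbers are handled in unary, as lists over `unit`. -/
inductive Ty : Type
  | unit : Ty
  | bool : Ty
  | fld : Ty
  | prod : Ty → Ty → Ty
  | list : Ty → Ty

/-- The data of a given type over the field `F`. -/
abbrev Ty.Val (F : Type) : Ty → Type
  | .unit => Unit
  | .bool => Bool
  | .fld => F
  | .prod a b => Ty.Val F a × Ty.Val F b
  | .list a => List (Ty.Val F a)

/-- Programs with input of type `a` and output of type `b`. -/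
inductive Prog : Ty → Ty → Type
  /- plumbing -/
  | id {a : Ty} : Prog a a
  | comp {a b c : Ty} : Prog b c → Prog a b → Prog a c
  | unit {a : Ty} : Prog a .unit
  | pair {a b c : Ty} : Prog a b → Prog a c → Prog a (.prod b c)
  | fst {a b : Ty} : Prog (.prod a b) a
  | snd {a b : Ty} : Prog (.prod a b) b
  /- field arithmetic and the equality test -/
  | zero {a : Ty} : Prog a .fld
  | one {a : Ty} : Prog a .fld
  | add : Prog (.prod .fld .fld) .fld
  | sub : Prog (.prod .fld .fld) .fld
  | mul : Prog (.prod .fld .fld) .fld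
  | inv : Prog .fld .fld
  | eqTest : Prog (.prod .fld .fld) .bool
  /- branching -/
  | ite {a b : Ty} : Prog a .bool → Prog a b → Prog a b → Prog a b
  /- lists: the empty list, prepending, case distinction, and a loop through a list (which updates
  a state of type `b` and can read a fixed environment of type `e`) -/
  | nil {a b : Ty} : Prog a (.list b)
  | cons {a : Ty} : Prog (.prod a (.list a)) (.list a)
  | caseList {e a b : Ty} : Prog e b → Prog (.prod e (.prod a (.list a))) b →
      Prog (.prod e (.list a)) b
  | loop {e a b : Ty} : Prog (.prod e (.prod b a)) b → Prog (.prod e (.prod b (.list a))) b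

/-- The result of running a program. -/
def Prog.eval {F : Type} [Field F] [DecidableEq F] :
    {a b : Ty} → Prog a b → Ty.Val F a → Ty.Val F b
  | _, _, .id, x => x
  | _, _, .comp p q, x => p.eval (q.eval x)
  | _, _, .unit, _ => ()
  | _, _, .pair p q, x => (p.eval x, q.eval x)
  | _, _, .fst, x => x.1
  | _, _, .snd, x => x.2
  | _, _, .zero, _ => (0 : F)
  | _, _, .one, _ => (1 : F)
  | _, _, .add, x => (x.1 + x.2 : F)
  | _, _, .sub, x => (x.1 - x.2 : F)
  | _, _, .mul, x => (x.1 * x.2 : F)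
  | _, _, .inv, x => ((x : F)⁻¹ : F)
  | _, _, .eqTest, x => decide ((x.1 : F) = x.2)
  | _, _, .ite c p q, x => match (c.eval x : Bool) with
    | true => p.eval x
    | false => q.eval x
  | _, _, .nil, _ => []
  | _, _, .cons, x => x.1 :: x.2
  | _, _, .caseList p q, (g, l) => match l with
    | [] => p.eval g
    | y :: l' => q.eval (g, y, l')
  | _, _, .loop p, (g, s, l) => l.foldl (fun s y => p.eval (g, s, y)) s

/-- The number of steps of a loop with update `step` whose single rounds cost `cost`. -/
def loopTime {σ τ : Type} (step : σ → τ → σ) (cost : σ → τ → ℕ) : σ → List τ → ℕ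
  | _, [] => 1
  | s, y :: l => 1 + cost s y + loopTime step cost (step s y) l

/-- The number of steps of a run. Every elementary operation takes one step: a field operation,
an equality test of field elements, a branching, moving a pointer, prepending one entry to a list,
entering a round of a loop. -/
def Prog.time {F : Type} [Field F] [DecidableEq F] :
    {a b : Ty} → Prog a b → Ty.Val F a → ℕ
  | _, _, .comp p q, x => 1 + q.time x + p.time (q.eval x)
  | _, _, .pair p q, x => 1 + p.time x + q.time x
  | _, _, .ite c p q, x => 1 + c.time x + match (c.eval x : Bool) with
    | true => p.time x
    | false => q.time x
  | _, _, .caseList p q, (g, l) => 1 + match l with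
    | [] => p.time g
    | y :: l' => q.time (g, y, l')
  | _, _, .loop p, (g, s, l) =>
      1 + loopTime (fun s y => p.eval (g, s, y)) (fun s y => p.time (g, s, y)) s l
  | _, _, _, _ => 1

/-! ### Reed–Solomon codes and the K-draw symmetric channel -/

section Code

variable {F : Type} [Field F] {n : ℕ}

/-- The word `(f(α₁), …, f(αₙ))`. -/
def evalWord (α : Fin n ↪ F) (f : F[X]) : Fin n → F := fun j => f.eval (α j)

/-- The `[n, k]` Reed–Solomon code with evaluation vector `α`. -/
def rsCode (k : ℕ) (α : Fin n ↪ F) : Set (Fin n → F) :=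
  {c | ∃ f : F[X], f.degree < k ∧ c = evalWord α f}

/-- The probability that the `q`-ary symmetric channel with substitution probability `p` turns the
symbol `x` into the symbol `y`. -/
noncomputable def symbolProb [Fintype F] [DecidableEq F] (p : ℝ) (x y : F) : ℝ :=
  if y = x then 1 - p else p / ((Fintype.card F : ℝ) - 1)

/-- The probability that the `K` independent reads of the transmitted word `c` are `Y`. -/
noncomputable def readsProb [Fintype F] [DecidableEq F] {K : ℕ} (p : ℝ) (c : Fin n → F)
    (Y : Fin K → Fin n → F) : ℝ :=
  ∏ i, ∏ j, symbolProb p (c j) (Y i j)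

/-! ### The multiplicity matrix of the reads -/

/-- The matrix of read counts, scaled by `μ`; its rows are indexed by the elements of the field. -/
def countMatrix [DecidableEq F] {K : ℕ} (μ : ℕ) (Y : Fin K → Fin n → F) : Matrix F (Fin n) ℕ :=
  fun v j => μ * (Finset.univ.filter fun i => Y i j = v).card

/-- The largest entry of column `j`. -/
def colMax [Fintype F] (M : Matrix F (Fin n) ℕ) (j : Fin n) : ℕ :=
  Finset.univ.sup fun v => M v j

/-- The field elements at which column `j` has its largest entry. -/
def colArgmax [Fintype F] (M : Matrix F (Fin n) ℕ) (j : Fin n) : Finset F :=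
  Finset.univ.filter fun v => M v j = colMax M j

/-- The multiplicity matrix built from the reads `Y`: a column of the count matrix with a unique
largest entry, which exceeds `1`, is replaced by `μ K` at that entry and `0` elsewhere. -/
def multMatrix [Fintype F] [DecidableEq F] {K : ℕ} (μ : ℕ) (Y : Fin K → Fin n → F) :
    Matrix F (Fin n) ℕ := fun v j =>
  if 1 < colMax (countMatrix μ Y) j ∧ (colArgmax (countMatrix μ Y) j).card = 1 then
    if v ∈ colArgmax (countMatrix μ Y) j then μ * K else 0
  else countMatrix μ Y v j

/-- The score of the word `c` with respect to `M`. -/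
def score (M : Matrix F (Fin n) ℕ) (c : Fin n → F) : ℕ := ∑ j, M (c j) j

/-! ### Koetter–Vardy decoding

The coefficient of `X ^ i * Y ^ j` in a bivariate polynomial `Q : F[X][X]` is
`(Q.coeff j).coeff i`. -/

/-- The `(1, k - 1)`-weighted degree of a nonzero bivariate polynomial. -/
noncomputable def weightedDegree (k : ℕ) (Q : F[X][X]) : ℕ :=
  Q.support.sup fun j => (Q.coeff j).natDegree + (k - 1) * j

/-- `Q` has a zero of multiplicity at least `m` at `(a, b)`: the polynomial `Q(X + a, Y + b)` has
no monomial of total degree less than `m`. -/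
def HasZeroOfMult (Q : F[X][X]) (a b : F) (m : ℕ) : Prop :=
  ∀ r s : ℕ, r + s < m →
    (((Q.map (compRingHom (X + C a))).comp (X + C (C b))).coeff s).coeff r = 0

/-- `Q` is nonzero and has the zeros that the multiplicity matrix `M` prescribes. -/
def Interpolates (α : Fin n ↪ F) (M : Matrix F (Fin n) ℕ) (Q : F[X][X]) : Prop :=
  Q ≠ 0 ∧ ∀ v j, HasZeroOfMult Q (α j) v (M v j)

/-- `Q` is a possible result of the interpolation step: it has minimal weighted degree. -/
def IsInterpolationPoly (k : ℕ) (α : Fin n ↪ F) (M : Matrix F (Fin n) ℕ) (Q : F[X][X]) : Prop :=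
  Interpolates α M Q ∧ ∀ Q', Interpolates α M Q' → weightedDegree k Q ≤ weightedDegree k Q'

/-- The candidate codewords, given by the factors `Y - f(X)` of `Q` with `deg f < k`. -/
def candidates (k : ℕ) (α : Fin n ↪ F) (Q : F[X][X]) : Set (Fin n → F) :=
  {c | ∃ f : F[X], f.degree < k ∧ X - C f ∣ Q ∧ c = evalWord α f}

/-- `c` is an element of `L` of maximal score. -/
def IsArgmax (M : Matrix F (Fin n) ℕ) (L : Set (Fin n → F)) (c : Fin n → F) : Prop :=
  c ∈ L ∧ ∀ c' ∈ L, score M c' ≤ score M c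

open Classical in
/-- The element of `L` of maximal score if there is exactly one, and `none` (failure) otherwise. -/
noncomputable def selectArgmax (M : Matrix F (Fin n) ℕ) (L : Set (Fin n → F)) :
    Option (Fin n → F) :=
  if h : ∃! c, IsArgmax M L c then some h.choose else none

/-- `out` is a possible output of the reconstruction algorithm on the reads `Y`. (The algorithm
may use any interpolation polynomial of minimal weighted degree.) -/
def IsReconstruction [Fintype F] [DecidableEq F] {K : ℕ} (k μ : ℕ) (α : Fin n ↪ F)
    (Y : Fin K → Fin n → F) (out : Option (Fin n → F)) : Prop :=
  ∃ Q : F[X][X], IsInterpolationPoly k α (multMatrix μ Y) Q ∧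
    out = selectArgmax (multMatrix μ Y) (candidates k α Q)

/-- `dec` is a decoder (a map from reads to outputs) that implements the reconstruction
algorithm. -/
def ImplementsReconstruction [Fintype F] [DecidableEq F] {K : ℕ} (k μ : ℕ) (α : Fin n ↪ F)
    (dec : (Fin K → Fin n → F) → Option (Fin n → F)) : Prop :=
  ∀ Y, IsReconstruction k μ α Y (dec Y)

open Classical in
/-- The error probability of the decoder `dec` over the K-draw symmetric channel, for a uniformly
distributed codeword of the `[n, k]` Reed–Solomon code. -/
noncomputable def errorProb [Fintype F] {K : ℕ} (p : ℝ) (k : ℕ) (α : Fin n ↪ F)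
    (dec : (Fin K → Fin n → F) → Option (Fin n → F)) : ℝ :=
  (∑ c ∈ Finset.univ.filter (· ∈ rsCode k α),
    ∑ Y ∈ Finset.univ.filter (fun Y => dec Y ≠ some c), readsProb p c Y) /
      (Fintype.card F : ℝ) ^ k

/-! ### Input and output format of the program -/

/-- The inputs: an ordering of the field, the evaluation vector, the reads, and the numbers `k`
and `μ` in unary. -/
abbrev inputTy : Ty :=
  .prod (.list .fld) (.prod (.list .fld) (.prod (.list (.list .fld))
    (.prod (.list .unit) (.list .unit))))

/-- The outputs: the one-entry list of the reconstructed codeword, or the empty list (failure). -/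
abbrev outputTy : Ty := .list (.list .fld)

/-- The input for given parameters and reads. -/
def encodeInput [Fintype F] {K : ℕ} (δ : Fin (Fintype.card F) ≃ F) (α : Fin n ↪ F)
    (Y : Fin K → Fin n → F) (k μ : ℕ) : inputTy.Val F :=
  (List.ofFn δ, List.ofFn α, List.ofFn fun i => List.ofFn (Y i), List.replicate k (),
    List.replicate μ ())

/-- The representation of an output of the reconstruction algorithm. -/
def encodeOutput (out : Option (Fin n → F)) : outputTy.Val F :=
  (out.map fun c => List.ofFn c).toList

end Code

/-- The rate threshold. -/
noncomputable def rateThreshold (K : ℕ) (p : ℝ) : ℝ :=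
  K * (1 - p ^ K - (K - 1) * (1 - p) * p ^ (K - 1)) ^ 2 /
    (1 + (K - 1) * (1 - p ^ K - K * (1 - p) * p ^ (K - 1)))

/-! Error probability. Let `x` be the probability of at least two correct reads in a column. Two
wrong reads of a column coincide with probability at most `K² / (q - 1)`, which is negligible
because `q ≥ n`. In the remaining columns there are only two cases. Either the sent symbol is read
at least twice and the column is concentrated on it with weight `μ K`, or all `K` reads differ and
the column keeps `K` entries `μ`. Hence per column the sent word scores about `μ ((K - 1) x + 1 - p
^ K)`, and twice the number of interpolation constraints is about `μ² K (1 + (K - 1) x)` plus a term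
linear in `μ`.

Counting monomials against constraints gives an interpolating `Q` of weighted degree below `S` as
soon as `k * cost < S²`. Counting zeros of `Q(X, f(X))` shows that `Y - f` divides `Q` when the
score exceeds the weighted degree. So the sent word is a candidate once `k * cost < score²`, and the
quotient of the two typical values is `R*` (`exists_interpolates`, `X_sub_C_dvd`,
`rateThreshold_eq`).

The sent word must also have the strictly largest score. A different codeword agrees with it in
fewer than `k` places, and elsewhere its symbol occurs among the reads with probability at most `K /
(q - 1)`. A union bound over the code shows that typically every such word occurs in fewer than `k +
δ n` columns (`mass_other_codeword_le`). It then loses because `R* < 1 - p ^ K`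
(`rateThreshold_lt`). Chernoff bounds control the column counts (`mass_count_le`,
`mass_not_typical_le`). The threshold itself is reached by a diagonal choice of rates increasing to
`R`.

Polynomial time. `PolyTime` is closed under the operations of the language, loops included provided
that some measure of the state grows only additively per round. The decoder is written as functions
on coefficient lists. Interpolation is Gaussian elimination, one constraint at a time, for
increasing degree bounds `w` (`interpolate_spec`). The factors `Y - f` are found by a
Roth–Ruckenstein search that determines `f` coefficient by coefficient. A potential, the sum of the
degrees of trailing coefficients over all live prefixes, never exceeds the `Y`-degree of `Q`, which
prevents exponential branching (`sum_prefixDeg_le`, `prefixes_spec`). `reconstruct_spec` identifies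
the result with the specification. -/

set_option linter.unusedSectionVars false

/-! ### Polynomial-time functions -/

/-- The size of a value. -/
def Ty.size {F : Type} : (a : Ty) → Ty.Val F a → ℕ
  | .unit, _ => 1
  | .bool, _ => 1
  | .fld, _ => 1
  | .prod a b, x => Ty.size a x.1 + Ty.size b x.2
  | .list a, l => 1 + (l.map (Ty.size a)).sum

theorem Ty.size_pos {F : Type} : (a : Ty) → (x : Ty.Val F a) → 1 ≤ Ty.size a x
  | .unit, _ => le_rfl
  | .bool, _ => le_rfl
  | .fld, _ => le_rfl
  | .prod a _, x => le_trans (Ty.size_pos a x.1) (Nat.le_add_right _ _)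
  | .list _, _ => Nat.le_add_right _ _

theorem Ty.length_lt_size {F : Type} (a : Ty) (l : List (Ty.Val F a)) :
    l.length + 1 ≤ Ty.size (.list a) l := by
  have : l.length ≤ (l.map (Ty.size a)).sum := by
    induction l with
    | nil => simp
    | cons y l ih => have := Ty.size_pos a y; simp; omega
  simp only [Ty.size]; omega

@[simp] theorem Ty.size_nil {F : Type} (a : Ty) :
    Ty.size (F := F) (.list a) ([] : List (Ty.Val F a)) = 1 := by simp [Ty.size]

@[simp] theorem Ty.size_cons {F : Type} (a : Ty) (y : Ty.Val F a) (l : List (Ty.Val F a)) :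
    Ty.size (F := F) (.list a) (y :: l : List (Ty.Val F a)) =
      Ty.size a y + Ty.size (.list a) l := by
  simp [Ty.size]; omega

@[simp] theorem Ty.size_append {F : Type} (a : Ty) (l l' : List (Ty.Val F a)) :
    Ty.size (F := F) (.list a) (l ++ l' : List (Ty.Val F a)) + 1 =
      Ty.size (.list a) l + Ty.size (.list a) l' := by
  simp [Ty.size]; omega

theorem Ty.size_prod {F : Type} (a b : Ty) (x : Ty.Val F (.prod a b)) :
    Ty.size (F := F) (.prod a b) x = Ty.size a x.1 + Ty.size b x.2 := rfl

theorem Ty.size_pair {F : Type} (a b : Ty) (x : Ty.Val F a) (y : Ty.Val F b) :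
    Ty.size (F := F) (.prod a b) (x, y) = Ty.size a x + Ty.size b y := rfl

theorem Ty.size_le_of_mem {F : Type} (a : Ty) {l : List (Ty.Val F a)} {y : Ty.Val F a}
    (h : y ∈ l) : Ty.size a y + 1 ≤ Ty.size (.list a) l := by
  have := List.single_le_sum (l := l.map (Ty.size a)) (by simp) _ (List.mem_map_of_mem h)
  simp only [Ty.size]; omega

theorem Ty.size_list_le {F : Type} (a : Ty) (l : List (Ty.Val F a)) (B : ℕ)
    (h : ∀ y ∈ l, Ty.size a y ≤ B) : Ty.size (.list a) l ≤ 1 + l.length * B := by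
  have := List.sum_le_card_nsmul (l.map (Ty.size a)) B (by simpa using h)
  simp only [Ty.size]; simpa using this

theorem natPoly_mono (T : Polynomial ℕ) {m n : ℕ} (h : m ≤ n) : T.eval m ≤ T.eval n := by
  induction T using Polynomial.induction_on' with
  | add p q hp hq => simpa using add_le_add hp hq
  | monomial i c => simpa using Nat.mul_le_mul_left c (Nat.pow_le_pow_left h i)

/-- A family of functions over the fields, computed by one program, with time and output size
bounded by a polynomial in the input size. -/
def PolyTime (a b : Ty)
    (f : ∀ (F : Type) [Field F] [DecidableEq F], Ty.Val F a → Ty.Val F b) : Prop :=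
  ∃ (P : Prog a b) (T : Polynomial ℕ), ∀ (F : Type) [Field F] [DecidableEq F] (x : Ty.Val F a),
    P.eval x = f F x ∧ P.time x ≤ T.eval (Ty.size a x) ∧
      Ty.size b (f F x) ≤ T.eval (Ty.size a x)

namespace PolyTime

variable {a b c d : Ty}

theorem id : PolyTime a a (fun _ _ _ x => x) :=
  ⟨.id, Polynomial.X, fun F _ _ x => ⟨by simp [Prog.eval],
    by simpa [Prog.time] using Ty.size_pos a x, by simp⟩⟩

/-- The output-size clause of `PolyTime` is what makes this work: it bounds the input on which the
outer program runs. -/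
theorem comp {f : ∀ (F : Type) [Field F] [DecidableEq F], Ty.Val F b → Ty.Val F c}
    {g : ∀ (F : Type) [Field F] [DecidableEq F], Ty.Val F a → Ty.Val F b}
    (hf : PolyTime b c f) (hg : PolyTime a b g) : PolyTime a c (fun F _ _ x => f F (g F x)) := by
  obtain ⟨P, T, hP⟩ := hf
  obtain ⟨Q, S, hQ⟩ := hg
  refine ⟨.comp P Q, 1 + S + T.comp S, fun F _ _ x => ?_⟩
  obtain ⟨h1, h2, h3⟩ := hQ F x
  obtain ⟨h4, h5, h6⟩ := hP F (g F x)
  have := natPoly_mono T h3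
  simp only [Prog.eval, Prog.time, h1, h4, eval_add, eval_one, eval_comp, true_and]
  omega

theorem pair {f : ∀ (F : Type) [Field F] [DecidableEq F], Ty.Val F a → Ty.Val F b}
    {g : ∀ (F : Type) [Field F] [DecidableEq F], Ty.Val F a → Ty.Val F c}
    (hf : PolyTime a b f) (hg : PolyTime a c g) :
    PolyTime a (.prod b c) (fun F _ _ x => (f F x, g F x)) := by
  obtain ⟨P, T, hP⟩ := hf
  obtain ⟨Q, S, hQ⟩ := hg
  refine ⟨.pair P Q, 1 + S + T, fun F _ _ x => ?_⟩
  obtain ⟨h1, h2, h3⟩ := hQ F x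
  obtain ⟨h4, h5, h6⟩ := hP F x
  simp only [Prog.eval, Prog.time, h1, h4, eval_add, eval_one, true_and, Ty.size]
  omega

theorem fst {f : ∀ (F : Type) [Field F] [DecidableEq F], Ty.Val F a → Ty.Val F (.prod b c)}
    (hf : PolyTime a (.prod b c) f) : PolyTime a b (fun F _ _ x => (f F x).1) := by
  refine comp (f := fun F _ _ (x : Ty.Val F (.prod b c)) => x.1)
    ⟨.fst, Polynomial.X, fun F _ _ x => ⟨by simp [Prog.eval], ?_, ?_⟩⟩ hf
  · simpa [Prog.time] using Ty.size_pos _ x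
  · simp [Ty.size]

theorem snd {f : ∀ (F : Type) [Field F] [DecidableEq F], Ty.Val F a → Ty.Val F (.prod b c)}
    (hf : PolyTime a (.prod b c) f) : PolyTime a c (fun F _ _ x => (f F x).2) := by
  refine comp (f := fun F _ _ (x : Ty.Val F (.prod b c)) => x.2)
    ⟨.snd, Polynomial.X, fun F _ _ x => ⟨by simp [Prog.eval], ?_, ?_⟩⟩ hf
  · simpa [Prog.time] using Ty.size_pos _ x
  · simp [Ty.size]

theorem unit : PolyTime a .unit (fun _ _ _ _ => ()) :=
  ⟨.unit, 1, fun F _ _ x => ⟨by simp [Prog.eval], by simp [Prog.time], by simp [Ty.size]⟩⟩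

theorem zero : PolyTime a .fld (fun _ _ _ _ => 0) :=
  ⟨.zero, 1, fun F _ _ x => ⟨by simp [Prog.eval], by simp [Prog.time], by simp [Ty.size]⟩⟩

theorem one : PolyTime a .fld (fun _ _ _ _ => 1) :=
  ⟨.one, 1, fun F _ _ x => ⟨by simp [Prog.eval], by simp [Prog.time], by simp [Ty.size]⟩⟩

theorem nil : PolyTime a (.list b) (fun _ _ _ _ => []) :=
  ⟨.nil, 1, fun F _ _ x => ⟨by simp [Prog.eval], by simp [Prog.time], by simp [Ty.size]⟩⟩

theorem add {f g : ∀ (F : Type) [Field F] [DecidableEq F], Ty.Val F a → Ty.Val F .fld}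
    (hf : PolyTime a .fld f) (hg : PolyTime a .fld g) :
    PolyTime a .fld (fun F _ _ x => (f F x + g F x : F)) :=
  comp (f := fun F _ _ (x : Ty.Val F (.prod .fld .fld)) => (x.1 + x.2 : F))
    ⟨.add, 1, fun F _ _ x => ⟨by simp [Prog.eval], by simp [Prog.time], by simp [Ty.size]⟩⟩
    (pair hf hg)

theorem sub {f g : ∀ (F : Type) [Field F] [DecidableEq F], Ty.Val F a → Ty.Val F .fld}
    (hf : PolyTime a .fld f) (hg : PolyTime a .fld g) :
    PolyTime a .fld (fun F _ _ x => (f F x - g F x : F)) :=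
  comp (f := fun F _ _ (x : Ty.Val F (.prod .fld .fld)) => (x.1 - x.2 : F))
    ⟨.sub, 1, fun F _ _ x => ⟨by simp [Prog.eval], by simp [Prog.time], by simp [Ty.size]⟩⟩
    (pair hf hg)

theorem mul {f g : ∀ (F : Type) [Field F] [DecidableEq F], Ty.Val F a → Ty.Val F .fld}
    (hf : PolyTime a .fld f) (hg : PolyTime a .fld g) :
    PolyTime a .fld (fun F _ _ x => (f F x * g F x : F)) :=
  comp (f := fun F _ _ (x : Ty.Val F (.prod .fld .fld)) => (x.1 * x.2 : F))
    ⟨.mul, 1, fun F _ _ x => ⟨by simp [Prog.eval], by simp [Prog.time], by simp [Ty.size]⟩⟩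
    (pair hf hg)

theorem inv {f : ∀ (F : Type) [Field F] [DecidableEq F], Ty.Val F a → Ty.Val F .fld}
    (hf : PolyTime a .fld f) : PolyTime a .fld (fun F _ _ x => ((f F x : F)⁻¹ : F)) :=
  comp (f := fun F _ _ (x : Ty.Val F .fld) => ((x : F)⁻¹ : F))
    ⟨.inv, 1, fun F _ _ x => ⟨by simp [Prog.eval], by simp [Prog.time], by simp [Ty.size]⟩⟩ hf

theorem eqTest {f g : ∀ (F : Type) [Field F] [DecidableEq F], Ty.Val F a → Ty.Val F .fld}
    (hf : PolyTime a .fld f) (hg : PolyTime a .fld g) :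
    PolyTime a .bool (fun F _ _ x => decide ((f F x : F) = g F x)) :=
  comp (f := fun F _ _ (x : Ty.Val F (.prod .fld .fld)) => decide ((x.1 : F) = x.2))
    ⟨.eqTest, 1, fun F _ _ x => ⟨by simp [Prog.eval], by simp [Prog.time], by simp [Ty.size]⟩⟩
    (pair hf hg)

theorem cons {f : ∀ (F : Type) [Field F] [DecidableEq F], Ty.Val F a → Ty.Val F b}
    {g : ∀ (F : Type) [Field F] [DecidableEq F], Ty.Val F a → Ty.Val F (.list b)}
    (hf : PolyTime a b f) (hg : PolyTime a (.list b) g) :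
    PolyTime a (.list b) (fun F _ _ x => f F x :: g F x) :=
  comp (f := fun F _ _ (x : Ty.Val F (.prod b (.list b))) => x.1 :: x.2)
    ⟨.cons, Polynomial.X, fun F _ _ x => ⟨by simp [Prog.eval],
      by simpa [Prog.time] using Ty.size_pos _ x, by simp [Ty.size_prod]⟩⟩
    (pair hf hg)

theorem cond {h : ∀ (F : Type) [Field F] [DecidableEq F], Ty.Val F a → Ty.Val F .bool}
    {f g : ∀ (F : Type) [Field F] [DecidableEq F], Ty.Val F a → Ty.Val F b}
    (hh : PolyTime a .bool h) (hf : PolyTime a b f) (hg : PolyTime a b g) :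
    PolyTime a b (fun F _ _ x => bif h F x then f F x else g F x) := by
  obtain ⟨R, U, hR⟩ := hh
  obtain ⟨P, T, hP⟩ := hf
  obtain ⟨Q, S, hQ⟩ := hg
  refine ⟨.ite R P Q, 1 + U + S + T, fun F _ _ x => ?_⟩
  obtain ⟨h1, h2, h3⟩ := hQ F x
  obtain ⟨h4, h5, h6⟩ := hP F x
  obtain ⟨h7, h8, h9⟩ := hR F x
  simp only [Prog.eval, Prog.time, h1, h4, h7, eval_add, eval_one]
  generalize (h F x) = y
  change Bool at y
  cases y <;> simp <;> omega

/-- Case distinction on a list. -/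
theorem caseList {l : ∀ (F : Type) [Field F] [DecidableEq F], Ty.Val F a → Ty.Val F (.list b)}
    {f : ∀ (F : Type) [Field F] [DecidableEq F], Ty.Val F a → Ty.Val F c}
    {g : ∀ (F : Type) [Field F] [DecidableEq F], Ty.Val F a → Ty.Val F b → Ty.Val F (.list b) →
      Ty.Val F c}
    (hl : PolyTime a (.list b) l) (hf : PolyTime a c f)
    (hg : PolyTime (.prod a (.prod b (.list b))) c (fun F _ _ z => g F z.1 z.2.1 z.2.2)) :
    PolyTime a c (fun F _ _ x => List.casesOn (l F x) (f F x) (fun y l' => g F x y l')) := by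
  refine comp (f := fun F _ _ (x : Ty.Val F (.prod a (.list b))) =>
    List.casesOn x.2 (f F x.1) (fun y l' => g F x.1 y l')) ?_ (pair id hl)
  obtain ⟨P, T, hP⟩ := hf
  obtain ⟨Q, S, hQ⟩ := hg
  refine ⟨.caseList P Q, 1 + S + T, fun F _ _ x => ?_⟩
  obtain ⟨x, l⟩ := x
  obtain ⟨h4, h5, h6⟩ := hP F x
  have hm := natPoly_mono T (show Ty.size a x ≤ Ty.size (.prod a (.list b)) (x, l) from
    Nat.le_add_right _ _)
  change List (Ty.Val F b) at l
  cases l with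
  | nil =>
    simp only [Prog.eval, Prog.time, h4, eval_add, eval_one, true_and]
    omega
  | cons y l =>
    obtain ⟨h1, h2, h3⟩ := hQ F (x, y, l)
    have hs : Ty.size (.prod a (.prod b (.list b))) (x, y, l) =
      Ty.size (.prod a (.list b)) (x, (y :: l : List _)) :=
      congrArg (Ty.size a x + ·) (Ty.size_cons b y l).symm
    rw [hs] at h2 h3
    change Ty.size c (g F x y l) ≤ _ at h3
    simp only [Prog.eval, Prog.time, h1, eval_add, eval_one, true_and]
    omega

/-- A loop is polynomial-time if some measure of the state grows in a controlled way. -/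
theorem foldl_of_measure
    {step : ∀ (F : Type) [Field F] [DecidableEq F], Ty.Val F a → Ty.Val F c → Ty.Val F b →
      Ty.Val F c}
    {s : ∀ (F : Type) [Field F] [DecidableEq F], Ty.Val F a → Ty.Val F c}
    {l : ∀ (F : Type) [Field F] [DecidableEq F], Ty.Val F a → Ty.Val F (.list b)}
    (hstep : PolyTime (.prod a (.prod c b)) c (fun F _ _ z => step F z.1 z.2.1 z.2.2))
    (hs : PolyTime a c s) (hl : PolyTime a (.list b) l)
    (m : ∀ (F : Type), Ty.Val F c → ℕ) (B B₁ B₂ : Polynomial ℕ)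
    (hm : ∀ (F : Type) [Field F] [DecidableEq F] (x : Ty.Val F a) (s : Ty.Val F c)
      (y : Ty.Val F b), m F (step F x s y) ≤ m F s + B.eval (Ty.size a x + Ty.size b y))
    (h₁ : ∀ (F : Type) (s : Ty.Val F c), Ty.size c s ≤ B₁.eval (m F s))
    (h₂ : ∀ (F : Type) (s : Ty.Val F c), m F s ≤ B₂.eval (Ty.size c s)) :
    PolyTime a c (fun F _ _ x => (l F x).foldl (step F x) (s F x)) := by
  refine comp (f := fun F _ _ (x : Ty.Val F (.prod a (.prod c (.list b)))) =>
    x.2.2.foldl (step F x.1) x.2.1) ?_ (pair id (pair hs hl))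
  obtain ⟨P, T, hP⟩ := hstep
  -- In at most `N` rounds the measure rises from at most `B₂` by at most `N` times `B`, all
  -- evaluated at the input size `N`. `Z` is the resulting size bound for every intermediate state.
  set Z : Polynomial ℕ := B₁.comp (B₂ + Polynomial.X * B) with hZ
  set U : Polynomial ℕ := T.comp (Polynomial.X + Z) with hU
  refine ⟨.loop P, 2 + Polynomial.X * (1 + U) + Z, fun F _ _ x => ?_⟩
  obtain ⟨x, s, l⟩ := x
  change List (Ty.Val F b) at l
  have heval : (fun (s : Ty.Val F c) (y : Ty.Val F b) => P.eval (x, s, y)) = step F x := by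
    funext s y; exact (hP F (x, s, y)).1
  have hN : Ty.size (.prod a (.prod c (.list b))) (x, s, l) =
      Ty.size a x + (Ty.size c s + Ty.size (.list b) l) := rfl
  generalize Ty.size (.prod a (.prod c (.list b))) (x, s, l) = N at hN
  -- `r` counts the rounds already done, so that `r` plus the remaining length never exceeds `N`.
  have key : ∀ (l' : List (Ty.Val F b)) (s' : Ty.Val F c) (r : ℕ),
      Ty.size a x + Ty.size (.list b) l' ≤ N → r + l'.length ≤ N →
      m F s' ≤ B₂.eval N + r * B.eval N →
      Ty.size c (l'.foldl (step F x) s') ≤ Z.eval N ∧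
        loopTime (step F x) (fun s y => P.time (x, s, y)) s' l' ≤
          1 + l'.length * (1 + U.eval N) := by
    intro l'
    induction l' with
    | nil =>
      intro s' r hx hr hms
      constructor
      · simp only [List.foldl_nil]
        refine (h₁ F s').trans ?_
        simp only [hZ, eval_comp, eval_add, eval_mul, eval_X]
        refine natPoly_mono _ (hms.trans ?_)
        have : r ≤ N := by omega
        gcongr
      · simp [loopTime]
    | cons y l' ih =>
      intro s' r hx hr hms
      simp only [Ty.size_cons, List.length_cons] at hx hr
      have h3 : m F (step F x s' y) ≤ B₂.eval N + (r + 1) * B.eval N := by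
        have := hm F x s' y
        have h4 := natPoly_mono B (show Ty.size a x + Ty.size b y ≤ N by omega)
        rw [add_mul]; omega
      obtain ⟨i1, i2⟩ := ih (step F x s' y) (r + 1) (by have := Ty.size_pos b y; omega) (by omega) h3
      refine ⟨by simpa using i1, ?_⟩
      have h5 : Ty.size c s' ≤ Z.eval N := by
        refine (h₁ F s').trans ?_
        simp only [hZ, eval_comp, eval_add, eval_mul, eval_X]
        refine natPoly_mono _ (hms.trans ?_)
        have : r ≤ N := by omega
        gcongr
      have h6 : P.time (x, s', y) ≤ U.eval N := by
        refine (hP F (x, s', y)).2.1.trans ?_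
        simp only [hU, eval_comp, eval_add, eval_X]
        refine natPoly_mono _ ?_
        change Ty.size a x + (Ty.size c s' + Ty.size b y) ≤ _
        have := Ty.size_pos (.list b) l'
        omega
      simp only [loopTime, List.length_cons, add_mul, one_mul] at i2 ⊢
      omega
  have hlen := Ty.length_lt_size b l
  have hss : m F s ≤ B₂.eval N + 0 * B.eval N := by
    have := natPoly_mono B₂ (show Ty.size c s ≤ N by omega)
    have := h₂ F s
    omega
  obtain ⟨k1, k2⟩ := key l s 0 (by omega) (by omega) hss
  have h7 : l.length * (1 + U.eval N) ≤ N * (1 + U.eval N) := by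
    have : l.length ≤ N := by omega
    gcongr
  refine ⟨?_, ?_, ?_⟩
  · simp only [Prog.eval, heval]
  · simp only [Prog.time, heval, eval_add, eval_mul, eval_X, eval_one, eval_ofNat]
    omega
  · simp only [eval_add]
    omega

/-- A loop is polynomial-time if the size of the state grows in a controlled way. -/
theorem foldl
    {step : ∀ (F : Type) [Field F] [DecidableEq F], Ty.Val F a → Ty.Val F c → Ty.Val F b →
      Ty.Val F c}
    {s : ∀ (F : Type) [Field F] [DecidableEq F], Ty.Val F a → Ty.Val F c}
    {l : ∀ (F : Type) [Field F] [DecidableEq F], Ty.Val F a → Ty.Val F (.list b)}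
    (hstep : PolyTime (.prod a (.prod c b)) c (fun F _ _ z => step F z.1 z.2.1 z.2.2))
    (hs : PolyTime a c s) (hl : PolyTime a (.list b) l) (B : Polynomial ℕ)
    (hm : ∀ (F : Type) [Field F] [DecidableEq F] (x : Ty.Val F a) (s : Ty.Val F c)
      (y : Ty.Val F b),
      Ty.size c (step F x s y) ≤ Ty.size c s + B.eval (Ty.size a x + Ty.size b y)) :
    PolyTime a c (fun F _ _ x => (l F x).foldl (step F x) (s F x)) :=
  foldl_of_measure hstep hs hl (fun _ s => Ty.size c s) B Polynomial.X Polynomial.X hm (by simp)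
    (by simp)

end PolyTime

/-! ### A measure for lists of lists -/

/-- The length of a list of lists plus the largest length of its entries. -/
def Ty.nest {F : Type} (a : Ty) (s : List (List (Ty.Val F a))) : ℕ :=
  s.length + s.foldr (fun l m => max l.length m) 0

section nest

variable {F : Type} (a : Ty)

theorem Ty.foldr_max_le_iff (s : List (List (Ty.Val F a))) (B : ℕ) :
    s.foldr (fun l m => max l.length m) 0 ≤ B ↔ ∀ l ∈ s, l.length ≤ B := by
  induction s with
  | nil => simp
  | cons l s ih => simp [ih]

theorem Ty.nest_le (s : List (List (Ty.Val F a))) (A B : ℕ) (hA : s.length ≤ A)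
    (hB : ∀ l ∈ s, l.length ≤ B) : Ty.nest a s ≤ A + B :=
  add_le_add hA ((Ty.foldr_max_le_iff a s B).2 hB)

theorem Ty.length_add_length_le_nest {s : List (List (Ty.Val F a))} {l : List (Ty.Val F a)}
    (h : l ∈ s) : s.length + l.length ≤ Ty.nest a s :=
  Nat.add_le_add_left ((Ty.foldr_max_le_iff a s _).1 le_rfl l h) _

theorem Ty.length_le_nest (s : List (List (Ty.Val F a))) : s.length ≤ Ty.nest a s :=
  Nat.le_add_right _ _

theorem Ty.nest_cons_le (l : List (Ty.Val F a)) (s : List (List (Ty.Val F a))) (B : ℕ)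
    (hB : l.length ≤ B) : Ty.nest a (l :: s) ≤ Ty.nest a s + B + 1 := by
  simp only [Ty.nest, List.length_cons, List.foldr_cons]; omega

theorem Ty.nest_map_le {b : Ty} (f : List (Ty.Val F a) → List (Ty.Val F b))
    (s : List (List (Ty.Val F a))) (B : ℕ) (hB : ∀ l, (f l).length ≤ l.length + B) :
    Ty.nest b (s.map f) ≤ Ty.nest a s + B := by
  unfold Ty.nest
  rw [List.length_map, add_assoc]
  refine Nat.add_le_add_left ((Ty.foldr_max_le_iff b _ _).2 fun l' hl => ?_) _
  obtain ⟨l, hls, rfl⟩ := List.mem_map.1 hl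
  have := (Ty.foldr_max_le_iff a s _).1 le_rfl l hls
  have := hB l
  omega

theorem Ty.size_list_of_flat (ha : ∀ y : Ty.Val F a, Ty.size a y = 1) (l : List (Ty.Val F a)) :
    Ty.size (F := F) (.list a) l = 1 + l.length := by
  induction l with
  | nil => simp
  | cons y l ih => rw [Ty.size_cons, ih, List.length_cons, ha]; omega

/-- With `Ty.nest_le_size` this makes size and `Ty.nest` polynomially equivalent. Loops that
lengthen every entry of a list enlarge its size in proportion to the state, but `Ty.nest` only by a
constant. -/
theorem Ty.size_le_nest (ha : ∀ y : Ty.Val F a, Ty.size a y = 1)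
    (s : List (List (Ty.Val F a))) : Ty.size (F := F) (.list (.list a)) s ≤
      (1 + Polynomial.X * (1 + Polynomial.X) : Polynomial ℕ).eval (Ty.nest a s) := by
  refine (Ty.size_list_le (.list a) s (1 + Ty.nest a s) ?_).trans ?_
  · intro l hl
    have h := Ty.length_add_length_le_nest a hl
    have := Ty.size_list_of_flat a ha l
    omega
  · simp only [eval_add, eval_mul, eval_one, eval_X]
    have := Ty.length_le_nest a s
    gcongr

theorem Ty.nest_le_size (s : List (List (Ty.Val F a))) : Ty.nest a s ≤
      (2 * Polynomial.X : Polynomial ℕ).eval (Ty.size (F := F) (.list (.list a)) s) := by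
  have h1 := Ty.length_lt_size (F := F) (.list a) s
  have := Ty.nest_le a s _ (Ty.size (F := F) (.list (.list a)) s) le_rfl fun l hl => by
    have := Ty.size_le_of_mem (.list a) hl
    have := Ty.length_lt_size (F := F) a l
    omega
  simp only [eval_mul, eval_ofNat, eval_X]
  omega

end nest

/-! ### Polynomial-time list operations -/

namespace PolyTime

variable {a b c d : Ty}

theorem of_eq {f g : ∀ (F : Type) [Field F] [DecidableEq F], Ty.Val F a → Ty.Val F b}
    (hf : PolyTime a b f)
    (h : ∀ (F : Type) [Field F] [DecidableEq F] (x : Ty.Val F a), g F x = f F x) :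
    PolyTime a b g := by
  obtain ⟨P, T, hP⟩ := hf
  exact ⟨P, T, fun F _ _ x => by rw [h F x]; exact hP F x⟩

/-- The output size of a polynomial-time function is polynomially bounded. -/
theorem size_bound {f : ∀ (F : Type) [Field F] [DecidableEq F], Ty.Val F a → Ty.Val F b}
    (hf : PolyTime a b f) : ∃ T : Polynomial ℕ, ∀ (F : Type) [Field F] [DecidableEq F]
      (x : Ty.Val F a), Ty.size b (f F x) ≤ T.eval (Ty.size a x) := by
  obtain ⟨P, T, hP⟩ := hf
  exact ⟨T, fun F _ _ x => (hP F x).2.2⟩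

/-- Substitution into a function of two arguments. -/
theorem bind {f : ∀ (F : Type) [Field F] [DecidableEq F], Ty.Val F a → Ty.Val F b → Ty.Val F c}
    {g : ∀ (F : Type) [Field F] [DecidableEq F], Ty.Val F d → Ty.Val F a}
    {h : ∀ (F : Type) [Field F] [DecidableEq F], Ty.Val F d → Ty.Val F b}
    (hf : PolyTime (.prod a b) c (fun F _ _ z => f F z.1 z.2)) (hg : PolyTime d a g)
    (hh : PolyTime d b h) : PolyTime d c (fun F _ _ x => f F (g F x) (h F x)) :=
  comp (f := fun F _ _ (z : Ty.Val F (.prod a b)) => f F z.1 z.2) hf (pair hg hh)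

theorem reverse {l : ∀ (F : Type) [Field F] [DecidableEq F], Ty.Val F a → Ty.Val F (.list b)}
    (hl : PolyTime a (.list b) l) :
    PolyTime a (.list b) (fun F _ _ x => (l F x).reverse) := by
  refine of_eq (foldl (step := fun F _ _ _ s y => (y :: s : List (Ty.Val F b)))
    (s := fun _ _ _ _ => []) (c := .list b) (cons (snd (snd id)) (fst (snd id))) nil hl
    Polynomial.X ?_) ?_
  · intro F _ _ x s y
    simp only [Ty.size_cons, eval_X]; omega
  · intro F _ _ x
    have : ∀ l s : List (Ty.Val F b), l.foldl (fun s y => y :: s) s = l.reverse ++ s := by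
      intro l; induction l with
      | nil => simp
      | cons y l ih => intro s; simp [ih]
    exact ((this _ _).trans (by simp)).symm

theorem foldr_of_measure
    {step : ∀ (F : Type) [Field F] [DecidableEq F], Ty.Val F a → Ty.Val F b → Ty.Val F c →
      Ty.Val F c}
    {s : ∀ (F : Type) [Field F] [DecidableEq F], Ty.Val F a → Ty.Val F c}
    {l : ∀ (F : Type) [Field F] [DecidableEq F], Ty.Val F a → Ty.Val F (.list b)}
    (hstep : PolyTime (.prod a (.prod c b)) c (fun F _ _ z => step F z.1 z.2.2 z.2.1))
    (hs : PolyTime a c s) (hl : PolyTime a (.list b) l)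
    (m : ∀ (F : Type), Ty.Val F c → ℕ) (B B₁ B₂ : Polynomial ℕ)
    (hm : ∀ (F : Type) [Field F] [DecidableEq F] (x : Ty.Val F a) (s : Ty.Val F c)
      (y : Ty.Val F b), m F (step F x y s) ≤ m F s + B.eval (Ty.size a x + Ty.size b y))
    (h₁ : ∀ (F : Type) (s : Ty.Val F c), Ty.size c s ≤ B₁.eval (m F s))
    (h₂ : ∀ (F : Type) (s : Ty.Val F c), m F s ≤ B₂.eval (Ty.size c s)) :
    PolyTime a c (fun F _ _ x => (l F x).foldr (step F x) (s F x)) :=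
  of_eq (foldl_of_measure (step := fun F _ _ x s y => step F x y s) hstep hs (reverse hl) m B B₁ B₂
    hm h₁ h₂) (fun F _ _ x => by simp)

theorem foldr
    {step : ∀ (F : Type) [Field F] [DecidableEq F], Ty.Val F a → Ty.Val F b → Ty.Val F c →
      Ty.Val F c}
    {s : ∀ (F : Type) [Field F] [DecidableEq F], Ty.Val F a → Ty.Val F c}
    {l : ∀ (F : Type) [Field F] [DecidableEq F], Ty.Val F a → Ty.Val F (.list b)}
    (hstep : PolyTime (.prod a (.prod c b)) c (fun F _ _ z => step F z.1 z.2.2 z.2.1))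
    (hs : PolyTime a c s) (hl : PolyTime a (.list b) l) (B : Polynomial ℕ)
    (hm : ∀ (F : Type) [Field F] [DecidableEq F] (x : Ty.Val F a) (s : Ty.Val F c)
      (y : Ty.Val F b),
      Ty.size c (step F x y s) ≤ Ty.size c s + B.eval (Ty.size a x + Ty.size b y)) :
    PolyTime a c (fun F _ _ x => (l F x).foldr (step F x) (s F x)) :=
  foldr_of_measure hstep hs hl (fun _ s => Ty.size c s) B Polynomial.X Polynomial.X hm (by simp)
    (by simp)

theorem append {l l' : ∀ (F : Type) [Field F] [DecidableEq F], Ty.Val F a → Ty.Val F (.list b)}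
    (hl : PolyTime a (.list b) l) (hl' : PolyTime a (.list b) l') :
    PolyTime a (.list b) (fun F _ _ x => (l F x ++ l' F x : List (Ty.Val F b))) := by
  refine of_eq (foldr (step := fun F _ _ _ y s => (y :: s : List (Ty.Val F b)))
    (c := .list b) (cons (snd (snd id)) (fst (snd id))) hl' hl Polynomial.X ?_) ?_
  · intro F _ _ x s y
    simp only [Ty.size_cons, eval_X]; omega
  · intro F _ _ x
    simp

theorem map {f : ∀ (F : Type) [Field F] [DecidableEq F], Ty.Val F a → Ty.Val F b → Ty.Val F c}
    {l : ∀ (F : Type) [Field F] [DecidableEq F], Ty.Val F a → Ty.Val F (.list b)}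
    (hf : PolyTime (.prod a b) c (fun F _ _ z => f F z.1 z.2)) (hl : PolyTime a (.list b) l) :
    PolyTime a (.list c) (fun F _ _ x => (l F x).map (f F x)) := by
  obtain ⟨T, hT⟩ := hf.size_bound
  refine of_eq (foldr (step := fun F _ _ x y s => (f F x y :: s : List (Ty.Val F c)))
    (c := .list c) (s := fun _ _ _ _ => [])
    (cons (bind (f := f) hf (fst id) (snd (snd id))) (fst (snd id))) nil hl T ?_) ?_
  · intro F _ _ x s y
    have := hT F (x, y)
    simp only [Ty.size_cons]
    change Ty.size c (f F x y) ≤ eval (Ty.size a x + Ty.size b y) T at this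
    omega
  · intro F _ _ x
    exact List.map_eq_foldr

theorem flatMap
    {f : ∀ (F : Type) [Field F] [DecidableEq F], Ty.Val F a → Ty.Val F b → Ty.Val F (.list c)}
    {l : ∀ (F : Type) [Field F] [DecidableEq F], Ty.Val F a → Ty.Val F (.list b)}
    (hf : PolyTime (.prod a b) (.list c) (fun F _ _ z => f F z.1 z.2))
    (hl : PolyTime a (.list b) l) :
    PolyTime a (.list c) (fun F _ _ x => (l F x).flatMap (f F x)) := by
  obtain ⟨T, hT⟩ := hf.size_bound
  refine of_eq (foldr (step := fun F _ _ x y s => (f F x y ++ s : List (Ty.Val F c)))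
    (c := .list c) (s := fun _ _ _ _ => [])
    (append (bind (f := f) hf (fst id) (snd (snd id))) (fst (snd id))) nil hl T ?_) ?_
  · intro F _ _ x s y
    have := hT F (x, y)
    have h2 := Ty.size_append c (f F x y) s
    change Ty.size (.list c) (f F x y) ≤ eval (Ty.size a x + Ty.size b y) T at this
    omega
  · intro F _ _ x
    generalize l F x = l
    change List (Ty.Val F b) at l
    induction l with
    | nil => rfl
    | cons y l ih => exact (List.flatMap_cons).trans (congrArg (f F x y ++ ·) ih)

theorem filter {f : ∀ (F : Type) [Field F] [DecidableEq F], Ty.Val F a → Ty.Val F b → Bool}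
    {l : ∀ (F : Type) [Field F] [DecidableEq F], Ty.Val F a → Ty.Val F (.list b)}
    (hf : PolyTime (.prod a b) .bool (fun F _ _ z => f F z.1 z.2)) (hl : PolyTime a (.list b) l) :
    PolyTime a (.list b) (fun F _ _ x => (l F x).filter (f F x)) := by
  refine of_eq (flatMap (f := fun F _ _ x y => (bif f F x y then [y] else [] : List (Ty.Val F b)))
    (cond hf (cons (snd id) nil) nil) hl) ?_
  intro F _ _ x
  generalize l F x = l
  change List (Ty.Val F b) at l
  induction l with
  | nil => rfl
  | cons y l ih =>
    rw [List.flatMap_cons, List.filter_cons, ih]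
    cases f F x y <;> rfl

/-- The language has no boolean constants; they arise from equality tests between `0` and `1`. -/
theorem true : PolyTime a .bool (fun _ _ _ _ => Bool.true) :=
  of_eq (eqTest zero zero) (by simp)

theorem false : PolyTime a .bool (fun _ _ _ _ => Bool.false) :=
  of_eq (eqTest zero one) (by simp)

theorem and {f g : ∀ (F : Type) [Field F] [DecidableEq F], Ty.Val F a → Bool}
    (hf : PolyTime a .bool f) (hg : PolyTime a .bool g) :
    PolyTime a .bool (fun F _ _ x => f F x && g F x) :=
  of_eq (cond hf hg false) (fun F _ _ x => by cases f F x <;> rfl)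

theorem or {f g : ∀ (F : Type) [Field F] [DecidableEq F], Ty.Val F a → Bool}
    (hf : PolyTime a .bool f) (hg : PolyTime a .bool g) :
    PolyTime a .bool (fun F _ _ x => f F x || g F x) :=
  of_eq (cond hf true hg) (fun F _ _ x => by cases f F x <;> rfl)

theorem not {f : ∀ (F : Type) [Field F] [DecidableEq F], Ty.Val F a → Bool}
    (hf : PolyTime a .bool f) : PolyTime a .bool (fun F _ _ x => !f F x) :=
  of_eq (cond hf false true) (fun F _ _ x => by cases f F x <;> rfl)

theorem all {f : ∀ (F : Type) [Field F] [DecidableEq F], Ty.Val F a → Ty.Val F b → Bool}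
    {l : ∀ (F : Type) [Field F] [DecidableEq F], Ty.Val F a → Ty.Val F (.list b)}
    (hf : PolyTime (.prod a b) .bool (fun F _ _ z => f F z.1 z.2)) (hl : PolyTime a (.list b) l) :
    PolyTime a .bool (fun F _ _ x => (l F x).all (f F x)) := by
  refine of_eq (foldr (step := fun F _ _ x y s => (f F x y && s : Bool))
    (c := .bool) (s := fun _ _ _ _ => Bool.true)
    (and (bind (c := .bool) (f := f) hf (fst id) (snd (snd id))) (fst (snd id))) true hl 0 ?_) ?_
  · intro F _ _ x s y
    simp [Ty.size]
  · intro F _ _ x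
    generalize l F x = l
    change List (Ty.Val F b) at l
    induction l with
    | nil => rfl
    | cons y l ih => rw [List.all_cons, ih, List.foldr_cons]

theorem isEmpty {l : ∀ (F : Type) [Field F] [DecidableEq F], Ty.Val F a → Ty.Val F (.list b)}
    (hl : PolyTime a (.list b) l) : PolyTime a .bool (fun F _ _ x => (l F x).isEmpty) :=
  of_eq (caseList (g := fun _ _ _ _ _ _ => Bool.false) hl true false)
    (fun F _ _ x => by
      generalize l F x = l'
      change List (Ty.Val F b) at l'
      cases l' <;> rfl)

theorem tail {l : ∀ (F : Type) [Field F] [DecidableEq F], Ty.Val F a → Ty.Val F (.list b)}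
    (hl : PolyTime a (.list b) l) : PolyTime a (.list b) (fun F _ _ x => (l F x).tail) :=
  of_eq (caseList (g := fun F _ _ _ _ l' => (l' : List (Ty.Val F b))) hl nil (snd (snd id)))
    (fun F _ _ x => by
      generalize l F x = l'
      change List (Ty.Val F b) at l'
      cases l' <;> rfl)

theorem headD {l : ∀ (F : Type) [Field F] [DecidableEq F], Ty.Val F a → Ty.Val F (.list b)}
    {f : ∀ (F : Type) [Field F] [DecidableEq F], Ty.Val F a → Ty.Val F b}
    (hl : PolyTime a (.list b) l) (hf : PolyTime a b f) :
    PolyTime a b (fun F _ _ x => (l F x).headD (f F x)) :=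
  of_eq (caseList (g := fun F _ _ _ y _ => y) hl hf (fst (snd id)))
    (fun F _ _ x => by
      generalize l F x = l'
      change List (Ty.Val F b) at l'
      cases l' <;> rfl)

/-- Dropping a number of entries given in unary. -/
theorem drop {l : ∀ (F : Type) [Field F] [DecidableEq F], Ty.Val F a → Ty.Val F (.list b)}
    {n : ∀ (F : Type) [Field F] [DecidableEq F], Ty.Val F a → Ty.Val F (.list c)}
    (hl : PolyTime a (.list b) l) (hn : PolyTime a (.list c) n) :
    PolyTime a (.list b) (fun F _ _ x => (l F x).drop (n F x).length) := by
  refine of_eq (foldr (step := fun F _ _ _ _ s => (s.tail : List (Ty.Val F b)))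
    (c := .list b) (tail (fst (snd id))) hl hn 0 ?_) ?_
  · intro F _ _ x s y
    cases s <;> simp
  · intro F _ _ x
    generalize n F x = n
    change List (Ty.Val F c) at n
    induction n with
    | nil => rfl
    | cons y l' ih =>
      simp only [List.foldr_cons, List.length_cons]
      rw [← ih, List.tail_drop]

/-- A loop runs through one list only. The other list is carried in the state and consumed entry by
entry, and the pairs accumulate in reverse order. -/
theorem zip {l : ∀ (F : Type) [Field F] [DecidableEq F], Ty.Val F a → Ty.Val F (.list b)}
    {l' : ∀ (F : Type) [Field F] [DecidableEq F], Ty.Val F a → Ty.Val F (.list c)}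
    (hl : PolyTime a (.list b) l) (hl' : PolyTime a (.list c) l') :
    PolyTime a (.list (.prod b c)) (fun F _ _ x => (l F x).zip (l' F x)) := by
  refine of_eq (reverse (snd (foldl
    (step := fun F _ _ _ (s : Ty.Val F (.prod (.list c) (.list (.prod b c)))) (y : Ty.Val F b) =>
      List.casesOn s.1 (([], s.2) : List (Ty.Val F c) × List (Ty.Val F b × Ty.Val F c))
        (fun z l' => (l', (y, z) :: s.2)))
    (s := fun F _ _ x => (l' F x, []))
    (b := b) (c := .prod (.list c) (.list (.prod b c)))
    (caseList (fst (fst (snd id))) (pair nil (snd (fst (snd id))))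
      (a := .prod a (.prod (.prod (.list c) (.list (.prod b c))) b)) (b := c)
      (c := .prod (.list c) (.list (.prod b c)))
      (g := fun F _ _ (z : Ty.Val F (.prod a (.prod (.prod (.list c) (.list (.prod b c))) b)))
        y l' => (l', (z.2.2, y) :: z.2.1.2))
      (pair (snd (snd id)) (cons (pair (snd (snd (fst id))) (fst (snd id)))
        (snd (fst (snd (fst id)))))))
    (pair hl' nil) hl Polynomial.X ?_))) ?_
  · rintro F _ _ x ⟨s, s'⟩ y
    change List (Ty.Val F c) at s
    cases s with
    | nil => simp only [Ty.size_prod, Ty.size_nil]; omega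
    | cons z s =>
      have h := Ty.size_cons (F := F) (.prod b c) (y, z) s'
      have h' := Ty.size_pair (F := F) b c y z
      change Ty.size (.list c) s + Ty.size (.list (.prod b c)) ((y, z) :: s' : List _) ≤
        Ty.size (.list c) (z :: s : List _) + Ty.size (.list (.prod b c)) s' + _
      rw [h, h', Ty.size_cons, eval_X]
      omega
  · intro F _ _ x
    have : ∀ (l : List (Ty.Val F b)) (l' : List (Ty.Val F c)) (s : List (Ty.Val F b × Ty.Val F c)),
      (l.foldl (fun (s : List (Ty.Val F c) × List (Ty.Val F b × Ty.Val F c)) (y : Ty.Val F b) =>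
        (List.casesOn s.1 (([], s.2) : List (Ty.Val F c) × List (Ty.Val F b × Ty.Val F c))
          (fun z l' => (l', (y, z) :: s.2)) :
            List (Ty.Val F c) × List (Ty.Val F b × Ty.Val F c))) (l', s)).2 =
          (l.zip l').reverse ++ s := by
      intro l
      induction l with
      | nil => intro l' s; simp
      | cons y l ih =>
        intro l' s
        cases l' with
        | nil => rw [List.foldl_cons, ih]; simp
        | cons z l' => rw [List.foldl_cons, ih]; simp
    rw [this]; simp

/-- The numbers less than a given one, all in unary. -/
theorem range {n : ∀ (F : Type) [Field F] [DecidableEq F], Ty.Val F a → Ty.Val F (.list b)}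
    (hn : PolyTime a (.list b) n) :
    PolyTime a (.list (.list .unit))
      (fun F _ _ x => (List.range (n F x).length).map fun i => List.replicate i ()) := by
  -- Each round adds one to all numbers found so far and prepends zero. The size grows by the length
  -- of the state, hence the measure `Ty.nest`.
  refine of_eq (foldr_of_measure (c := .list (.list .unit))
    (step := fun F _ _ _ _ s => ([] :: s.map (fun l => (() :: l : List Unit)) : List (List Unit)))
    (s := fun F _ _ x => [])
    (cons nil (map (b := .list .unit) (c := .list .unit) (f := fun F _ _ _ l => (() :: l : List Unit))
      (cons unit (snd id)) (fst (snd id)))) nil hn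
    (fun _ s => Ty.nest .unit s) 2
    (1 + Polynomial.X * (1 + Polynomial.X)) (2 * Polynomial.X) ?_
    (fun F => Ty.size_le_nest .unit (fun _ => rfl)) (fun F => Ty.nest_le_size .unit)) ?_
  · intro F _ _ x s y
    have := Ty.nest_cons_le (F := F) .unit [] (s.map (fun l => (() :: l : List Unit))) 0 (by simp)
    have h2 := Ty.nest_map_le (F := F) .unit (b := .unit) (fun l => (() :: l : List Unit)) s 1
      (fun l => le_rfl)
    rw [eval_ofNat]
    exact this.trans (Nat.add_le_add_right h2 1)
  · intro F _ _ x
    generalize n F x = n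
    change List (Ty.Val F b) at n
    induction n with
    | nil => rfl
    | cons y l ih =>
      rw [List.foldr_cons, ← ih, List.length_cons, List.range_succ_eq_map]
      simp [List.replicate_succ]

end PolyTime

/-! ### The reconstruction program as functions on lists -/

namespace ListAlg

/-- Entrywise addition of lists, the shorter one being padded. -/
def zipAdd {A : Type} (add : A → A → A) (l l' : List A) : List A :=
  (l.zip l').map (fun p => add p.1 p.2) ++ (l.drop l'.length ++ l'.drop l.length)

/-- Multiplication of polynomials given by coefficient lists. -/
def conv {A : Type} (add mul : A → A → A) (z : A) (l l' : List A) : List A :=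
  l.foldr (fun a acc => zipAdd add (l'.map fun b => mul a b) (z :: acc)) []

/-- `a < b` for numbers in unary. -/
def ltU (m n : List Unit) : Bool := !(n.drop m.length).isEmpty

/-- `a ≤ b` for numbers in unary. -/
def leU (m n : List Unit) : Bool := (m.drop n.length).isEmpty

/-- The numbers less than a given one, in unary. -/
def rangeU {A : Type} (n : List A) : List (List Unit) :=
  (List.range n.length).map fun i => List.replicate i ()

/-- The first entries of a list, their number being given in unary. -/
def takeU {A B : Type} (l : List A) (n : List B) : List A := (l.zip n).map fun p => p.1

variable {F : Type} [Field F] [DecidableEq F]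

/-- Polynomial addition. -/
def padd (p q : List F) : List F := zipAdd (fun x y => x + y) p q

/-- Polynomial multiplication. -/
def pmul (p q : List F) : List F := conv (fun x y => x + y) (fun x y => x * y) 0 p q

/-- Scaling of a polynomial. -/
def psmul (c : F) (p : List F) : List F := p.map fun x => c * x

/-- Polynomial powers. -/
def ppow (p : List F) (n : List Unit) : List F := n.foldr (fun _ q => pmul p q) [1]

/-- Evaluation of a polynomial. -/
def peval (p : List F) (x : F) : F := p.foldr (fun c acc => c + x * acc) 0

/-- The test for the zero polynomial. -/
def isZero (p : List F) : Bool := p.all fun c => decide (c = 0)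

/-- Bivariate addition. -/
def padd₂ (p q : List (List F)) : List (List F) := zipAdd padd p q

/-- Bivariate multiplication. -/
def pmul₂ (p q : List (List F)) : List (List F) := conv padd pmul [] p q

/-- Bivariate powers. -/
def ppow₂ (p : List (List F)) (n : List Unit) : List (List F) :=
  n.foldr (fun _ q => pmul₂ p q) [[1]]

/-- Bivariate test for zero. -/
def isZero₂ (p : List (List F)) : Bool := p.all fun c => isZero c

/-- Equality of words. -/
def eqW (p q : List F) : Bool :=
  ((p.drop q.length).isEmpty && (q.drop p.length).isEmpty) &&
    (p.zip q).all fun z => decide (z.1 = z.2)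

/-- The word with the strictly largest score, as a list of length at most one. -/
def uniqueMax (l : List (List F × List Unit)) : List (List F) :=
  takeU ((l.filter fun x => l.all fun y => eqW y.1 x.1 || ltU y.2 x.2).map fun x => x.1) [()]

/-- `μ` times the number of occurrences of `v`. -/
def count (μ : List Unit) (col : List F) (v : F) : List Unit :=
  (col.filter fun u => decide (u = v)).flatMap fun _ => μ

/-- The multiplicity at `v` in the column with the given reads. -/
def mult (δ : List F) (μ : List Unit) (col : List F) (v : F) : List Unit :=
  List.casesOn (uniqueMax (δ.map fun u => ([u], count μ col u))) (count μ col v)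
    fun u _ => bif (count μ col (u.headD 0)).tail.isEmpty then count μ col v
      else bif eqW [v] u then col.flatMap fun _ => μ else []

/-- The evaluation points with the columns of reads. -/
def points (α : List F) (Y : List (List F)) : List (F × List F) :=
  Y.foldr (fun y acc => (y.zip acc).map fun z => (z.2.1, z.1 :: z.2.2)) (α.map fun x => (x, []))

/-- The interpolation constraints `(a, v, r, s)` for multiplicity `M` at `(a, v)`: the coefficient
of `X ^ r Y ^ s` in `Q(X + a, Y + v)` vanishes. -/
def constraintsAt (M : List Unit) (a v : F) : List (F × F × List Unit × List Unit) :=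
  (rangeU M).flatMap fun r => (rangeU (M.drop r.length)).map fun s => (a, v, r, s)

/-- The list of all interpolation constraints. -/
def constraints (δ : List F) (μ : List Unit) (pts : List (F × List F)) :
    List (F × F × List Unit × List Unit) :=
  pts.flatMap fun pt => δ.flatMap fun v => constraintsAt (mult δ μ pt.2 v) pt.1 v

/-- The exponents `(i, j)` with `i, j ≤ C` and `i + (k - 1) j ≤ w`, for `C` constraints. -/
def monos {A : Type} (cs : List A) (k w : List Unit) : List (List Unit × List Unit) :=
  (rangeU cs ++ [cs.map fun _ => ()]).flatMap fun i =>
    ((rangeU cs ++ [cs.map fun _ => ()]).filter fun j =>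
      leU (i ++ j.flatMap fun _ => k.tail) w).map fun j => (i, j)

/-- The value of a constraint at a monomial. -/
def constraintVal (c : F × F × List Unit × List Unit) (m : List Unit × List Unit) : F :=
  ((ppow [c.1, 1] m.1).drop c.2.2.1.length).headD 0 *
    ((ppow [c.2.1, 1] m.2).drop c.2.2.2.length).headD 0

/-- The dot product. -/
def dot (p q : List F) : F := (p.zip q).foldr (fun z acc => z.1 * z.2 + acc) 0

/-- One elimination step: generators of the intersection of the span of `L` with the kernel of
`D`. -/
def elim (D : List F) (L : List (List F)) : List (List F) :=
  List.casesOn (L.filter fun g => !decide (dot D g = 0)) L fun p _ =>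
    (L.map fun g => padd g (psmul (0 - dot D g * (dot D p)⁻¹) p)).filter fun g => !isZero g

/-- The unit vectors. -/
def unitVecs {A : Type} (F : Type) [Field F] (ms : List A) : List (List F) :=
  (rangeU ms).map fun t => (t.map fun _ => 0) ++ [1]

/-- Generators of the space of polynomials with the given exponents that satisfy the
constraints. -/
def kernelGens (cs : List (F × F × List Unit × List Unit)) (ms : List (List Unit × List Unit)) :
    List (List F) :=
  cs.foldr (fun c L => elim (ms.map fun m => constraintVal c m) L) (unitVecs F ms)

/-- The interpolation polynomial, as a list of terms. -/
def interpolate (cs : List (F × F × List Unit × List Unit)) (k : List Unit) :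
    List (F × List Unit × List Unit) :=
  ((rangeU cs ++ [cs.map fun _ => ()]).flatMap fun w =>
    (kernelGens cs (monos cs k w)).map fun g => g.zip (monos cs k w)).headD []

/-- The result of the substitution of `f` for `Y`. -/
def substY (Q : List (F × List Unit × List Unit)) (f : List (List F)) : List (List F) :=
  Q.foldr (fun t acc => padd₂ ((t.2.1.map fun _ => []) ++
    (ppow₂ f t.2.2).map fun p => psmul t.1 p) acc) []

/-- The extensions of the prefix `g` by one coefficient. -/
def children (δ : List F) (Q : List (F × List Unit × List Unit)) (g : List F) : List (List F) :=
  (δ.filter fun γ => decide (peval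
    (((substY Q ((g.map fun x => [x]) ++ [[0, 1]])).filter fun p => !isZero p).headD []) γ
      = 0)).map fun γ => g ++ [γ]

/-- The prefixes of length `k`. -/
def prefixes (δ : List F) (Q : List (F × List Unit × List Unit)) (cap k : List Unit) :
    List (List F) :=
  k.foldr (fun _ L => takeU (L.flatMap fun g => children δ Q g) cap) [[]]

/-- The coefficient lists of the `f` such that `Y - f` divides `Q`. -/
def factors (δ : List F) (Q : List (F × List Unit × List Unit)) (cap k : List Unit) :
    List (List F) :=
  (prefixes δ Q cap k).filter fun g => isZero₂ (substY Q (g.map fun x => [x]))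

/-- The score of the word of a polynomial. -/
def scoreU (δ : List F) (μ : List Unit) (pts : List (F × List F)) (f : List F) : List Unit :=
  pts.flatMap fun pt => mult δ μ pt.2 (peval f pt.1)

/-- Selection of the polynomial of maximal score. -/
def select (δ : List F) (μ : List Unit) (pts : List (F × List F)) (L : List (List F)) :
    List (List F) :=
  uniqueMax (L.map fun f => (pts.map fun pt => peval f pt.1, scoreU δ μ pts f))

/-- The reconstruction algorithm from the constraints on. -/
def decode (δ : List F) (μ k : List Unit) (pts : List (F × List F))
    (cs : List (F × F × List Unit × List Unit)) : List (List F) :=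
  select δ μ pts (factors δ (interpolate cs k) (() :: cs.map fun _ => ()) k)

/-- The reconstruction algorithm. -/
def reconstruct (α : List F) (δ : List F) (Y : List (List F)) (k μ : List Unit) :
    List (List F) :=
  decode δ μ k (points α Y) (constraints δ μ (points α Y))

end ListAlg

/-! ### Polynomial time for arithmetic on coefficient lists and for multiplicities -/

namespace PolyTime

variable {a b c d : Ty}

theorem weak {f : ∀ (F : Type) [Field F] [DecidableEq F], Ty.Val F a → Ty.Val F c}
    (hf : PolyTime a c f) : PolyTime (.prod a b) c (fun F _ _ z => f F z.1) :=
  comp hf (fst id)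

theorem zipAdd {add : ∀ (F : Type) [Field F] [DecidableEq F], Ty.Val F b → Ty.Val F b → Ty.Val F b}
    {l l' : ∀ (F : Type) [Field F] [DecidableEq F], Ty.Val F a → Ty.Val F (.list b)}
    (ha : PolyTime (.prod b b) b (fun F _ _ z => add F z.1 z.2))
    (hl : PolyTime a (.list b) l) (hl' : PolyTime a (.list b) l') :
    PolyTime a (.list b) (fun F _ _ x => ListAlg.zipAdd (add F) (l F x) (l' F x)) :=
  append (map (b := .prod b b) (c := b) (f := fun F _ _ _ p => add F p.1 p.2)
    (bind (f := add) ha (fst (snd id)) (snd (snd id))) (zip hl hl'))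
    (append (drop hl hl') (drop hl' hl))

/-- Subadditivity of the size makes repeated addition of bounded summands an admissible loop, as in
`conv` and `substY`. -/
theorem size_zipAdd {F : Type} (add : Ty.Val F b → Ty.Val F b → Ty.Val F b)
    (hadd : ∀ x y, Ty.size b (add x y) ≤ Ty.size b x + Ty.size b y) (l l' : List (Ty.Val F b)) :
    Ty.size (F := F) (.list b) (ListAlg.zipAdd add l l') + 1 ≤
      Ty.size (.list b) l + Ty.size (.list b) l' := by
  induction l generalizing l' with
  | nil => simp [ListAlg.zipAdd]
  | cons x l ih =>
    cases l' with
    | nil => simp [ListAlg.zipAdd]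
    | cons y l' =>
      have h := ih l'
      have h2 := hadd x y
      have : ListAlg.zipAdd add (x :: l) (y :: l') = add x y :: ListAlg.zipAdd add l l' := by
        simp [ListAlg.zipAdd]
      rw [this, Ty.size_cons, Ty.size_cons, Ty.size_cons]
      omega

theorem conv {add mul : ∀ (F : Type) [Field F] [DecidableEq F],
      Ty.Val F b → Ty.Val F b → Ty.Val F b}
    {z : ∀ (F : Type) [Field F] [DecidableEq F], Ty.Val F b}
    {l l' : ∀ (F : Type) [Field F] [DecidableEq F], Ty.Val F a → Ty.Val F (.list b)}
    (ha : PolyTime (.prod b b) b (fun F _ _ z => add F z.1 z.2))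
    (hm : PolyTime (.prod b b) b (fun F _ _ z => mul F z.1 z.2))
    (hz : ∀ a, PolyTime a b (fun F _ _ _ => z F))
    (hadd : ∀ (F : Type) [Field F] [DecidableEq F] (x y : Ty.Val F b),
      Ty.size b (add F x y) ≤ Ty.size b x + Ty.size b y)
    (hl : PolyTime a (.list b) l) (hl' : PolyTime a (.list b) l') :
    PolyTime a (.list b)
      (fun F _ _ x => ListAlg.conv (add F) (mul F) (z F) (l F x) (l' F x)) := by
  have h1 : PolyTime (.prod a b) (.list b)
      (fun F _ _ x => (l' F x.1).map fun y => mul F x.2 y) :=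
    map (a := .prod a b) (b := b) (c := b) (f := fun F _ _ x y => mul F x.2 y) (bind (f := mul) hm (snd (fst id)) (snd id)) (weak hl')
  obtain ⟨T, hT⟩ := h1.size_bound
  obtain ⟨U, hU⟩ := (hz a).size_bound
  refine foldr (step := fun F _ _ x y acc =>
    ListAlg.zipAdd (add F) ((l' F x).map fun b => mul F y b) (z F :: acc)) (c := .list b)
    (zipAdd (add := add) ha (bind (a := a) (b := b) (c := .list b) (f := fun F _ _ x y => (l' F x).map fun b => mul F y b) h1
      (fst id) (snd (snd id))) (cons (hz _) (fst (snd id)))) nil hl (T + U) ?_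
  intro F _ _ x s y
  have h3 := hT F (x, y)
  have h5 := hU F x
  have h4 := size_zipAdd (add F) (hadd F) ((l' F x).map fun b => mul F y b) (z F :: s)
  change Ty.size (.list b) ((l' F x).map fun b => mul F y b) ≤
    eval (Ty.size a x + Ty.size b y) T at h3
  have h6 := natPoly_mono U (show Ty.size a x ≤ Ty.size a x + Ty.size b y by omega)
  rw [Ty.size_cons] at h4
  rw [eval_add]
  omega

section field

variable {f g : ∀ (F : Type) [Field F] [DecidableEq F], Ty.Val F a → Ty.Val F (.list .fld)}
  {u v : ∀ (F : Type) [Field F] [DecidableEq F], Ty.Val F a → Ty.Val F .fld}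
  {m n : ∀ (F : Type) [Field F] [DecidableEq F], Ty.Val F a → Ty.Val F (.list .unit)}
  {p q : ∀ (F : Type) [Field F] [DecidableEq F], Ty.Val F a → Ty.Val F (.list (.list .fld))}

theorem ltU (hm : PolyTime a (.list .unit) m) (hn : PolyTime a (.list .unit) n) :
    PolyTime a .bool (fun F _ _ x => ListAlg.ltU (m F x) (n F x)) :=
  not (isEmpty (drop hn hm))

theorem leU (hm : PolyTime a (.list .unit) m) (hn : PolyTime a (.list .unit) n) :
    PolyTime a .bool (fun F _ _ x => ListAlg.leU (m F x) (n F x)) :=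
  isEmpty (drop hm hn)

theorem takeU {l : ∀ (F : Type) [Field F] [DecidableEq F], Ty.Val F a → Ty.Val F (.list b)}
    {n : ∀ (F : Type) [Field F] [DecidableEq F], Ty.Val F a → Ty.Val F (.list c)}
    (hl : PolyTime a (.list b) l) (hn : PolyTime a (.list c) n) :
    PolyTime a (.list b) (fun F _ _ x => ListAlg.takeU (l F x) (n F x)) :=
  map (f := fun F _ _ _ (p : Ty.Val F (.prod b c)) => p.1) (fst (snd id)) (zip hl hn)

theorem padd (hf : PolyTime a (.list .fld) f) (hg : PolyTime a (.list .fld) g) :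
    PolyTime a (.list .fld) (fun F _ _ x => ListAlg.padd (F := F) (f F x) (g F x)) :=
  zipAdd (add := fun F _ _ (x y : F) => (x + y : F)) (b := .fld) (add (fst id) (snd id)) hf hg

theorem pmul (hf : PolyTime a (.list .fld) f) (hg : PolyTime a (.list .fld) g) :
    PolyTime a (.list .fld) (fun F _ _ x => ListAlg.pmul (F := F) (f F x) (g F x)) :=
  conv (add := fun F _ _ (x y : F) => (x + y : F)) (mul := fun F _ _ (x y : F) => (x * y : F))
    (z := fun F _ _ => (0 : F)) (b := .fld) (add (fst id) (snd id)) (mul (fst id) (snd id))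
    (fun _ => zero) (fun F _ _ x y => by simp [Ty.size]) hf hg

theorem psmul (hu : PolyTime a .fld u) (hg : PolyTime a (.list .fld) g) :
    PolyTime a (.list .fld) (fun F _ _ x => ListAlg.psmul (F := F) (u F x) (g F x)) :=
  map (f := fun F _ _ x (y : F) => (u F x * y : F)) (b := .fld) (c := .fld)
    (mul (weak hu) (snd id)) hg

theorem peval (hf : PolyTime a (.list .fld) f) (hu : PolyTime a .fld u) :
    PolyTime a .fld (fun F _ _ x => ListAlg.peval (F := F) (f F x) (u F x)) :=
  foldr (step := fun F _ _ x (c acc : F) => (c + u F x * acc : F)) (b := .fld) (c := .fld)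
    (add (snd (snd id)) (mul (weak hu) (fst (snd id)))) zero hf 1
    (fun F _ _ x s y => by simp [Ty.size])

theorem isZero (hf : PolyTime a (.list .fld) f) :
    PolyTime a .bool (fun F _ _ x => ListAlg.isZero (F := F) (f F x)) :=
  all (f := fun F _ _ _ (c : F) => decide (c = 0)) (b := .fld) (eqTest (snd id) zero) hf

theorem size_padd {F : Type} [Field F] [DecidableEq F] (l l' : List F) :
    Ty.size (F := F) (.list .fld) (ListAlg.padd l l') + 1 ≤
      Ty.size (F := F) (.list .fld) l + Ty.size (F := F) (.list .fld) l' :=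
  size_zipAdd (b := .fld) _ (fun _ _ => by simp [Ty.size]) l l'

theorem size_padd₂ {F : Type} [Field F] [DecidableEq F] (l l' : List (List F)) :
    Ty.size (F := F) (.list (.list .fld)) (ListAlg.padd₂ l l') + 1 ≤
      Ty.size (F := F) (.list (.list .fld)) l + Ty.size (F := F) (.list (.list .fld)) l' :=
  size_zipAdd (b := .list .fld) _ (fun x y => by have := size_padd x y; omega) l l'

theorem padd₂ (hp : PolyTime a (.list (.list .fld)) p) (hq : PolyTime a (.list (.list .fld)) q) :
    PolyTime a (.list (.list .fld)) (fun F _ _ x => ListAlg.padd₂ (F := F) (p F x) (q F x)) :=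
  zipAdd (add := fun F _ _ x y => ListAlg.padd (F := F) x y) (b := .list .fld)
    (padd (fst id) (snd id)) hp hq

theorem pmul₂ (hp : PolyTime a (.list (.list .fld)) p) (hq : PolyTime a (.list (.list .fld)) q) :
    PolyTime a (.list (.list .fld)) (fun F _ _ x => ListAlg.pmul₂ (F := F) (p F x) (q F x)) :=
  conv (add := fun F _ _ x y => ListAlg.padd (F := F) x y)
    (mul := fun F _ _ x y => ListAlg.pmul (F := F) x y) (z := fun F _ _ => ([] : List F))
    (b := .list .fld) (padd (fst id) (snd id)) (pmul (fst id) (snd id))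
    (fun _ => nil) (fun F _ _ x y => by have := size_padd (F := F) x y; omega) hp hq

theorem isZero₂ (hp : PolyTime a (.list (.list .fld)) p) :
    PolyTime a .bool (fun F _ _ x => ListAlg.isZero₂ (F := F) (p F x)) :=
  all (f := fun F _ _ _ c => ListAlg.isZero (F := F) c) (b := .list .fld) (isZero (snd id)) hp

theorem length_zipAdd {A : Type} (add : A → A → A) (l l' : List A) :
    (ListAlg.zipAdd add l l').length = max l.length l'.length := by
  simp [ListAlg.zipAdd]; omega

theorem length_conv_le {A : Type} (add mul : A → A → A) (z : A) (l l' : List A) :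
    (ListAlg.conv add mul z l l').length ≤ l.length + l'.length := by
  induction l with
  | nil => simp [ListAlg.conv]
  | cons x l ih =>
    rw [ListAlg.conv, List.foldr_cons, length_zipAdd]
    simp only [List.length_map, List.length_cons]
    change max _ ((ListAlg.conv add mul z l l').length + 1) ≤ _
    omega

theorem mem_zipAdd {A : Type} (add : A → A → A) (l l' : List A) (P : A → Prop)
    (hl : ∀ x ∈ l, P x) (hl' : ∀ x ∈ l', P x) (hadd : ∀ x y, P x → P y → P (add x y)) :
    ∀ x ∈ ListAlg.zipAdd add l l', P x := by
  intro x hx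
  simp only [ListAlg.zipAdd, List.mem_append, List.mem_map, Prod.exists] at hx
  rcases hx with ⟨y, z, h, rfl⟩ | h | h
  · exact hadd _ _ (hl _ (List.of_mem_zip h).1) (hl' _ (List.of_mem_zip h).2)
  · exact hl _ (List.mem_of_mem_drop h)
  · exact hl' _ (List.mem_of_mem_drop h)

theorem length_pmul₂_entry {F : Type} [Field F] [DecidableEq F] (l l' : List (List F)) (A B : ℕ)
    (hl : ∀ x ∈ l, x.length ≤ A) (hl' : ∀ x ∈ l', x.length ≤ B) :
    ∀ x ∈ ListAlg.pmul₂ l l', x.length ≤ A + B := by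
  induction l with
  | nil => simp [ListAlg.pmul₂, ListAlg.conv]
  | cons y l ih =>
    refine mem_zipAdd _ _ _ (fun x : List F => x.length ≤ A + B) ?_ ?_ ?_
    · intro x hx
      obtain ⟨z, hz, rfl⟩ := List.mem_map.1 hx
      have h1 := length_conv_le (fun x y : F => x + y) (fun x y => x * y) 0 y z
      have h2 := hl y (by simp)
      have h3 := hl' z hz
      change (ListAlg.conv _ _ _ _ _).length ≤ _
      omega
    · intro x hx
      rcases List.mem_cons.1 hx with rfl | hx
      · simp
      · exact ih (fun x hx => hl x (by simp [hx])) x hx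
    · intro x y hx hy
      rw [ListAlg.padd, length_zipAdd]
      omega

/-- Both the number of coefficients and their largest length are subadditive under multiplication.
Multiplying repeatedly by a fixed factor therefore raises `Ty.nest` by a fixed amount, as needed in
`ppow₂`. -/
theorem nest_pmul₂_le {F : Type} [Field F] [DecidableEq F] (l l' : List (List F)) :
    Ty.nest (F := F) .fld (ListAlg.pmul₂ l l') ≤ Ty.nest (F := F) .fld l + Ty.nest .fld l' := by
  have h1 := length_conv_le ListAlg.padd ListAlg.pmul ([] : List F) l l'
  have h2 := length_pmul₂_entry l l' _ _ ((Ty.foldr_max_le_iff (F := F) .fld l _).1 le_rfl)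
    ((Ty.foldr_max_le_iff (F := F) .fld l' _).1 le_rfl)
  refine (Ty.nest_le (F := F) .fld _ _ _ h1 h2).trans ?_
  simp only [Ty.nest]
  omega

theorem ppow (hf : PolyTime a (.list .fld) f) (hn : PolyTime a (.list .unit) n) :
    PolyTime a (.list .fld) (fun F _ _ x => ListAlg.ppow (F := F) (f F x) (n F x)) := by
  obtain ⟨T, hT⟩ := hf.size_bound
  refine foldr (step := fun F _ _ x _ q => ListAlg.pmul (F := F) (f F x) q) (b := .unit)
    (c := .list .fld) (pmul (weak hf) (fst (snd id))) (cons one nil) hn T ?_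
  intro F _ _ x s y
  have h1 := length_conv_le (fun x y : F => x + y) (fun x y => x * y) 0 (f F x) s
  have h2 := hT F x
  have h3 := natPoly_mono T (Nat.le_add_right (Ty.size a x) (Ty.size .unit y))
  rw [Ty.size_list_of_flat .fld (fun _ => rfl)] at h2 ⊢
  rw [Ty.size_list_of_flat .fld (fun _ => rfl)]
  change 1 + (ListAlg.conv (fun x y : F => x + y) (fun x y => x * y) 0 (f F x) s).length ≤ _
  omega

theorem ppow₂ (hp : PolyTime a (.list (.list .fld)) p) (hn : PolyTime a (.list .unit) n) :
    PolyTime a (.list (.list .fld)) (fun F _ _ x => ListAlg.ppow₂ (F := F) (p F x) (n F x)) := by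
  obtain ⟨T, hT⟩ := hp.size_bound
  refine foldr_of_measure (step := fun F _ _ x _ q => ListAlg.pmul₂ (F := F) (p F x) q)
    (b := .unit) (c := .list (.list .fld)) (pmul₂ (weak hp) (fst (snd id)))
    (cons (cons one nil) nil) hn (fun _ s => Ty.nest .fld s) ((2 * Polynomial.X).comp T)
    (1 + Polynomial.X * (1 + Polynomial.X)) (2 * Polynomial.X) ?_
    (fun F => Ty.size_le_nest .fld (fun _ => rfl)) (fun F => Ty.nest_le_size .fld)
  intro F _ _ x s y
  have h1 := nest_pmul₂_le (F := F) (p F x) s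
  have h2 := hT F x
  have h3 := natPoly_mono T (Nat.le_add_right (Ty.size a x) (Ty.size .unit y))
  have h4 := Ty.nest_le_size (F := F) .fld (p F x)
  have h5 := natPoly_mono (2 * Polynomial.X) (h2.trans h3)
  rw [eval_comp]
  omega

theorem eqW (hf : PolyTime a (.list .fld) f) (hg : PolyTime a (.list .fld) g) :
    PolyTime a .bool (fun F _ _ x => ListAlg.eqW (F := F) (f F x) (g F x)) :=
  and (and (isEmpty (drop hf hg)) (isEmpty (drop hg hf)))
    (all (f := fun F _ _ _ (z : Ty.Val F (.prod .fld .fld)) => decide ((z.1 : F) = z.2))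
      (eqTest (fst (snd id)) (snd (snd id))) (zip hf hg))

theorem uniqueMax {l : ∀ (F : Type) [Field F] [DecidableEq F], Ty.Val F a →
      Ty.Val F (.list (.prod (.list .fld) (.list .unit)))}
    (hl : PolyTime a (.list (.prod (.list .fld) (.list .unit))) l) :
    PolyTime a (.list (.list .fld)) (fun F _ _ x => ListAlg.uniqueMax (F := F) (l F x)) :=
  takeU (map (b := .prod (.list .fld) (.list .unit)) (c := .list .fld)
    (f := fun _ _ _ _ x => x.1) (fst (snd id))
    (filter (b := .prod (.list .fld) (.list .unit))
      (f := fun F _ _ z x => (l F z).all fun y => ListAlg.eqW (F := F) y.1 x.1 ||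
        ListAlg.ltU y.2 x.2)
      (all (a := .prod a (.prod (.list .fld) (.list .unit))) (b := .prod (.list .fld) (.list .unit))
        (f := fun F _ _ z y => ListAlg.eqW (F := F) y.1 z.2.1 || ListAlg.ltU y.2 z.2.2)
        (or (eqW (fst (snd id)) (fst (snd (fst id)))) (ltU (snd (snd id)) (snd (snd (fst id)))))
        (weak hl)) hl))
    (cons (b := .unit) unit nil)

theorem count (hm : PolyTime a (.list .unit) m) (hf : PolyTime a (.list .fld) f)
    (hu : PolyTime a .fld u) :
    PolyTime a (.list .unit) (fun F _ _ x => ListAlg.count (F := F) (m F x) (f F x) (u F x)) :=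
  flatMap (b := .fld) (c := .unit) (f := fun F _ _ x _ => m F x) (weak hm)
    (filter (b := .fld) (f := fun F _ _ x y => decide ((y : F) = u F x))
      (eqTest (snd id) (weak hu)) hf)

theorem mult (hf : PolyTime a (.list .fld) f) (hm : PolyTime a (.list .unit) m)
    (hg : PolyTime a (.list .fld) g) (hu : PolyTime a .fld u) :
    PolyTime a (.list .unit)
      (fun F _ _ x => ListAlg.mult (F := F) (f F x) (m F x) (g F x) (u F x)) :=
  caseList (b := .list .fld) (c := .list .unit)
    (g := fun F _ _ x w _ => bif (ListAlg.count (F := F) (m F x) (g F x) (w.headD 0)).tail.isEmpty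
      then ListAlg.count (F := F) (m F x) (g F x) (u F x)
      else bif ListAlg.eqW (F := F) [u F x] w then (g F x).flatMap fun _ => m F x else [])
    (uniqueMax (map (b := .fld) (c := .prod (.list .fld) (.list .unit))
      (f := fun F _ _ x y => ([y], ListAlg.count (F := F) (m F x) (g F x) y))
      (pair (cons (snd id) nil) (count (weak hm) (weak hg) (snd id))) hf))
    (count hm hg hu)
    (cond (isEmpty (tail (count (weak hm) (weak hg) (headD (fst (snd id)) zero))))
      (count (weak hm) (weak hg) (weak hu))
      (cond (eqW (cons (weak hu) nil) (fst (snd id)))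
        (flatMap (b := .fld) (c := .unit)
          (a := .prod a (.prod (.list .fld) (.list (.list .fld))))
          (f := fun F _ _ z _ => m F z.1) (weak (weak hm)) (weak hg)) nil))

end field

end PolyTime

namespace Ty

/-- Numbers in unary. -/
abbrev num : Ty := .list .unit

/-- Polynomials. -/
abbrev poly : Ty := .list .fld

/-- Exponents of bivariate monomials. -/
abbrev mon : Ty := .prod num num

/-- Interpolation constraints. -/
abbrev constr : Ty := .prod .fld (.prod .fld (.prod num num))

/-- Terms of bivariate polynomials. -/
abbrev term : Ty := .prod .fld mon

/-- Evaluation points with columns of reads. -/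
abbrev point : Ty := .prod .fld poly

end Ty

/-! ### Polynomial time for the steps of the decoder -/

namespace PolyTime

open Ty

variable {a b c d : Ty}
  {f g δ : ∀ (F : Type) [Field F] [DecidableEq F], Ty.Val F a → Ty.Val F poly}
  {u : ∀ (F : Type) [Field F] [DecidableEq F], Ty.Val F a → Ty.Val F .fld}
  {μ k n w : ∀ (F : Type) [Field F] [DecidableEq F], Ty.Val F a → Ty.Val F num}
  {p q : ∀ (F : Type) [Field F] [DecidableEq F], Ty.Val F a → Ty.Val F (.list poly)}
  {pts : ∀ (F : Type) [Field F] [DecidableEq F], Ty.Val F a → Ty.Val F (.list point)}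
  {cs : ∀ (F : Type) [Field F] [DecidableEq F], Ty.Val F a → Ty.Val F (.list constr)}
  {ms : ∀ (F : Type) [Field F] [DecidableEq F], Ty.Val F a → Ty.Val F (.list mon)}
  {ts : ∀ (F : Type) [Field F] [DecidableEq F], Ty.Val F a → Ty.Val F (.list term)}
  {l : ∀ (F : Type) [Field F] [DecidableEq F], Ty.Val F a → Ty.Val F (.list b)}

theorem rangeU (hl : PolyTime a (.list b) l) :
    PolyTime a (.list num) (fun F _ _ x => ListAlg.rangeU (l F x)) := range hl

theorem toUnits (hl : PolyTime a (.list b) l) :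
    PolyTime a num (fun F _ _ x => (l F x).map fun _ => ()) :=
  map (f := fun _ _ _ _ _ => ()) (c := .unit) unit hl

theorem points (hf : PolyTime a poly f) (hp : PolyTime a (.list poly) p) :
    PolyTime a (.list point) (fun F _ _ x => ListAlg.points (F := F) (f F x) (p F x)) := by
  refine foldr (b := poly) (c := .list point)
    (step := fun F _ _ _ y acc => (y.zip acc).map fun z => (z.2.1, z.1 :: z.2.2))
    (map (b := .prod .fld point) (c := point) (f := fun F _ _ _ z => (z.2.1, z.1 :: z.2.2))
      (pair (fst (snd (snd id))) (cons (fst (snd id)) (snd (snd (snd id)))))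
      (zip (snd (snd id)) (fst (snd id))))
    (map (b := .fld) (c := point) (f := fun F _ _ _ x => (x, [])) (pair (snd id) nil) hf) hp
    Polynomial.X ?_
  intro F _ _ x s y
  -- Each column receives one symbol of the read, so the growth is at most the size of the read,
  -- independently of the state.
  have : ∀ (y : List F) (s : List (F × List F)),
      Ty.size (F := F) (.list point) ((y.zip s).map fun z => (z.2.1, z.1 :: z.2.2)) ≤
        Ty.size (F := F) (.list point) s + Ty.size (F := F) poly y := by
    intro y
    induction y with
    | nil =>
      intro s
      exact (Ty.size_nil point).le.trans
        ((Ty.size_pos (.list point) s).trans (Nat.le_add_right _ _))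
    | cons y l ih =>
      intro s
      cases s with
      | nil => simp
      | cons z s =>
        rw [List.zip_cons_cons, List.map_cons, Ty.size_cons, Ty.size_cons, Ty.size_cons]
        have h1 := ih s
        have h2 := Ty.size_cons (F := F) .fld y z.2
        change Ty.size (F := F) .fld y + Ty.size (F := F) (.list .fld) (y :: z.2 : List F) + _ ≤
          (Ty.size (F := F) .fld y + Ty.size (F := F) (.list .fld) z.2) + _ + _
        rw [h2]
        have h3 : ∀ e c A B L : ℕ, A ≤ B + L → e + (e + c) + A ≤ (e + c) + B + (e + L) := by
          intros; omega
        exact h3 _ _ _ _ _ h1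
  rw [eval_X]
  exact (this y s).trans (by omega)

theorem constraintsAt {v : ∀ (F : Type) [Field F] [DecidableEq F], Ty.Val F a → Ty.Val F .fld}
    (hμ : PolyTime a num μ) (hu : PolyTime a .fld u) (hv : PolyTime a .fld v) :
    PolyTime a (.list constr)
      (fun F _ _ x => ListAlg.constraintsAt (F := F) (μ F x) (u F x) (v F x)) :=
  flatMap (b := num) (c := constr)
    (f := fun F _ _ x r => (ListAlg.rangeU ((μ F x).drop r.length)).map fun s => (u F x, v F x, r, s))
    (map (a := .prod a num) (b := num) (c := constr)
      (f := fun F _ _ z s => (u F z.1, v F z.1, z.2, s))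
      (pair (weak (weak hu)) (pair (weak (weak hv)) (pair (snd (fst id)) (snd id))))
      (rangeU (drop (weak hμ) (snd id))))
    (rangeU hμ)

theorem constraints (hδ : PolyTime a poly δ) (hμ : PolyTime a num μ)
    (hp : PolyTime a (.list point) pts) : PolyTime a (.list constr)
      (fun F _ _ x => ListAlg.constraints (F := F) (δ F x) (μ F x) (pts F x)) :=
  flatMap (b := point) (c := constr)
    (f := fun F _ _ x pt => (δ F x).flatMap fun v =>
      ListAlg.constraintsAt (F := F) (ListAlg.mult (F := F) (δ F x) (μ F x) pt.2 v) pt.1 v)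
    (flatMap (a := .prod a point) (b := .fld) (c := constr)
      (f := fun F _ _ z v => ListAlg.constraintsAt (F := F)
        (ListAlg.mult (F := F) (δ F z.1) (μ F z.1) z.2.2 v) z.2.1 v)
      (constraintsAt (mult (weak (weak hδ)) (weak (weak hμ)) (snd (snd (fst id))) (snd id))
        (fst (snd (fst id))) (snd id))
      (weak hδ))
    hp

theorem monos (hl : PolyTime a (.list b) l) (hk : PolyTime a num k) (hw : PolyTime a num w) :
    PolyTime a (.list mon) (fun F _ _ x => ListAlg.monos (l F x) (k F x) (w F x)) := by
  have hr : PolyTime a (.list num)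
      (fun F _ _ x => ListAlg.rangeU (l F x) ++ [(l F x).map fun _ => ()]) :=
    append (rangeU hl) (cons (toUnits hl) nil)
  exact flatMap (b := num) (c := mon)
    (f := fun F _ _ x i => ((ListAlg.rangeU (l F x) ++ [(l F x).map fun _ => ()]).filter fun j =>
      ListAlg.leU (i ++ j.flatMap fun _ => (k F x).tail) (w F x)).map fun j => (i, j))
    (map (a := .prod a num) (b := num) (c := mon) (f := fun F _ _ z j => (z.2, j))
      (pair (snd (fst id)) (snd id))
      (filter (a := .prod a num) (b := num)
        (f := fun F _ _ z j => ListAlg.leU (z.2 ++ j.flatMap fun _ => (k F z.1).tail) (w F z.1))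
        (leU (append (snd (fst id)) (flatMap (a := .prod (.prod a num) num) (b := .unit)
          (c := .unit) (f := fun F _ _ z _ => (k F z.1.1).tail) (tail (weak (weak (weak hk))))
          (snd id))) (weak (weak hw)))
        (weak hr))) hr

theorem constraintVal {c : ∀ (F : Type) [Field F] [DecidableEq F], Ty.Val F a → Ty.Val F constr}
    {m : ∀ (F : Type) [Field F] [DecidableEq F], Ty.Val F a → Ty.Val F mon}
    (hc : PolyTime a constr c) (hm : PolyTime a mon m) :
    PolyTime a .fld (fun F _ _ x => ListAlg.constraintVal (F := F) (c F x) (m F x)) :=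
  mul (headD (drop (ppow (cons (fst hc) (cons one nil)) (fst hm)) (fst (snd (snd hc)))) zero)
    (headD (drop (ppow (cons (fst (snd hc)) (cons one nil)) (snd hm)) (snd (snd (snd hc)))) zero)

theorem dot (hf : PolyTime a poly f) (hg : PolyTime a poly g) :
    PolyTime a .fld (fun F _ _ x => ListAlg.dot (F := F) (f F x) (g F x)) :=
  foldr (b := .prod .fld .fld) (c := .fld)
    (step := fun F _ _ _ z (acc : F) => (z.1 * z.2 + acc : F))
    (add (mul (fst (snd (snd id))) (snd (snd (snd id)))) (fst (snd id))) zero (zip hf hg) 1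
    (fun F _ _ _ _ _ => by simp [Ty.size])

theorem elim (hf : PolyTime a poly f) (hp : PolyTime a (.list poly) p) :
    PolyTime a (.list poly) (fun F _ _ x => ListAlg.elim (F := F) (f F x) (p F x)) :=
  caseList (b := poly) (c := .list poly)
    (g := fun F _ _ x r _ => ((p F x).map fun g => ListAlg.padd (F := F) g (ListAlg.psmul
      (0 - ListAlg.dot (f F x) g * (ListAlg.dot (f F x) r)⁻¹) r)).filter fun g => !ListAlg.isZero g)
    (filter (b := poly) (f := fun F _ _ x g => !decide (ListAlg.dot (F := F) (f F x) g = 0))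
      (not (eqTest (dot (weak hf) (snd id)) zero)) hp) hp
    (filter (a := .prod a (.prod poly (.list poly))) (b := poly)
      (f := fun F _ _ _ g => !ListAlg.isZero (F := F) g) (not (isZero (snd id)))
      (map (a := .prod a (.prod poly (.list poly))) (b := poly) (c := poly)
        (f := fun F _ _ z g => ListAlg.padd (F := F) g (ListAlg.psmul
          (0 - ListAlg.dot (f F z.1) g * (ListAlg.dot (f F z.1) z.2.1)⁻¹) z.2.1))
        (padd (snd id) (psmul (sub zero (mul (dot (weak (weak hf)) (snd id))
          (inv (dot (weak (weak hf)) (fst (snd (fst id))))))) (fst (snd (fst id)))))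
        (weak hp)))

theorem unitVecs (hl : PolyTime a (.list b) l) :
    PolyTime a (.list poly) (fun F _ _ x => ListAlg.unitVecs F (l F x)) :=
  map (b := num) (c := poly) (f := fun F _ _ _ t => (t.map fun _ => (0 : F)) ++ [1])
    (append (map (a := .prod a num) (b := .unit) (c := .fld) (f := fun F _ _ _ _ => (0 : F)) zero
      (snd id)) (cons one nil)) (rangeU hl)

/-- Elimination produces no new generators, and a combination of two vectors is no longer than the
longer one. Field elements have size one, so no coefficient growth has to be controlled. -/
theorem nest_elim_le {F : Type} [Field F] [DecidableEq F] (D : List F) (L : List (List F)) :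
    Ty.nest (F := F) .fld (ListAlg.elim D L) ≤ Ty.nest (F := F) .fld L := by
  unfold ListAlg.elim
  have hmem : ∀ g ∈ L.filter fun g => !decide (ListAlg.dot D g = 0), g ∈ L :=
    fun g hg => (List.mem_filter.1 hg).1
  generalize (L.filter fun g => !decide (ListAlg.dot D g = 0)) = L' at hmem
  cases L' with
  | nil => exact le_rfl
  | cons p L' =>
    refine Ty.nest_le (F := F) .fld _ _ _
      ((List.length_filter_le _ _).trans (List.length_map _).le) ?_
    intro g hg
    obtain ⟨h, hh, rfl⟩ := List.mem_map.1 (List.mem_filter.1 hg).1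
    have h1 := (Ty.foldr_max_le_iff (F := F) .fld L _).1 le_rfl h hh
    have h2 := (Ty.foldr_max_le_iff (F := F) .fld L _).1 le_rfl p (hmem p (by simp))
    have h3 : (ListAlg.padd h (ListAlg.psmul
        (0 - ListAlg.dot D h * (ListAlg.dot D p)⁻¹) p)).length = max h.length p.length := by
      rw [ListAlg.padd, length_zipAdd, ListAlg.psmul, List.length_map]
    exact h3.le.trans (max_le h1 h2)

theorem kernelGens (hc : PolyTime a (.list constr) cs) (hm : PolyTime a (.list mon) ms) :
    PolyTime a (.list poly) (fun F _ _ x => ListAlg.kernelGens (F := F) (cs F x) (ms F x)) :=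
  foldr_of_measure (b := constr) (c := .list poly)
    (step := fun F _ _ x c L => ListAlg.elim (F := F)
      ((ms F x).map fun m => ListAlg.constraintVal c m) L)
    (elim (map (a := .prod a (.prod (.list poly) constr)) (b := mon) (c := .fld)
      (f := fun F _ _ z m => ListAlg.constraintVal (F := F) z.2.2 m)
      (constraintVal (snd (snd (fst id))) (snd id)) (weak hm)) (fst (snd id)))
    (unitVecs hm) hc (fun _ s => Ty.nest .fld s) 0
    (1 + Polynomial.X * (1 + Polynomial.X)) (2 * Polynomial.X)
    (fun F _ _ x s y => (nest_elim_le (F := F) _ s).trans (by simp))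
    (fun F => Ty.size_le_nest .fld (fun _ => rfl)) (fun F => Ty.nest_le_size .fld)

theorem interpolate (hc : PolyTime a (.list constr) cs) (hk : PolyTime a num k) :
    PolyTime a (.list term) (fun F _ _ x => ListAlg.interpolate (F := F) (cs F x) (k F x)) :=
  headD (b := .list term) (flatMap (b := num) (c := .list term)
    (f := fun F _ _ x w => (ListAlg.kernelGens (F := F) (cs F x)
      (ListAlg.monos (cs F x) (k F x) w)).map fun g => g.zip (ListAlg.monos (cs F x) (k F x) w))
    (map (a := .prod a num) (b := poly) (c := .list term)
      (f := fun F _ _ z g => g.zip (ListAlg.monos (cs F z.1) (k F z.1) z.2))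
      (zip (snd id) (weak (monos (weak hc) (weak hk) (snd id))))
      (kernelGens (weak hc) (monos (weak hc) (weak hk) (snd id))))
    (append (rangeU hc) (cons (toUnits hc) nil))) nil

theorem substY (ht : PolyTime a (.list term) ts) (hp : PolyTime a (.list poly) p) :
    PolyTime a (.list poly) (fun F _ _ x => ListAlg.substY (F := F) (ts F x) (p F x)) := by
  have h1 : PolyTime (.prod a term) (.list poly) (fun F _ _ z =>
      (z.2.2.1.map fun _ => []) ++ (ListAlg.ppow₂ (F := F) (p F z.1) z.2.2.2).map fun q =>
        ListAlg.psmul z.2.1 q) :=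
    append (map (a := .prod a term) (b := .unit) (c := poly)
        (f := fun F _ _ _ _ => ([] : List F)) nil (fst (snd (snd id))))
      (map (a := .prod a term) (b := poly) (c := poly)
        (f := fun F _ _ z q => ListAlg.psmul (F := F) z.2.1 q) (psmul (fst (snd (fst id))) (snd id))
        (ppow₂ (weak hp) (snd (snd (snd id)))))
  obtain ⟨T, hT⟩ := h1.size_bound
  refine foldr (b := term) (c := .list poly)
    (step := fun F _ _ x t acc => ListAlg.padd₂ (F := F) ((t.2.1.map fun _ => []) ++
      (ListAlg.ppow₂ (F := F) (p F x) t.2.2).map fun q => ListAlg.psmul t.1 q) acc)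
    (padd₂ (bind (a := a) (b := term) (c := .list poly) (f := fun F _ _ x t =>
      (t.2.1.map fun _ => []) ++ (ListAlg.ppow₂ (F := F) (p F x) t.2.2).map fun q =>
        ListAlg.psmul t.1 q) h1 (fst id) (snd (snd id))) (fst (snd id))) nil ht T ?_
  intro F _ _ x s y
  have h2 := hT F (x, y)
  have h3 := size_padd₂ (F := F) ((y.2.1.map fun _ => []) ++
      (ListAlg.ppow₂ (F := F) (p F x) y.2.2).map fun q => ListAlg.psmul y.1 q) s
  exact ((Nat.le_succ _).trans h3).trans ((add_comm _ _).le.trans (Nat.add_le_add_left h2 _))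

theorem children (hδ : PolyTime a poly δ) (ht : PolyTime a (.list term) ts)
    (hg : PolyTime a poly g) : PolyTime a (.list poly)
      (fun F _ _ x => ListAlg.children (F := F) (δ F x) (ts F x) (g F x)) :=
  map (b := .fld) (c := poly) (f := fun F _ _ x (γ : F) => g F x ++ [γ])
    (append (weak hg) (cons (snd id) nil))
    (filter (b := .fld) (f := fun F _ _ x (γ : F) => decide (ListAlg.peval (F := F)
      (((ListAlg.substY (F := F) (ts F x) (((g F x).map fun x => [x]) ++ [[0, 1]])).filter
        fun p => !ListAlg.isZero p).headD []) γ = 0))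
      (eqTest (peval (weak (headD (filter (b := poly)
        (f := fun F _ _ _ p => !ListAlg.isZero (F := F) p) (not (isZero (snd id)))
        (substY ht (append (map (b := .fld) (c := poly) (f := fun F _ _ _ (x : F) => [x])
          (cons (snd id) nil) hg) (cons (cons zero (cons one nil)) nil)))) nil)) (snd id)) zero)
      hδ)

theorem length_children {F : Type} [Field F] [DecidableEq F] (δ : List F)
    (Q : List (F × List Unit × List Unit)) (g : List F) :
    ∀ h ∈ ListAlg.children δ Q g, h.length = g.length + 1 := by
  intro h hh
  obtain ⟨γ, -, rfl⟩ := List.mem_map.1 hh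
  simp

theorem takeU_eq {A B : Type} (l : List A) (n : List B) : ListAlg.takeU l n = l.take n.length := by
  induction l generalizing n with
  | nil => simp [ListAlg.takeU]
  | cons x l ih =>
    cases n with
    | nil => simp [ListAlg.takeU]
    | cons y n => simpa [ListAlg.takeU] using ih n

theorem prefixes (hδ : PolyTime a poly δ) (ht : PolyTime a (.list term) ts)
    (hn : PolyTime a num n) (hk : PolyTime a num k) : PolyTime a (.list poly)
      (fun F _ _ x => ListAlg.prefixes (F := F) (δ F x) (ts F x) (n F x) (k F x)) := by
  obtain ⟨T, hT⟩ := hn.size_bound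
  refine foldr_of_measure (b := .unit) (c := .list poly)
    (step := fun F _ _ x _ L => ListAlg.takeU (L.flatMap fun g =>
      ListAlg.children (F := F) (δ F x) (ts F x) g) (n F x))
    (takeU (flatMap (a := .prod a (.prod (.list poly) .unit)) (b := poly) (c := poly)
      (f := fun F _ _ z g => ListAlg.children (F := F) (δ F z.1) (ts F z.1) g)
      (children (weak (weak hδ)) (weak (weak ht)) (snd id)) (fst (snd id))) (weak hn))
    (cons nil nil) hk (fun _ s => Ty.nest .fld s) (T + 1)
    (1 + Polynomial.X * (1 + Polynomial.X)) (2 * Polynomial.X) ?_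
    (fun F => Ty.size_le_nest .fld (fun _ => rfl)) (fun F => Ty.nest_le_size .fld)
  intro F _ _ x s y
  have h1 := hT F x
  have h2 := Ty.length_lt_size (F := F) .unit (n F x)
  have h3 := natPoly_mono T (Nat.le_add_right (Ty.size a x) (Ty.size (F := F) .unit y))
  change Ty.size (F := F) (.list .unit) (n F x) ≤ _ at h1
  rw [takeU_eq]
  -- The truncation bounds the number of prefixes whatever the input is, and one round lengthens
  -- each prefix by one. For the inputs that matter it removes nothing, by `prefixes_spec`.
  refine (Ty.nest_le (F := F) .fld _ (n F x).length (Ty.nest (F := F) .fld s + 1)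
    (List.length_take_le _ _) ?_).trans ?_
  · intro h hh
    obtain ⟨g, hg, hh⟩ := List.mem_flatMap.1 (List.mem_of_mem_take hh)
    have h4 := length_children (F := F) _ _ g h hh
    have h5 := Ty.length_add_length_le_nest (F := F) .fld hg
    exact h4.le.trans (by omega)
  · rw [eval_add, eval_one]
    omega

theorem factors (hδ : PolyTime a poly δ) (ht : PolyTime a (.list term) ts)
    (hn : PolyTime a num n) (hk : PolyTime a num k) : PolyTime a (.list poly)
      (fun F _ _ x => ListAlg.factors (F := F) (δ F x) (ts F x) (n F x) (k F x)) :=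
  filter (b := poly)
    (f := fun F _ _ x g => ListAlg.isZero₂ (F := F) (ListAlg.substY (ts F x) (g.map fun x => [x])))
    (isZero₂ (substY (weak ht) (map (a := .prod a poly) (b := .fld) (c := poly)
      (f := fun F _ _ _ (x : F) => [x]) (cons (snd id) nil) (snd id))))
    (prefixes hδ ht hn hk)

theorem scoreU (hδ : PolyTime a poly δ) (hμ : PolyTime a num μ)
    (hp : PolyTime a (.list point) pts) (hf : PolyTime a poly f) : PolyTime a num
      (fun F _ _ x => ListAlg.scoreU (F := F) (δ F x) (μ F x) (pts F x) (f F x)) :=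
  flatMap (b := point) (c := .unit)
    (f := fun F _ _ x pt => ListAlg.mult (F := F) (δ F x) (μ F x) pt.2
      (ListAlg.peval (f F x) pt.1))
    (mult (weak hδ) (weak hμ) (snd (snd id)) (peval (weak hf) (fst (snd id)))) hp

theorem select (hδ : PolyTime a poly δ) (hμ : PolyTime a num μ)
    (hp : PolyTime a (.list point) pts) (hq : PolyTime a (.list poly) q) :
    PolyTime a (.list poly)
      (fun F _ _ x => ListAlg.select (F := F) (δ F x) (μ F x) (pts F x) (q F x)) :=
  uniqueMax (map (b := poly) (c := .prod poly num)
    (f := fun F _ _ x f => ((pts F x).map fun pt => ListAlg.peval (F := F) f pt.1,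
      ListAlg.scoreU (F := F) (δ F x) (μ F x) (pts F x) f))
    (pair (map (a := .prod a poly) (b := point) (c := .fld)
        (f := fun F _ _ z pt => ListAlg.peval (F := F) z.2 pt.1)
        (peval (snd (fst id)) (fst (snd id))) (weak hp))
      (scoreU (weak hδ) (weak hμ) (weak hp) (snd id))) hq)

theorem decode (hδ : PolyTime a poly δ) (hμ : PolyTime a num μ) (hk : PolyTime a num k)
    (hp : PolyTime a (.list point) pts) (hc : PolyTime a (.list constr) cs) :
    PolyTime a (.list poly)
      (fun F _ _ x => ListAlg.decode (F := F) (δ F x) (μ F x) (k F x) (pts F x) (cs F x)) :=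
  select hδ hμ hp (factors hδ (interpolate hc hk) (cons unit (toUnits hc)) hk)

theorem reconstruct : PolyTime inputTy outputTy (fun F _ _ x =>
    ListAlg.reconstruct (F := F) x.2.1 x.1 x.2.2.1 x.2.2.2.1 x.2.2.2.2) := by
  have hδ : PolyTime inputTy poly (fun F _ _ x => x.1) := fst id
  have hμ : PolyTime inputTy num (fun F _ _ x => x.2.2.2.2) := snd (snd (snd (snd id)))
  have hp : PolyTime inputTy (.list point)
      (fun F _ _ x => ListAlg.points (F := F) x.2.1 x.2.2.1) :=
    points (fst (snd id)) (fst (snd (snd id)))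
  exact decode hδ hμ (fst (snd (snd (snd id)))) hp (constraints hδ hμ hp)

end PolyTime

/-! ### Koetter–Vardy interpolation -/

namespace KoetterVardy

section linear

variable {F : Type} [Field F]

/-- The coefficient of `X ^ r Y ^ s` in `Q(X + a, Y + b)`, as a linear functional of `Q`. -/
noncomputable def shiftCoeff (a b : F) (r s : ℕ) : F[X][X] →ₗ[F] F where
  toFun Q := (((Q.map (compRingHom (X + C a))).comp (X + C (C b))).coeff s).coeff r
  map_add' P Q := by simp
  map_smul' c Q := by
    have : c • Q = C (C c) * Q := by
      ext i j
      simp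
    rw [this]
    simp

theorem hasZeroOfMult_iff (Q : F[X][X]) (a b : F) (m : ℕ) :
    HasZeroOfMult Q a b m ↔ ∀ r s : ℕ, r + s < m → shiftCoeff a b r s Q = 0 := Iff.rfl

/-- The monomial `X ^ i Y ^ j`. -/
noncomputable def bimon (m : ℕ × ℕ) : F[X][X] := monomial m.2 (monomial m.1 1)

/-- The shifted monomial is a product of one polynomial in `X` and one in `Y`. This is the form in
which `constraintVal` evaluates a constraint. -/
theorem shiftCoeff_bimon (a b : F) (r s : ℕ) (m : ℕ × ℕ) :
    shiftCoeff a b r s (bimon m) = ((X + C a) ^ m.1).coeff r * ((X + C b) ^ m.2).coeff s := by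
  have h1 : (X + C (C b) : F[X][X]) = (X + C b : F[X]).map C := by simp
  change ((((bimon m).map (compRingHom (X + C a))).comp (X + C (C b))).coeff s).coeff r = _
  rw [bimon, map_monomial, monomial_comp, h1, ← Polynomial.map_pow, coeff_C_mul, coeff_map,
    coeff_mul_C]
  simp [coe_compRingHom, ← C_mul_X_pow_eq_monomial]

theorem coeff_bimon (m : ℕ × ℕ) (i j : ℕ) :
    ((bimon m : F[X][X]).coeff j).coeff i = if m = (i, j) then 1 else 0 := by
  rw [bimon, coeff_monomial]
  by_cases hj : m.2 = j
  · by_cases hi : m.1 = i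
    · simp [Prod.ext_iff, hi, hj]
    · simp [Prod.ext_iff, hi, hj, coeff_monomial]
  · simp [Prod.ext_iff, hj]

theorem eq_sum_bimon (Q : F[X][X]) :
    Q = ∑ j ∈ Q.support, ∑ i ∈ (Q.coeff j).support, (Q.coeff j).coeff i • bimon (i, j) := by
  conv_lhs => rw [Q.as_sum_support]
  refine Finset.sum_congr rfl fun j _ => ?_
  conv_lhs => rw [(Q.coeff j).as_sum_support, map_sum]
  refine Finset.sum_congr rfl fun i _ => ?_
  rw [bimon, smul_monomial, smul_monomial, smul_eq_mul, mul_one]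

/-- Degree bounds are conditions on exponents, whereas elimination handles spans of monomials; this
passes between the two. -/
theorem mem_span_bimon {S : Set (ℕ × ℕ)} {Q : F[X][X]} :
    Q ∈ Submodule.span F (bimon '' S) ↔ ∀ i j, (Q.coeff j).coeff i ≠ 0 → (i, j) ∈ S := by
  constructor
  · intro h
    induction h using Submodule.span_induction with
    | mem Q hQ =>
      obtain ⟨m, hm, rfl⟩ := hQ
      intro i j hij
      rw [coeff_bimon] at hij
      by_cases h : m = (i, j)
      · rwa [← h]
      · simp [h] at hij
    | zero => simp
    | add P Q _ _ hP hQ =>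
      intro i j hij
      by_contra hS
      refine hij ?_
      rw [coeff_add, coeff_add, not_not.1 fun h => hS (hP i j h), not_not.1 fun h => hS (hQ i j h),
        add_zero]
    | smul c Q _ hQ =>
      intro i j hij
      refine hQ i j fun h => hij ?_
      rw [coeff_smul, coeff_smul, h, smul_zero]
  · intro h
    rw [eq_sum_bimon Q]
    refine Submodule.sum_mem _ fun j _ => Submodule.sum_mem _ fun i hi => Submodule.smul_mem _ _ ?_
    exact Submodule.subset_span ⟨_, h i j (mem_support_iff.1 hi), rfl⟩

/-- More monomials than linear conditions leave room for a nonzero polynomial. -/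
theorem exists_ne_zero {ι : Type*} [Fintype ι] (φ : ι → F[X][X] →ₗ[F] F)
    (S : Finset (ℕ × ℕ)) (h : Fintype.card ι < S.card) :
    ∃ Q ∈ Submodule.span F (bimon '' (S : Set (ℕ × ℕ))), Q ≠ 0 ∧ ∀ i, φ i Q = 0 := by
  let T : (S → F) →ₗ[F] F[X][X] := Fintype.linearCombination F (fun m : S => bimon (m : ℕ × ℕ))
  have hT : ∀ x, T x = ∑ m : S, x m • bimon (m : ℕ × ℕ) := fun x =>
    Fintype.linearCombination_apply F _ _
  let Φ : (S → F) →ₗ[F] (ι → F) := LinearMap.pi fun i => (φ i).comp T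
  have hker := LinearMap.ker_ne_bot_of_finrank_lt (f := Φ) (by simpa using h)
  obtain ⟨x, hx, hx0⟩ := Submodule.exists_mem_ne_zero_of_ne_bot hker
  refine ⟨T x, ?_, ?_, fun i => congrFun (LinearMap.mem_ker.1 hx) i⟩
  · rw [hT]
    exact Submodule.sum_mem _ fun m _ => Submodule.smul_mem _ _
      (Submodule.subset_span ⟨m, m.2, rfl⟩)
  · intro h0
    apply hx0
    funext m
    have := congrArg (fun Q : F[X][X] => (Q.coeff (m : ℕ × ℕ).2).coeff (m : ℕ × ℕ).1) h0
    simp only [hT, finsetSum_coeff, coeff_smul, coeff_bimon, coeff_zero, smul_eq_mul] at this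
    rw [Finset.sum_eq_single m] at this
    · simpa using this
    · intro m' _ hm'
      have : (m' : ℕ × ℕ) ≠ m := fun h => hm' (Subtype.ext h)
      simp [this]
    · simp

theorem weightedDegree_le_iff (k w : ℕ) (Q : F[X][X]) :
    weightedDegree k Q ≤ w ↔ ∀ i j, (Q.coeff j).coeff i ≠ 0 → i + (k - 1) * j ≤ w := by
  rw [weightedDegree, Finset.sup_le_iff]
  constructor
  · intro h i j hij
    have hj : Q.coeff j ≠ 0 := fun h0 => hij (by rw [h0, coeff_zero])
    exact (Nat.add_le_add_right (le_natDegree_of_ne_zero hij) _).trans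
      (h j (mem_support_iff.2 hj))
  · intro h j hj
    refine h _ j ?_
    rw [coeff_natDegree]
    exact leadingCoeff_ne_zero.2 (mem_support_iff.1 hj)

end linear

section divisibility

variable {F : Type} [Field F]

/-- Move the origin to `(a, f(a))`. The shifted `f` vanishes at `0`, so substituting it into a
monomial `X ^ r Y ^ s` gives a multiple of `X ^ (r + s)`, and only monomials with `r + s ≥ m` occur.
-/
theorem pow_dvd_eval (Q : F[X][X]) (f : F[X]) (a : F) (m : ℕ)
    (h : HasZeroOfMult Q a (f.eval a) m) : (X - C a) ^ m ∣ Q.eval f := by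
  set P := (Q.map (compRingHom (X + C a))).comp (X + C (C (f.eval a))) with hP
  have h1 : P.eval (f.comp (X + C a) - C (f.eval a)) = (Q.eval f).comp (X + C a) := by
    rw [hP, eval_comp, eval_map, eval_add, eval_X, eval_C, sub_add_cancel]
    change eval₂ (compRingHom (X + C a)) (compRingHom (X + C a) f) Q = compRingHom (X + C a) _
    rw [eval₂_hom]
  have h2 : X ∣ f.comp (X + C a) - C (f.eval a) := by
    rw [X_dvd_iff, coeff_zero_eq_eval_zero]
    simp
  have h3 : X ^ m ∣ P.eval (f.comp (X + C a) - C (f.eval a)) := by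
    rw [eval_eq_sum_range]
    refine Finset.dvd_sum fun s _ => ?_
    have h4 : X ^ (m - s) ∣ P.coeff s := by
      rw [X_pow_dvd_iff]
      intro r hr
      exact h r s (by omega)
    exact (pow_dvd_pow X (show m ≤ (m - s) + s by omega)).trans
      (by rw [pow_add]; exact mul_dvd_mul h4 (pow_dvd_pow_of_dvd h2 s))
  rw [h1] at h3
  obtain ⟨g, hg⟩ := h3
  refine ⟨g.comp (X - C a), ?_⟩
  have := congrArg (fun p : F[X] => p.comp (X - C a)) hg
  simpa [comp_assoc] using this

variable {n : ℕ}

theorem natDegree_eval_le (k : ℕ) (Q : F[X][X]) (f : F[X]) (hf : f.degree < k) :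
    (Q.eval f).natDegree ≤ weightedDegree k Q := by
  rw [eval_eq_sum]
  refine natDegree_sum_le_of_forall_le _ _ fun j hj => ?_
  refine (natDegree_mul_le.trans (Nat.add_le_add_left natDegree_pow_le _)).trans ?_
  have : f.natDegree ≤ k - 1 := by
    by_cases h0 : f = 0
    · simp [h0]
    · have := (natDegree_lt_iff_degree_lt h0).2 hf
      omega
  refine le_trans ?_ (Finset.le_sup (f := fun j => (Q.coeff j).natDegree + (k - 1) * j) hj)
  rw [mul_comm j]
  gcongr

/-- A polynomial whose word has a score above the weighted degree gives a factor. -/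
theorem X_sub_C_dvd (k : ℕ) (α : Fin n ↪ F) (M : Matrix F (Fin n) ℕ) (Q : F[X][X])
    (hQ : ∀ v j, HasZeroOfMult Q (α j) v (M v j)) (f : F[X]) (hf : f.degree < k)
    (h : weightedDegree k Q < score M (evalWord α f)) : X - C f ∣ Q := by
  rw [dvd_iff_isRoot, IsRoot]
  by_contra h0
  -- The divisor has the score as its degree, since the powers belong to distinct points. A nonzero
  -- `Q(X, f(X))` would have degree at most the weighted degree, which is smaller.
  have h1 : (∏ j, (X - C (α j)) ^ M (evalWord α f j) j) ∣ Q.eval f := by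
    refine Finset.prod_dvd_of_coprime ?_ fun j _ => pow_dvd_eval Q f _ _ (hQ _ j)
    intro i _ j _ hij
    exact (pairwise_coprime_X_sub_C α.injective hij).pow
  have h2 := natDegree_le_of_dvd h1 h0
  rw [natDegree_prod_of_monic _ _ fun j _ => (monic_X_sub_C _).pow _] at h2
  simp only [natDegree_pow, natDegree_X_sub_C, mul_one] at h2
  have := natDegree_eval_le k Q f hf
  have h3 : ∑ j, M (evalWord α f j) j = score M (evalWord α f) := rfl
  omega

end divisibility

end KoetterVardy

namespace ListAlg

/-! ### Coefficient lists as polynomials -/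

section polyOf

variable {A R : Type} [CommRing R]

/-- The polynomial with a given list of coefficients. -/
noncomputable def polyOf (val : A → R) (l : List A) : R[X] :=
  l.foldr (fun a p => C (val a) + X * p) 0

variable (val : A → R)

@[simp] theorem polyOf_nil : polyOf val [] = 0 := rfl

@[simp] theorem polyOf_cons (a : A) (l : List A) :
    polyOf val (a :: l) = C (val a) + X * polyOf val l := rfl

theorem polyOf_append (l l' : List A) :
    polyOf val (l ++ l') = polyOf val l + X ^ l.length * polyOf val l' := by
  induction l with
  | nil => simp
  | cons a l ih => rw [List.cons_append, polyOf_cons, ih, polyOf_cons, List.length_cons]; ring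

theorem zipAdd_nil_left (add : A → A → A) (l : List A) : zipAdd add [] l = l := by simp [zipAdd]

theorem zipAdd_nil_right (add : A → A → A) (l : List A) : zipAdd add l [] = l := by simp [zipAdd]

theorem zipAdd_cons (add : A → A → A) (a b : A) (l l' : List A) :
    zipAdd add (a :: l) (b :: l') = add a b :: zipAdd add l l' := by simp [zipAdd]

theorem polyOf_zipAdd {add : A → A → A} (h : ∀ a b, val (add a b) = val a + val b)
    (l l' : List A) : polyOf val (zipAdd add l l') = polyOf val l + polyOf val l' := by
  induction l generalizing l' with
  | nil => simp [zipAdd_nil_left]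
  | cons a l ih =>
    cases l' with
    | nil => simp [zipAdd_nil_right]
    | cons b l' => rw [zipAdd_cons, polyOf_cons, ih, h, C_add, polyOf_cons, polyOf_cons]; ring

theorem polyOf_map_mul {mul : A → A → A} (h : ∀ a b, val (mul a b) = val a * val b) (a : A)
    (l : List A) : polyOf val (l.map fun b => mul a b) = C (val a) * polyOf val l := by
  induction l with
  | nil => simp
  | cons b l ih => rw [List.map_cons, polyOf_cons, ih, h, C_mul, polyOf_cons]; ring

theorem polyOf_conv {add mul : A → A → A} {z : A} (hadd : ∀ a b, val (add a b) = val a + val b)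
    (hmul : ∀ a b, val (mul a b) = val a * val b) (hz : val z = 0) (l l' : List A) :
    polyOf val (conv add mul z l l') = polyOf val l * polyOf val l' := by
  induction l with
  | nil => simp [conv]
  | cons a l ih =>
    change polyOf val (zipAdd add _ (z :: conv add mul z l l')) = _
    rw [polyOf_zipAdd val hadd, polyOf_map_mul val hmul, polyOf_cons, ih, hz, polyOf_cons, C_0]
    ring

theorem coeff_polyOf (z : A) (hz : val z = 0) (l : List A) (i : ℕ) :
    (polyOf val l).coeff i = val ((l.drop i).headD z) := by
  induction l generalizing i with
  | nil => simp [hz]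
  | cons a l ih =>
    cases i with
    | zero => simp
    | succ i => rw [polyOf_cons, coeff_add, coeff_C_succ, coeff_X_mul, ih]; simp

end polyOf

section field

variable {F : Type} [Field F] [DecidableEq F]

/-- The polynomial of a list over the field. -/
noncomputable abbrev toPoly (l : List F) : F[X] := polyOf (fun x => x) l

/-- The bivariate polynomial of a list of lists. -/
noncomputable abbrev toPoly₂ (l : List (List F)) : F[X][X] := polyOf toPoly l

theorem toPoly_cons (a : F) (p : List F) : toPoly (a :: p) = C a + X * toPoly p := rfl

theorem toPoly₂_cons (a : List F) (p : List (List F)) :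
    toPoly₂ (a :: p) = C (toPoly a) + X * toPoly₂ p := rfl

theorem toPoly_padd (p q : List F) : toPoly (padd p q) = toPoly p + toPoly q :=
  polyOf_zipAdd _ (fun _ _ => rfl) p q

theorem toPoly_pmul (p q : List F) : toPoly (pmul p q) = toPoly p * toPoly q :=
  polyOf_conv (fun x => x) (add := fun x y => x + y) (mul := fun x y => x * y) (z := 0)
    (fun _ _ => rfl) (fun _ _ => rfl) rfl p q

theorem toPoly_psmul (c : F) (p : List F) : toPoly (psmul c p) = C c * toPoly p :=
  polyOf_map_mul _ (mul := fun x y => x * y) (fun _ _ => rfl) c p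

theorem toPoly_ppow (p : List F) (n : List Unit) : toPoly (ppow p n) = toPoly p ^ n.length := by
  induction n with
  | nil => simp [ppow]
  | cons u n ih =>
    change toPoly (pmul p (ppow p n)) = _
    rw [toPoly_pmul, ih, List.length_cons, pow_succ']

theorem peval_eq (p : List F) (x : F) : peval p x = (toPoly p).eval x := by
  induction p with
  | nil => simp [peval]
  | cons a p ih =>
    change a + x * peval p x = _
    rw [ih, toPoly_cons, eval_add, eval_C, eval_mul, eval_X]

/-- Coefficient lists are not normalised: trailing zeros occur, so the zero polynomial has many
representations and emptiness is not the right test. -/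
theorem isZero_iff (p : List F) : isZero p = true ↔ toPoly p = 0 := by
  induction p with
  | nil => simp [isZero]
  | cons a p ih =>
    have h : isZero (a :: p) = (decide (a = 0) && isZero p) := rfl
    rw [h, Bool.and_eq_true, ih, decide_eq_true_iff, toPoly_cons]
    constructor
    · rintro ⟨h1, h2⟩
      simp [h1, h2]
    · intro h
      have h0 : a = 0 := by simpa using congrArg (fun p => coeff p 0) h
      subst h0
      simpa using h

theorem toPoly₂_padd₂ (p q : List (List F)) : toPoly₂ (padd₂ p q) = toPoly₂ p + toPoly₂ q :=
  polyOf_zipAdd _ toPoly_padd p q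

theorem toPoly₂_pmul₂ (p q : List (List F)) : toPoly₂ (pmul₂ p q) = toPoly₂ p * toPoly₂ q :=
  polyOf_conv _ toPoly_padd toPoly_pmul rfl p q

theorem toPoly₂_ppow₂ (p : List (List F)) (n : List Unit) :
    toPoly₂ (ppow₂ p n) = toPoly₂ p ^ n.length := by
  induction n with
  | nil => simp [ppow₂]
  | cons u n ih =>
    change toPoly₂ (pmul₂ p (ppow₂ p n)) = _
    rw [toPoly₂_pmul₂, ih, List.length_cons, pow_succ']

theorem isZero₂_iff (p : List (List F)) : isZero₂ p = true ↔ toPoly₂ p = 0 := by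
  induction p with
  | nil => simp [isZero₂]
  | cons a p ih =>
    have h : isZero₂ (a :: p) = (isZero a && isZero₂ p) := rfl
    rw [h, Bool.and_eq_true, ih, isZero_iff, toPoly₂_cons]
    constructor
    · rintro ⟨h1, h⟩
      simp [h, h1]
    · intro h
      have h0 : toPoly a = 0 := by simpa using congrArg (fun p => coeff p 0) h
      simpa [h0] using h

theorem eqW_iff (p q : List F) : eqW p q = true ↔ p = q := by
  induction p generalizing q with
  | nil => cases q <;> simp [eqW]
  | cons a p ih =>
    cases q with
    | nil => simp [eqW]
    | cons b q =>
      have := ih q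
      simp only [eqW, Bool.and_eq_true, List.length_cons, List.drop_succ_cons, List.zip_cons_cons,
        List.all_cons, decide_eq_true_iff, List.cons.injEq] at this ⊢
      rw [← this]
      tauto

end field

/-! ### Elimination -/

section elimination

open KoetterVardy

/-- The map `g ↦ g - (Φ g / Φ p) p` is the linear projection onto the kernel of `Φ` along `p`. It
maps the span into itself because `p` lies in it, and it fixes the elements of the kernel. -/
theorem span_eliminate {K V : Type*} [Field K] [AddCommGroup V] [Module K V] (Φ : V →ₗ[K] K)
    (S : Set V) (p : V) (hp : p ∈ S) (h : Φ p ≠ 0) :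
    Submodule.span K ((fun g => g + (0 - Φ g * (Φ p)⁻¹) • p) '' S) =
      Submodule.span K S ⊓ LinearMap.ker Φ := by
  apply le_antisymm
  · rw [Submodule.span_le]
    rintro _ ⟨g, hg, rfl⟩
    refine ⟨Submodule.add_mem _ (Submodule.subset_span hg)
      (Submodule.smul_mem _ _ (Submodule.subset_span hp)), ?_⟩
    simp only [SetLike.mem_coe, LinearMap.mem_ker, map_add, map_smul, smul_eq_mul]
    field_simp
    ring
  · rintro x ⟨hx, hx0⟩
    have key : ∀ x ∈ Submodule.span K S, x + (0 - Φ x * (Φ p)⁻¹) • p ∈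
        Submodule.span K ((fun g => g + (0 - Φ g * (Φ p)⁻¹) • p) '' S) := by
      intro x hx
      induction hx using Submodule.span_induction with
      | mem x hx => exact Submodule.subset_span ⟨x, hx, rfl⟩
      | zero => simp
      | add x y _ _ hx hy =>
        convert Submodule.add_mem _ hx hy using 1
        rw [map_add]
        module
      | smul c x _ hx =>
        convert Submodule.smul_mem _ c hx using 1
        rw [map_smul, smul_eq_mul]
        module
    have := key x hx
    rw [LinearMap.mem_ker.1 hx0] at this
    simpa using this

variable {F : Type} [Field F] [DecidableEq F]

/-- The exponents of a monomial. -/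
def expo (m : List Unit × List Unit) : ℕ × ℕ := (m.1.length, m.2.length)

/-- The polynomial of a list of terms. -/
noncomputable def termsSum (Q : List (F × List Unit × List Unit)) : F[X][X] :=
  (Q.map fun t => t.1 • bimon (expo t.2)).sum

/-- The polynomial of a coefficient vector. -/
noncomputable def vecPoly (ms : List (List Unit × List Unit)) (g : List F) : F[X][X] :=
  termsSum (g.zip ms)

theorem vecPoly_cons (m : List Unit × List Unit) (ms : List (List Unit × List Unit)) (c : F)
    (g : List F) : vecPoly (m :: ms) (c :: g) = c • bimon (expo m) + vecPoly ms g := by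
  simp [vecPoly, termsSum]

@[simp] theorem vecPoly_nil_left (g : List F) : vecPoly [] g = 0 := by
  simp [vecPoly, termsSum]

@[simp] theorem vecPoly_nil_right (ms : List (List Unit × List Unit)) :
    vecPoly ms ([] : List F) = 0 := by simp [vecPoly, termsSum]

theorem vecPoly_padd (ms : List (List Unit × List Unit)) (g h : List F) :
    vecPoly ms (padd g h) = vecPoly ms g + vecPoly ms h := by
  induction ms generalizing g h with
  | nil => simp
  | cons m ms ih =>
    cases g with
    | nil => simp [padd, zipAdd_nil_left]
    | cons a g =>
      cases h with
      | nil => simp [padd, zipAdd_nil_right]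
      | cons b h =>
        have : padd (a :: g) (b :: h) = (a + b) :: padd g h := zipAdd_cons _ _ _ _ _
        rw [this, vecPoly_cons, vecPoly_cons, vecPoly_cons, ih]
        module

theorem vecPoly_psmul (ms : List (List Unit × List Unit)) (c : F) (g : List F) :
    vecPoly ms (psmul c g) = c • vecPoly ms g := by
  induction ms generalizing g with
  | nil => simp
  | cons m ms ih =>
    cases g with
    | nil => simp [psmul]
    | cons a g =>
      have : psmul c (a :: g) = (c * a) :: psmul c g := rfl
      rw [this, vecPoly_cons, vecPoly_cons, ih]
      module

theorem dot_eq (Φ : F[X][X] →ₗ[F] F) (ms : List (List Unit × List Unit)) (g : List F) :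
    dot (ms.map fun m => Φ (bimon (expo m))) g = Φ (vecPoly ms g) := by
  induction ms generalizing g with
  | nil => simp [dot]
  | cons m ms ih =>
    cases g with
    | nil => simp [dot]
    | cons a g =>
      rw [vecPoly_cons, map_add, ← ih, map_smul, smul_eq_mul, mul_comm]
      rfl

theorem vecPoly_mem_span (ms : List (List Unit × List Unit)) (g : List F) :
    vecPoly ms g ∈ Submodule.span F (bimon '' {m | m ∈ ms.map expo}) := by
  induction ms generalizing g with
  | nil => simp
  | cons m ms ih =>
    cases g with
    | nil => simp
    | cons a g =>
      rw [vecPoly_cons]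
      refine Submodule.add_mem _ (Submodule.smul_mem _ _ (Submodule.subset_span
        ⟨_, by simp, rfl⟩)) (Submodule.span_mono (Set.image_mono ?_) (ih g))
      intro x hx
      simp only [List.map_cons, List.mem_cons, Set.mem_ofPred_eq] at hx ⊢
      exact Or.inr hx

/-- Monomials with distinct exponents are linearly independent. The length bound is needed because
`zip` ignores coefficients beyond the last monomial. -/
theorem isZero_of_vecPoly_eq_zero (ms : List (List Unit × List Unit)) (hms : (ms.map expo).Nodup)
    (g : List F) (hg : g.length ≤ ms.length) (h : vecPoly ms g = 0) : isZero g = true := by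
  induction ms generalizing g with
  | nil => rw [List.length_nil, Nat.le_zero, List.length_eq_zero_iff] at hg; subst hg; rfl
  | cons m ms ih =>
    cases g with
    | nil => rfl
    | cons a g =>
      rw [List.map_cons, List.nodup_cons] at hms
      have h1 := vecPoly_mem_span ms g
      rw [mem_span_bimon] at h1
      have h2 : ((vecPoly ms g).coeff (expo m).2).coeff (expo m).1 = 0 :=
        not_not.1 fun h3 => hms.1 (h1 _ _ h3)
      rw [vecPoly_cons] at h
      have h3 := congrArg (fun Q : F[X][X] => (Q.coeff (expo m).2).coeff (expo m).1) h
      simp only [coeff_add, coeff_smul, coeff_bimon, h2] at h3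
      have ha : a = 0 := by simpa using h3
      subst ha
      have := ih hms.2 g (by simpa using hg) (by simpa using h)
      simpa [isZero] using this

theorem vecPoly_of_isZero (ms : List (List Unit × List Unit)) (g : List F)
    (h : isZero g = true) : vecPoly ms g = 0 := by
  induction ms generalizing g with
  | nil => simp
  | cons m ms ih =>
    cases g with
    | nil => simp
    | cons a g =>
      simp only [isZero, List.all_cons, Bool.and_eq_true, decide_eq_true_iff] at h
      rw [vecPoly_cons, ih g h.2, h.1]
      simp

theorem vecPoly_replicate_append (ms : List (List Unit × List Unit)) (t : ℕ)
    (ht : t < ms.length) (l : List Unit) (hl : l.length = t) :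
    vecPoly (F := F) ms ((l.map fun _ => 0) ++ [1]) = bimon (expo ms[t]) := by
  induction ms generalizing t l with
  | nil => simp at ht
  | cons m ms ih =>
    cases l with
    | nil =>
      simp only [List.length_nil] at hl
      subst hl
      simp [vecPoly_cons]
    | cons u l =>
      simp only [List.length_cons] at hl
      subst hl
      rw [List.map_cons, List.cons_append, vecPoly_cons,
        ih l.length (by simpa using ht) l rfl]
      simp

/-- What the elimination maintains: nonzero generators of a space. -/
structure Generates (ms : List (List Unit × List Unit)) (L : List (List F))
    (W : Submodule F F[X][X]) : Prop where
  length_le : ∀ g ∈ L, g.length ≤ ms.length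
  ne_zero : ∀ g ∈ L, vecPoly ms g ≠ 0
  span_eq : Submodule.span F (vecPoly ms '' {g | g ∈ L}) = W

theorem generates_unitVecs (ms : List (List Unit × List Unit)) :
    Generates ms (unitVecs F ms) (Submodule.span F (bimon '' {m | m ∈ ms.map expo})) := by
  have key : ∀ g ∈ unitVecs F ms, ∃ t, ∃ h : t < ms.length,
      vecPoly ms g = bimon (expo ms[t]) ∧ g.length = t + 1 := by
    intro g hg
    simp only [unitVecs, rangeU, List.map_map, List.mem_map, List.mem_range] at hg
    obtain ⟨t, ht, rfl⟩ := hg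
    exact ⟨t, ht, vecPoly_replicate_append ms t ht _ (by simp), by simp⟩
  refine ⟨?_, ?_, le_antisymm ?_ ?_⟩
  · intro g hg
    obtain ⟨t, ht, -, h⟩ := key g hg
    omega
  · intro g hg h0
    obtain ⟨t, ht, h, -⟩ := key g hg
    rw [h] at h0
    have := congrArg (fun Q : F[X][X] => (Q.coeff (expo ms[t]).2).coeff (expo ms[t]).1) h0
    simp [coeff_bimon] at this
  · rw [Submodule.span_le]
    rintro _ ⟨g, -, rfl⟩
    exact vecPoly_mem_span ms g
  · refine Submodule.span_mono ?_
    rintro _ ⟨m, hm, rfl⟩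
    obtain ⟨m', hm', rfl⟩ := List.mem_map.1 hm
    obtain ⟨t, ht, rfl⟩ := List.getElem_of_mem hm'
    refine ⟨((List.replicate t ()).map fun _ => 0) ++ [1], ?_,
      vecPoly_replicate_append ms t ht _ (by simp)⟩
    simp only [unitVecs, rangeU, List.map_map, List.mem_map, List.mem_range, Set.mem_ofPred_eq]
    exact ⟨t, ht, rfl⟩

/-- Without a generator outside the kernel nothing changes. Otherwise `span_eliminate` applies with
the first such generator as pivot. Discarding zero vectors, among them the image of the pivot,
leaves the span unchanged and restores `ne_zero`. -/
theorem Generates.elim {ms : List (List Unit × List Unit)} (hms : (ms.map expo).Nodup)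
    {L : List (List F)} {W : Submodule F F[X][X]} (h : Generates ms L W) (Φ : F[X][X] →ₗ[F] F) :
    Generates ms (ListAlg.elim (ms.map fun m => Φ (bimon (expo m))) L) (W ⊓ LinearMap.ker Φ) := by
  unfold ListAlg.elim
  simp only [dot_eq]
  rcases hL : L.filter (fun g => !decide (Φ (vecPoly ms g) = 0)) with _ | ⟨p, L'⟩
  · have h0 : ∀ g ∈ L, Φ (vecPoly ms g) = 0 := by
      intro g hg
      have := List.filter_eq_nil_iff.1 hL g hg
      simpa using this
    refine ⟨h.length_le, h.ne_zero, ?_⟩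
    rw [h.span_eq, eq_comm, inf_eq_left, ← h.span_eq, Submodule.span_le]
    rintro _ ⟨g, hg, rfl⟩
    exact h0 g hg
  · have hp : p ∈ L.filter (fun g => !decide (Φ (vecPoly ms g) = 0)) := by simp [hL]
    rw [List.mem_filter] at hp
    have hp0 : Φ (vecPoly ms p) ≠ 0 := by simpa using hp.2
    have hlen : ∀ g ∈ L, (padd g (psmul (0 - Φ (vecPoly ms g) * (Φ (vecPoly ms p))⁻¹) p)).length ≤
        ms.length := by
      intro g hg
      rw [padd, PolyTime.length_zipAdd, psmul, List.length_map]
      exact max_le (h.length_le g hg) (h.length_le p hp.1)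
    change Generates ms ((L.map fun g => padd g
      (psmul (0 - Φ (vecPoly ms g) * (Φ (vecPoly ms p))⁻¹) p)).filter fun g => !isZero g) _
    refine ⟨?_, ?_, ?_⟩
    · intro g hg
      obtain ⟨g', hg', rfl⟩ := List.mem_map.1 (List.mem_filter.1 hg).1
      exact hlen g' hg'
    · intro g hg h0
      rw [List.mem_filter] at hg
      obtain ⟨g', hg', hgg⟩ := List.mem_map.1 hg.1
      have := isZero_of_vecPoly_eq_zero ms hms g (by rw [← hgg]; exact hlen g' hg') h0
      rw [this] at hg
      simp at hg
    · rw [← h.span_eq, ← span_eliminate Φ _ (vecPoly ms p) (Set.mem_image_of_mem (vecPoly ms)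
        (show p ∈ {g | g ∈ L} from hp.1)) hp0,
        Set.image_image]
      have hv : ∀ g : List F, vecPoly ms (padd g
          (psmul (0 - Φ (vecPoly ms g) * (Φ (vecPoly ms p))⁻¹) p)) =
          vecPoly ms g + (0 - Φ (vecPoly ms g) * (Φ (vecPoly ms p))⁻¹) • vecPoly ms p := fun g => by
        rw [vecPoly_padd, vecPoly_psmul]
      apply le_antisymm <;> rw [Submodule.span_le]
      · rintro _ ⟨g, hg, rfl⟩
        obtain ⟨g', hg', rfl⟩ := List.mem_map.1 (List.mem_filter.1 hg).1
        exact Submodule.subset_span ⟨g', hg', (hv g').symm⟩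
      · rintro _ ⟨g, hg, rfl⟩
        simp only [SetLike.mem_coe]
        rw [← hv]
        by_cases hz : isZero (padd g
            (psmul (0 - Φ (vecPoly ms g) * (Φ (vecPoly ms p))⁻¹) p)) = true
        · rw [vecPoly_of_isZero ms _ hz]
          exact Submodule.zero_mem _
        · refine Submodule.subset_span ⟨_, List.mem_filter.2 ⟨List.mem_map.2 ⟨g, hg, rfl⟩, ?_⟩, rfl⟩
          simpa using hz

/-- The functional of a constraint. -/
noncomputable def constraintFun (c : F × F × List Unit × List Unit) : F[X][X] →ₗ[F] F :=
  shiftCoeff c.1 c.2.1 c.2.2.1.length c.2.2.2.length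

theorem constraintVal_eq (c : F × F × List Unit × List Unit) (m : List Unit × List Unit) :
    constraintVal c m = constraintFun c (bimon (expo m)) := by
  rw [constraintFun, shiftCoeff_bimon, constraintVal]
  have h : ∀ (a : F) (i r : List Unit),
      ((ppow [a, 1] i).drop r.length).headD 0 = ((X + C a) ^ i.length).coeff r.length := by
    intro a i r
    rw [← coeff_polyOf (fun x => x) 0 rfl]
    have := toPoly_ppow [a, 1] i
    rw [toPoly] at this
    rw [this]
    simp [add_comm]
  rw [h, h]
  rfl

theorem generates_kernelGens (cs : List (F × F × List Unit × List Unit))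
    (ms : List (List Unit × List Unit)) (hms : (ms.map expo).Nodup) :
    ∃ W : Submodule F F[X][X], Generates ms (kernelGens cs ms) W ∧
      ∀ Q, Q ∈ W ↔ Q ∈ Submodule.span F (bimon '' {m | m ∈ ms.map expo}) ∧
        ∀ c ∈ cs, constraintFun c Q = 0 := by
  induction cs with
  | nil => exact ⟨_, generates_unitVecs ms, by simp⟩
  | cons c cs ih =>
    obtain ⟨W, h1, h2⟩ := ih
    refine ⟨W ⊓ LinearMap.ker (constraintFun c), ?_, ?_⟩
    · have := h1.elim hms (constraintFun c)
      simp only [← constraintVal_eq] at this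
      exact this
    · intro Q
      rw [Submodule.mem_inf, h2, LinearMap.mem_ker, List.forall_mem_cons]
      tauto

end elimination

end ListAlg

/-! ### Correctness of the interpolation step -/

namespace ListAlg

open KoetterVardy

section interpolation

theorem rangeU_append {A : Type} (cs : List A) : rangeU cs ++ [cs.map fun _ => ()] =
    (List.range (cs.length + 1)).map fun i => List.replicate i () := by
  rw [List.range_succ, List.map_append, rangeU]
  simp

/-- The exponents of `monos`. -/
def natMonos (C k w : ℕ) : List (ℕ × ℕ) :=
  (List.range (C + 1)).flatMap fun i =>
    ((List.range (C + 1)).filter fun j => decide (i + (k - 1) * j ≤ w)).map fun j => (i, j)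

theorem map_expo_monos {A : Type} (cs : List A) (k w : ℕ) :
    (monos cs (List.replicate k ()) (List.replicate w ())).map expo =
      natMonos cs.length k w := by
  rw [monos, rangeU_append, natMonos, List.flatMap_map, List.map_flatMap]
  refine List.flatMap_congr fun i _ => ?_
  rw [List.filter_map, List.map_map, List.map_map]
  have h : ((fun j => leU (List.replicate i () ++ List.flatMap
      (fun _ => (List.replicate k ()).tail) j) (List.replicate w ())) ∘
      fun i => List.replicate i ()) = fun j => decide (i + (k - 1) * j ≤ w) := by
    funext j
    rw [Bool.eq_iff_iff, decide_eq_true_iff]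
    simp [leU, Nat.mul_comm]
  rw [h]
  refine List.map_congr_left fun j _ => ?_
  simp [expo]

theorem mem_natMonos {C k w i j : ℕ} :
    (i, j) ∈ natMonos C k w ↔ i ≤ C ∧ j ≤ C ∧ i + (k - 1) * j ≤ w := by
  simp only [natMonos, List.mem_flatMap, List.mem_map, List.mem_filter, List.mem_range,
    decide_eq_true_iff, Prod.mk.injEq]
  constructor
  · rintro ⟨_, hi, _, ⟨hj, h⟩, rfl, rfl⟩
    omega
  · rintro ⟨hi, hj, h⟩
    exact ⟨i, by omega, j, ⟨by omega, h⟩, rfl, rfl⟩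

theorem nodup_natMonos (C k w : ℕ) : (natMonos C k w).Nodup := by
  rw [natMonos, List.nodup_flatMap]
  refine ⟨fun i _ => ((List.nodup_range).filter _).map fun a b h => (Prod.mk.inj h).2, ?_⟩
  refine (List.nodup_range (n := C + 1)).imp ?_
  intro i i' hii x hx hx'
  obtain ⟨j, -, rfl⟩ := List.mem_map.1 hx
  obtain ⟨j', -, h⟩ := List.mem_map.1 hx'
  exact hii (Prod.mk.inj h).1.symm

/-- The head of a concatenation lies in the first nonempty block. Applied to blocks indexed by
degree bounds, this gives minimality of the degree. -/
theorem headD_flatMap_range {B : Type} (f : ℕ → List B) (d : B) (m : ℕ)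
    (h : ∃ w < m, f w ≠ []) : ∃ w < m, ∃ b ∈ f w,
      ((List.range m).flatMap f).headD d = b ∧ ∀ w' < w, f w' = [] := by
  induction m with
  | zero => simp at h
  | succ m ih =>
    rw [List.range_succ, List.flatMap_append]
    by_cases h0 : ∃ w < m, f w ≠ []
    · obtain ⟨w, hw, b, hb, h1, h2⟩ := ih h0
      refine ⟨w, by omega, b, hb, ?_, h2⟩
      have : (List.range m).flatMap f ≠ [] := by
        intro h3
        rw [List.flatMap_eq_nil_iff] at h3
        rw [h3 w (by simpa using hw)] at hb
        simp at hb
      obtain ⟨c, l, hl⟩ := List.exists_cons_of_ne_nil this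
      rw [hl] at h1 ⊢
      simpa using h1
    · push Not at h0
      have : (List.range m).flatMap f = [] := by
        rw [List.flatMap_eq_nil_iff]
        simpa using h0
      obtain ⟨w, hw, hw0⟩ := h
      have hwm : w = m := by
        by_contra hne
        exact hw0 (h0 w (by omega))
      subst hwm
      obtain ⟨c, l, hl⟩ := List.exists_cons_of_ne_nil hw0
      exact ⟨w, by omega, c, by simp [hl], by simp [this, hl], h0⟩

variable {F : Type} [Field F] [DecidableEq F]

theorem interpolate_spec (cs : List (F × F × List Unit × List Unit)) (k : ℕ) :
    termsSum (interpolate cs (List.replicate k ())) ≠ 0 ∧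
    (∀ c ∈ cs, constraintFun c (termsSum (interpolate cs (List.replicate k ()))) = 0) ∧
    (∀ Q' : F[X][X], Q' ≠ 0 → (∀ c ∈ cs, constraintFun c Q' = 0) →
      weightedDegree k (termsSum (interpolate cs (List.replicate k ()))) ≤ weightedDegree k Q') ∧
    (termsSum (interpolate cs (List.replicate k ()))).natDegree ≤ cs.length := by
  set ms : ℕ → List (List Unit × List Unit) := fun w =>
    monos cs (List.replicate k ()) (List.replicate w ()) with hms
  have hgen : ∀ w, ∃ W : Submodule F F[X][X], Generates (ms w) (kernelGens cs (ms w)) W ∧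
      ∀ Q, Q ∈ W ↔ (∀ i j, (Q.coeff j).coeff i ≠ 0 →
          i ≤ cs.length ∧ j ≤ cs.length ∧ i + (k - 1) * j ≤ w) ∧
        ∀ c ∈ cs, constraintFun c Q = 0 := by
    intro w
    obtain ⟨W, h1, h2⟩ := generates_kernelGens cs (ms w)
      (by rw [hms, map_expo_monos]; exact nodup_natMonos _ _ _)
    refine ⟨W, h1, fun Q => ?_⟩
    rw [h2, mem_span_bimon, hms]
    simp only [map_expo_monos, Set.mem_ofPred_eq, mem_natMonos]
  have hne : ∀ w, (∃ Q : F[X][X], Q ≠ 0 ∧ (∀ i j, (Q.coeff j).coeff i ≠ 0 →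
      i ≤ cs.length ∧ j ≤ cs.length ∧ i + (k - 1) * j ≤ w) ∧ ∀ c ∈ cs, constraintFun c Q = 0) →
      kernelGens cs (ms w) ≠ [] := by
    rintro w ⟨Q, hQ0, hQ⟩ hnil
    obtain ⟨W, h1, h2⟩ := hgen w
    rw [← h2, ← h1.span_eq, hnil] at hQ
    simp at hQ
    exact hQ0 hQ
  set f : ℕ → List (List (F × List Unit × List Unit)) := fun w =>
    (kernelGens cs (ms w)).map fun g => g.zip (ms w) with hf
  have hint : interpolate cs (List.replicate k ()) =
      ((List.range (cs.length + 1)).flatMap f).headD [] := by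
    rw [interpolate, rangeU_append, List.flatMap_map]
  -- A solution in `X` alone: it shows that the scan over `w` succeeds at the latest at the number
  -- of constraints.
  have hX : ∃ Q : F[X][X], Q ≠ 0 ∧ (∀ i j, (Q.coeff j).coeff i ≠ 0 → i ≤ cs.length ∧ j = 0) ∧
      ∀ c ∈ cs, constraintFun c Q = 0 := by
    obtain ⟨Q, hQ, hQ0, hQc⟩ := exists_ne_zero (fun t : Fin cs.length => constraintFun (cs.get t))
      ((Finset.range (cs.length + 1)).map ⟨fun i => (i, 0), fun a b h => (Prod.mk.inj h).1⟩)
      (by simp)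
    refine ⟨Q, hQ0, ?_, ?_⟩
    · rw [mem_span_bimon] at hQ
      intro i j hij
      obtain ⟨i', hi, h⟩ := Finset.mem_map.1 (Finset.mem_coe.1 (hQ i j hij))
      have := Finset.mem_range.1 hi
      have := Prod.mk.inj h
      omega
    · intro c hc
      obtain ⟨t, rfl⟩ := List.get_of_mem hc
      exact hQc t
  -- A solution in `Y` alone, used only when `Y` has weight zero.
  have hY : ∃ Q : F[X][X], Q ≠ 0 ∧ (∀ i j, (Q.coeff j).coeff i ≠ 0 → i = 0 ∧ j ≤ cs.length) ∧
      ∀ c ∈ cs, constraintFun c Q = 0 := by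
    obtain ⟨Q, hQ, hQ0, hQc⟩ := exists_ne_zero (fun t : Fin cs.length => constraintFun (cs.get t))
      ((Finset.range (cs.length + 1)).map ⟨fun i => (0, i), fun a b h => (Prod.mk.inj h).2⟩)
      (by simp)
    refine ⟨Q, hQ0, ?_, ?_⟩
    · rw [mem_span_bimon] at hQ
      intro i j hij
      obtain ⟨i', hi, h⟩ := Finset.mem_map.1 (Finset.mem_coe.1 (hQ i j hij))
      have := Finset.mem_range.1 hi
      have := Prod.mk.inj h
      omega
    · intro c hc
      obtain ⟨t, rfl⟩ := List.get_of_mem hc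
      exact hQc t
  obtain ⟨w, hw, b, hb, h1, h2⟩ := headD_flatMap_range f [] (cs.length + 1)
    ⟨cs.length, by omega, by
      obtain ⟨Q, hQ0, hQ1, hQ2⟩ := hX
      simp only [hf, ne_eq, List.map_eq_nil_iff]
      refine hne _ ⟨Q, hQ0, fun i j hij => ?_, hQ2⟩
      obtain ⟨hi, rfl⟩ := hQ1 i j hij
      simpa using hi⟩
  rw [hint, h1]
  obtain ⟨g, hg, rfl⟩ := List.mem_map.1 hb
  obtain ⟨W, hW1, hW2⟩ := hgen w
  change vecPoly (ms w) g ≠ 0 ∧ (∀ c ∈ cs, constraintFun c (vecPoly (ms w) g) = 0) ∧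
    (∀ Q' : F[X][X], Q' ≠ 0 → (∀ c ∈ cs, constraintFun c Q' = 0) →
      weightedDegree k (vecPoly (ms w) g) ≤ weightedDegree k Q') ∧
      (vecPoly (ms w) g).natDegree ≤ cs.length
  have hgW : vecPoly (ms w) g ∈ W := by
    rw [← hW1.span_eq]
    exact Submodule.subset_span ⟨g, hg, rfl⟩
  rw [hW2] at hgW
  refine ⟨hW1.ne_zero g hg, hgW.2, ?_, ?_⟩
  · intro Q' hQ0 hQ'
    have hle : weightedDegree k (vecPoly (ms w) g) ≤ w :=
      (weightedDegree_le_iff _ _ _).2 fun i j hij => (hgW.1 i j hij).2.2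
    refine hle.trans ?_
    by_contra! hlt
    have h3 := h2 _ hlt
    simp only [hf, List.map_eq_nil_iff] at h3
    refine hne _ ?_ h3
    -- If `Y` has weight zero, the solution in `Y` alone fits every degree bound. Otherwise a
    -- cheaper `Q'` has both exponents within the cap and would have been found at a smaller `w`.
    by_cases hk : k - 1 = 0
    · obtain ⟨Q, hQ0, hQ1, hQ2⟩ := hY
      refine ⟨Q, hQ0, fun i j hij => ?_, hQ2⟩
      obtain ⟨rfl, hj⟩ := hQ1 i j hij
      simpa [hk] using hj
    · refine ⟨Q', hQ0, fun i j hij => ?_, hQ'⟩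
      have h4 := (weightedDegree_le_iff k _ Q').1 le_rfl i j hij
      have h5 : j ≤ (k - 1) * j := Nat.le_mul_of_pos_left j (by omega)
      omega
  · rw [natDegree_le_iff_coeff_eq_zero]
    intro j hj
    ext i
    by_contra h0
    have := hgW.1 i j (by simpa using h0)
    omega

end interpolation

end ListAlg

/-! ### Root finding for bivariate polynomials

In this part, elements of `F[X][X]` are polynomials in `X` with coefficients in `F[Y]`, except for
the polynomial `Q(X, Y)` whose factors are sought. -/

namespace RothRuckenstein

variable {F : Type} [Field F]

/-- The substitution of `f(X, Y)` for `Y` in `Q(X, Y)`. -/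
noncomputable def substHom (f : F[X][X]) : F[X][X] →+* F[X][X] :=
  eval₂RingHom (mapRingHom C) f

/-- The substitution of `c + X Y` for `Y`. -/
noncomputable def shiftHom (c : F) : F[X][X] →+* F[X][X] :=
  eval₂RingHom (eval₂RingHom (C.comp C) (C (C c) + X * C X)) X

/-- The shift fixes polynomials in `X` alone, hence the coefficients of `Q`. It sends `g + X ^ m Y`
to `g + c X ^ m + X ^ (m + 1) Y`, so that it appends the coefficient `c` to the prefix `g`. -/
theorem shiftHom_substHom (c : F) (f Q : F[X][X]) :
    shiftHom c (substHom f Q) = substHom (shiftHom c f) Q := by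
  have h : (shiftHom c).comp (mapRingHom (C : F →+* F[X])) = mapRingHom C := by
    ext <;> simp [shiftHom]
  rw [substHom, substHom, coe_eval₂RingHom, coe_eval₂RingHom, hom_eval₂, h]

theorem coeff_coeff_eval₂ (c : F) (p : F[X]) (e b : ℕ) :
    ((eval₂ (C.comp C) (C (C c) + X * C X : F[X][X]) p).coeff e).coeff b =
      if b = e then (p.comp (X + C c)).coeff b else 0 := by
  have h : eval₂ (C.comp C) (C (C c) + X * C X : F[X][X]) p =
      eval₂ (C.comp C) (X * C X : F[X][X]) (p.comp (X + C c)) := by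
    rw [eval₂_comp, eval₂_add, eval₂_X, eval₂_C, add_comm]
    rfl
  rw [h]
  generalize p.comp (X + C c) = q
  have h2 : ∀ i, ∀ a : F, (C (C a) * (X * C X) ^ i : F[X][X]) = C (C a * X ^ i) * X ^ i := by
    intro i a
    rw [mul_pow, C_mul, C_pow]
    ring
  rw [eval₂_eq_sum, sum_def]
  simp only [RingHom.comp_apply, h2, finsetSum_coeff, coeff_C_mul_X_pow]
  by_cases hbe : b = e
  · subst hbe
    rw [if_pos rfl, Finset.sum_eq_single b]
    · simp
    · intro i _ hi
      rw [if_neg (Ne.symm hi), coeff_zero]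
    · intro hb
      simp [notMem_support_iff.1 hb]
  · rw [if_neg hbe]
    refine Finset.sum_eq_zero fun i _ => ?_
    split_ifs with h
    · subst h
      rw [coeff_C_mul_X_pow, if_neg hbe]
    · simp

/-- In `p(c + X Y)` the exponents of `X` and `Y` rise together, so the coefficient of `X ^ e Y ^ b`
can only come from the coefficient of `X ^ (e - b)`. -/
theorem coeff_shiftHom (c : F) (S : F[X][X]) (e b : ℕ) :
    ((shiftHom c S).coeff e).coeff b =
      if b ≤ e then ((S.coeff (e - b)).comp (X + C c)).coeff b else 0 := by
  induction S using Polynomial.induction_on' with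
  | add p q hp hq =>
    rw [map_add, coeff_add, coeff_add, hp, hq, coeff_add, add_comp, coeff_add]
    split_ifs <;> simp
  | monomial i p =>
    rw [shiftHom, coe_eval₂RingHom, eval₂_monomial, coe_eval₂RingHom, coeff_mul_X_pow',
      coeff_monomial]
    by_cases hi : i ≤ e
    · rw [if_pos hi, coeff_coeff_eval₂]
      by_cases hb : b ≤ e
      · rw [if_pos hb]
        by_cases h : b = e - i
        · rw [if_pos h, if_pos (by omega)]
        · rw [if_neg h, if_neg (by omega), zero_comp, coeff_zero]
      · rw [if_neg (by omega), if_neg hb]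
    · rw [if_neg hi, coeff_zero]
      split_ifs <;> first | omega | simp

/-- Let `t` be the trailing degree and `m` the multiplicity of `c` as a root of the trailing
coefficient. The shifted polynomial has a nonzero term `X ^ (t + m) Y ^ m`, so its trailing degree
`e` is at most `t + m`. A term `X ^ e Y ^ b` requires `e - b ≥ t`, whence `b ≤ m`. -/
theorem shiftHom_spec (c : F) (S : F[X][X]) (hS : S ≠ 0) :
    shiftHom c S ≠ 0 ∧
      (shiftHom c S).trailingCoeff.natDegree ≤ S.trailingCoeff.rootMultiplicity c := by
  have h0 : S.trailingCoeff ≠ 0 := trailingCoeff_nonzero_iff_nonzero.2 hS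
  set t := S.natTrailingDegree with ht
  set m := S.trailingCoeff.rootMultiplicity c with hm
  have h1 : ((shiftHom c S).coeff (t + m)).coeff m ≠ 0 := by
    rw [coeff_shiftHom, if_pos (by omega), Nat.add_sub_cancel]
    change (S.trailingCoeff.comp (X + C c)).coeff m ≠ 0
    rw [hm, rootMultiplicity_eq_natTrailingDegree]
    have : S.trailingCoeff.comp (X + C c) ≠ 0 := by
      intro h
      apply h0
      have h2 := congrArg (fun p : F[X] => p.comp (X - C c)) h
      simpa [comp_assoc] using h2
    exact trailingCoeff_nonzero_iff_nonzero.2 this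
  have h2 : (shiftHom c S).coeff (t + m) ≠ 0 := fun h => h1 (by rw [h, coeff_zero])
  have h3 : shiftHom c S ≠ 0 := fun h => h2 (by rw [h, coeff_zero])
  refine ⟨h3, ?_⟩
  have h4 : (shiftHom c S).natTrailingDegree ≤ t + m := natTrailingDegree_le_of_ne_zero h2
  rw [natDegree_le_iff_coeff_eq_zero]
  intro b hb
  rw [trailingCoeff, coeff_shiftHom]
  split_ifs with hbe
  · rw [coeff_eq_zero_of_lt_natTrailingDegree (show _ < S.natTrailingDegree by omega), zero_comp,
      coeff_zero]
  · rfl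

/-- For the empty prefix the substitution merely exchanges the roles of the variables. This starts
the search with a nonzero polynomial of known `Y`-degree. -/
theorem coeff_substHom_C_X (Q : F[X][X]) (i j : ℕ) :
    ((substHom (C X) Q).coeff i).coeff j = (Q.coeff j).coeff i := by
  induction Q using Polynomial.induction_on' with
  | add p q hp hq => simp [hp, hq]
  | monomial a p =>
    rw [substHom, coe_eval₂RingHom, eval₂_monomial, coe_mapRingHom, ← C_pow, coeff_mul_C,
      coeff_map, coeff_C_mul_X_pow, coeff_monomial]
    by_cases h : j = a
    · simp [h]
    · rw [if_neg h, if_neg (Ne.symm h), coeff_zero]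

/-- The polynomial of a root `f` meets the roots of the trailing coefficient. -/
theorem eval_trailingCoeff_eq_zero (Q : F[X][X]) (g h : F[X]) (m : ℕ)
    (hQ : Q.eval (g + X ^ m * h) = 0) :
    (substHom (g.map C + X ^ m * C X) Q).trailingCoeff.eval (h.coeff 0) = 0 := by
  set S := substHom (g.map C + X ^ m * C X) Q with hS
  -- `θ` puts `h(X)` for `Y`, which turns the prefix `g + X ^ m Y` into the full root.
  set θ : F[X][X] →+* F[X] := eval₂RingHom (eval₂RingHom C h) X with hθ
  have h1 : θ S = 0 := by
    rw [← hQ, hS]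
    change θ (eval₂ (mapRingHom C) (g.map C + X ^ m * C X) Q) = _
    rw [hom_eval₂]
    have h2 : θ.comp (mapRingHom C) = RingHom.id _ := by
      ext <;> simp [hθ]
    have h3 : θ (g.map C) = g := by
      have := congrArg (fun φ : F[X] →+* F[X] => φ g) h2
      simpa using this
    rw [h2, map_add, h3, map_mul, map_pow]
    simp [hθ, eval₂_id]
  -- After removing the power of `X`, the constant coefficient is the trailing coefficient, and
  -- setting `X = 0` evaluates it at `h(0)`.
  obtain ⟨P, hP⟩ : X ^ S.natTrailingDegree ∣ S := by
    rw [X_pow_dvd_iff]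
    exact fun d hd => coeff_eq_zero_of_lt_natTrailingDegree hd
  have h4 : P.coeff 0 = S.trailingCoeff := by
    rw [trailingCoeff]
    conv_rhs => rw [hP, coeff_X_pow_mul' ]
    simp [← hP]
  rw [hP, map_mul, map_pow] at h1
  have h5 : θ P = 0 := by
    refine (mul_eq_zero.1 h1).resolve_left ?_
    simp [hθ]
  have h6 : (θ P).coeff 0 = (P.coeff 0).eval (h.coeff 0) := by
    conv_lhs => rw [← divX_mul_X_add P]
    rw [map_add, map_mul]
    simp [hθ, coeff_zero_eq_eval_zero, ← coe_evalRingHom, hom_eval₂]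
    rw [eval₂_eq_eval_map]
    congr 1
    ext
    simp
  rw [← h4, ← h6, h5, coeff_zero]

end RothRuckenstein

/-! ### Correctness of the root search on lists -/

namespace ListAlg

open KoetterVardy RothRuckenstein

variable {F : Type} [Field F] [DecidableEq F]

theorem polyOf_replicate_nil (l : List Unit) (q : List (List F)) :
    toPoly₂ ((l.map fun _ => []) ++ q) = X ^ l.length * toPoly₂ q := by
  rw [toPoly₂, polyOf_append, List.length_map]
  have : ∀ l : List Unit, polyOf (toPoly (F := F)) (l.map fun _ => []) = 0 := by
    intro l
    induction l with
    | nil => rfl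
    | cons u l ih => rw [List.map_cons, polyOf_cons, ih]; simp
  rw [this, zero_add]

theorem toPoly₂_map_psmul (c : F) (q : List (List F)) :
    toPoly₂ (q.map fun p => psmul c p) = C (C c) * toPoly₂ q := by
  induction q with
  | nil => simp
  | cons p q ih => rw [List.map_cons, toPoly₂_cons, ih, toPoly_psmul, C_mul, toPoly₂_cons]; ring

theorem toPoly₂_substY (Q : List (F × List Unit × List Unit)) (f : List (List F)) :
    toPoly₂ (substY Q f) = substHom (toPoly₂ f) (termsSum Q) := by
  induction Q with
  | nil => simp [substY, termsSum]
  | cons t Q ih =>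
    change toPoly₂ (padd₂ _ (substY Q f)) = _
    rw [toPoly₂_padd₂, ih, polyOf_replicate_nil, toPoly₂_map_psmul, toPoly₂_ppow₂]
    have h : termsSum (t :: Q) = t.1 • bimon (expo t.2) + termsSum Q := by
      simp [termsSum]
    rw [h, map_add]
    congr 1
    rw [bimon, smul_monomial, smul_monomial, substHom, coe_eval₂RingHom, eval₂_monomial]
    simp only [expo, smul_eq_mul, mul_one, coe_mapRingHom, map_monomial]
    rw [← C_mul_X_pow_eq_monomial]
    ring

theorem toPoly₂_map_singleton (g : List F) :
    toPoly₂ (g.map fun x => [x]) = (toPoly g).map C := by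
  induction g with
  | nil => simp
  | cons a g ih => rw [List.map_cons, toPoly₂_cons, ih, toPoly_cons, toPoly_cons]; simp

theorem toPoly₂_prefix (g : List F) :
    toPoly₂ ((g.map fun x => [x]) ++ [[0, 1]]) = (toPoly g).map C + X ^ g.length * C X := by
  have h1 : toPoly₂ [[(0 : F), 1]] = C X := by
    rw [toPoly₂_cons, toPoly_cons, toPoly_cons]
    simp
  refine (polyOf_append (toPoly (F := F)) (g.map fun x => [x]) [[0, 1]]).trans ?_
  rw [List.length_map]
  exact congrArg₂ (· + ·) (toPoly₂_map_singleton g) (congrArg (X ^ g.length * ·) h1)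

/-- Lists run through increasing powers of `X`, so the first nonzero entry is the trailing
coefficient. -/
theorem toPoly_headD_filter (l : List (List F)) :
    toPoly ((l.filter fun p => !isZero p).headD []) = (toPoly₂ l).trailingCoeff := by
  induction l with
  | nil => simp
  | cons p l ih =>
    rw [toPoly₂_cons, List.filter_cons]
    by_cases hp : isZero p = true
    · rw [if_neg (by simp [hp]), ih, (isZero_iff p).1 hp, C_0, zero_add, trailingCoeff_mul]
      have : (X : F[X][X]).trailingCoeff = 1 := by
        simp [trailingCoeff]
      rw [this, one_mul]
    · rw [if_pos (by simpa using hp)]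
      have h0 : (C (toPoly p) + X * toPoly₂ l).coeff 0 = toPoly p := by simp
      have h1 : (C (toPoly p) + X * toPoly₂ l).natTrailingDegree = 0 :=
        Nat.le_zero.1 (natTrailingDegree_le_of_ne_zero
          (by rw [h0]; exact fun h => hp ((isZero_iff p).2 h)))
      rw [trailingCoeff, h1, h0]
      rfl

section prefixes

variable (Q : F[X][X])

/-- The polynomial in `F[Y][X]` of a prefix. -/
noncomputable def prefixPoly (g : List F) : F[X][X] :=
  substHom ((toPoly g).map C + X ^ g.length * C X) Q

theorem prefixPoly_append (g : List F) (γ : F) :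
    prefixPoly Q (g ++ [γ]) = shiftHom γ (prefixPoly Q g) := by
  rw [prefixPoly, prefixPoly, shiftHom_substHom]
  congr 2
  have h1 : shiftHom γ ((toPoly g).map C) = (toPoly g).map C := by
    have : (shiftHom γ).comp (mapRingHom (C : F →+* F[X])) = mapRingHom C := by
      ext <;> simp [shiftHom]
    exact congrArg (fun φ : F[X] →+* F[X][X] => φ (toPoly g)) this
  have h2 := polyOf_append (fun x : F => x) g [γ]
  rw [map_add, h1, toPoly, h2, map_mul, map_pow]
  simp [shiftHom]
  ring

theorem prefixPoly_ne_zero (hQ : Q ≠ 0) (g : List F) : prefixPoly Q g ≠ 0 := by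
  induction g using List.reverseRecOn with
  | nil =>
    intro h
    apply hQ
    ext j i
    have := congrArg (fun P : F[X][X] => (P.coeff i).coeff j) h
    simp only [prefixPoly, toPoly, polyOf_nil, Polynomial.map_zero, List.length_nil, pow_zero,
      one_mul, zero_add, coeff_substHom_C_X] at this
    simpa using this
  | append_singleton g γ ih => rw [prefixPoly_append]; exact (shiftHom_spec γ _ ih).1

/-- The number of roots of the trailing coefficient that a prefix can still lead to. -/
noncomputable def prefixDeg (g : List F) : ℕ := (prefixPoly Q g).trailingCoeff.natDegree

theorem prefixDeg_nil : prefixDeg Q [] ≤ Q.natDegree := by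
  rw [prefixDeg, natDegree_le_iff_coeff_eq_zero]
  intro j hj
  simp only [trailingCoeff, prefixPoly, toPoly, polyOf_nil, Polynomial.map_zero, List.length_nil,
    pow_zero, one_mul, zero_add, coeff_substHom_C_X]
  rw [coeff_eq_zero_of_natDegree_lt hj, coeff_zero]

/-- Children correspond to distinct roots of the trailing coefficient, and by `shiftHom_spec` the
potential of a child is at most the multiplicity of its root. The multiplicities add up to at most
the degree, and each is at least one, which bounds the number of children as well. -/
theorem sum_prefixDeg_le (hQ : Q ≠ 0) (δ : List F) (hδ : δ.Nodup) (g : List F) :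
    let ch := (δ.filter fun γ => decide ((prefixPoly Q g).trailingCoeff.eval γ = 0)).map
      fun γ => g ++ [γ]
    (ch.map (prefixDeg Q)).sum ≤ prefixDeg Q g ∧ ch.length ≤ prefixDeg Q g := by
  intro ch
  set P := (prefixPoly Q g).trailingCoeff with hP
  have hP0 : P ≠ 0 := trailingCoeff_nonzero_iff_nonzero.2 (prefixPoly_ne_zero Q hQ g)
  set L := δ.filter fun γ => decide (P.eval γ = 0) with hL
  have hLn : L.Nodup := hδ.filter _
  have hsum : (L.map fun γ => P.rootMultiplicity γ).sum ≤ P.natDegree := by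
    rw [← List.sum_toFinset _ hLn]
    calc ∑ γ ∈ L.toFinset, P.rootMultiplicity γ
        ≤ ∑ γ ∈ P.roots.toFinset, P.rootMultiplicity γ := by
          refine Finset.sum_le_sum_of_subset fun γ hγ => ?_
          rw [List.mem_toFinset, hL, List.mem_filter] at hγ
          rw [Multiset.mem_toFinset, mem_roots hP0]
          simpa using hγ.2
      _ = P.roots.card := by
          rw [← Multiset.toFinset_sum_count_eq]
          simp only [count_roots]
      _ ≤ P.natDegree := card_roots' P
  constructor
  · refine le_trans ?_ hsum
    rw [List.map_map]
    refine List.sum_le_sum fun γ _ => ?_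
    simp only [Function.comp, prefixDeg, prefixPoly_append]
    exact (shiftHom_spec γ _ (prefixPoly_ne_zero Q hQ g)).2
  · refine le_trans ?_ hsum
    rw [List.length_map]
    have : (L.map fun _ => 1).sum ≤ (L.map fun γ => P.rootMultiplicity γ).sum := by
      refine List.sum_le_sum fun γ hγ => ?_
      rw [Nat.one_le_iff_ne_zero, ← Nat.pos_iff_ne_zero, rootMultiplicity_pos hP0]
      simpa using (List.mem_filter.1 hγ).2
    simpa using this

end prefixes

theorem children_eq (δ : List F) (Q : List (F × List Unit × List Unit)) (g : List F) :
    children δ Q g = (δ.filter fun γ =>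
      decide ((prefixPoly (termsSum Q) g).trailingCoeff.eval γ = 0)).map fun γ => g ++ [γ] := by
  rw [children]
  simp only [peval_eq, toPoly_headD_filter, toPoly₂_substY, toPoly₂_prefix]
  rfl

/-- The next coefficient of `f` is the constant term of the tail `h`, the value at which
`eval_trailingCoeff_eq_zero` gives a root. -/
theorem toPoly_take_coeffs (f : F[X]) (m : ℕ) :
    ∃ h : F[X], f = toPoly ((List.range m).map f.coeff) + X ^ m * h ∧ h.coeff 0 = f.coeff m := by
  induction m with
  | zero => exact ⟨f, by simp, rfl⟩
  | succ m ih =>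
    obtain ⟨h, h1, h2⟩ := ih
    refine ⟨h.divX, ?_, ?_⟩
    · rw [List.range_succ, List.map_append, toPoly, polyOf_append]
      conv_lhs => rw [h1, ← divX_mul_X_add h, h2]
      simp
      ring
    · rw [coeff_divX, zero_add]
      have := congrArg (fun p : F[X] => p.coeff (m + 1)) h1
      simp only [coeff_add] at this
      rw [add_comm m 1, coeff_X_pow_mul', if_pos (by omega), Nat.add_sub_cancel,
        coeff_polyOf _ 0 rfl, List.drop_of_length_le (by simp)] at this
      simpa [add_comm] using this.symm

/-- The bound on the total potential is the invariant that carries the induction: it keeps the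
number of children below `cap`, so no prefix of a root is cut off. -/
theorem prefixes_spec (δ : List F) (hδ : δ.Nodup) (hδ' : ∀ x, x ∈ δ)
    (Q : List (F × List Unit × List Unit)) (hQ : termsSum Q ≠ 0) (cap : List Unit)
    (hcap : (termsSum Q).natDegree < cap.length) (k : ℕ) :
    (∀ g ∈ prefixes δ Q cap (List.replicate k ()), g.length = k) ∧
    ((prefixes δ Q cap (List.replicate k ())).map (prefixDeg (termsSum Q))).sum ≤
      (termsSum Q).natDegree ∧
    ∀ f : F[X], (termsSum Q).eval f = 0 →
      (List.range k).map f.coeff ∈ prefixes δ Q cap (List.replicate k ()) := by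
  induction k with
  | zero =>
    simp only [prefixes, List.replicate_zero, List.foldr_nil]
    exact ⟨by simp, by simpa using prefixDeg_nil _, by simp⟩
  | succ k ih =>
    set L := prefixes δ Q cap (List.replicate k ()) with hL
    obtain ⟨h1, h2, h3⟩ := ih
    have hstep : prefixes δ Q cap (List.replicate (k + 1) ()) =
        takeU (L.flatMap fun g => children δ Q g) cap := rfl
    -- Each prefix has at most as many children as its potential, so the total is below `cap` and
    -- the truncation does nothing.
    have hlen : (L.flatMap fun g => children δ Q g).length ≤ (termsSum Q).natDegree := by
      rw [List.length_flatMap]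
      refine le_trans (List.sum_le_sum fun g _ => ?_) h2
      rw [children_eq]
      exact (sum_prefixDeg_le (termsSum Q) hQ δ hδ g).2
    have hsum : ((L.flatMap fun g => children δ Q g).map (prefixDeg (termsSum Q))).sum ≤
        (termsSum Q).natDegree := by
      rw [List.map_flatMap, List.flatMap, List.sum_flatten, List.map_map]
      refine le_trans (List.sum_le_sum fun g _ => ?_) h2
      simp only [Function.comp]
      rw [children_eq]
      exact (sum_prefixDeg_le (termsSum Q) hQ δ hδ g).1
    rw [hstep, PolyTime.takeU_eq, List.take_of_length_le (by omega)]
    refine ⟨?_, hsum, ?_⟩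
    · intro g hg
      obtain ⟨g', hg', hg⟩ := List.mem_flatMap.1 hg
      rw [PolyTime.length_children δ Q g' g hg, h1 g' hg']
    · intro f hf
      refine List.mem_flatMap.2 ⟨_, h3 f hf, ?_⟩
      rw [children_eq]
      refine List.mem_map.2 ⟨f.coeff k, List.mem_filter.2 ⟨hδ' _, ?_⟩, ?_⟩
      · obtain ⟨h, hf1, hf2⟩ := toPoly_take_coeffs f k
        rw [decide_eq_true_iff, ← hf2, prefixPoly, List.length_map, List.length_range]
        refine eval_trailingCoeff_eq_zero _ _ _ _ ?_
        rw [← hf1, hf]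
      · rw [List.range_succ, List.map_append]
        rfl

theorem degree_toPoly_lt (g : List F) : (toPoly g).degree < g.length := by
  rw [degree_lt_iff_coeff_zero]
  intro m hm
  rw [coeff_polyOf _ 0 rfl, List.drop_of_length_le hm]
  rfl

/-- The factors found are all factors of the form `Y - f` with `deg f < k`. -/
theorem factors_spec (δ : List F) (hδ : δ.Nodup) (hδ' : ∀ x, x ∈ δ)
    (Q : List (F × List Unit × List Unit)) (hQ : termsSum Q ≠ 0) (cap : List Unit)
    (hcap : (termsSum Q).natDegree < cap.length) (k : ℕ) (f : F[X]) :
    (∃ g ∈ factors δ Q cap (List.replicate k ()), toPoly g = f) ↔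
      f.degree < k ∧ X - C f ∣ termsSum Q := by
  obtain ⟨h1, -, h3⟩ := prefixes_spec δ hδ hδ' Q hQ cap hcap k
  have hz : ∀ g : List F, isZero₂ (substY Q (g.map fun x => [x])) = true ↔
      (termsSum Q).eval (toPoly g) = 0 := by
    intro g
    rw [isZero₂_iff, toPoly₂_substY, toPoly₂_map_singleton, substHom, coe_eval₂RingHom]
    have : eval₂ (mapRingHom C) ((toPoly g).map C) (termsSum Q) =
        ((termsSum Q).eval (toPoly g)).map (C : F →+* F[X]) := by
      have := eval₂_hom (p := termsSum Q) (mapRingHom (C : F →+* F[X])) (toPoly g)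
      simpa using this
    rw [this, Polynomial.map_eq_zero_iff C_injective]
  rw [dvd_iff_isRoot, IsRoot]
  constructor
  · rintro ⟨g, hg, rfl⟩
    rw [factors, List.mem_filter, hz] at hg
    refine ⟨?_, hg.2⟩
    have := degree_toPoly_lt g
    rwa [h1 g hg.1] at this
  · rintro ⟨hf, hf0⟩
    have hfg : toPoly ((List.range k).map f.coeff) = f := by
      ext i
      rw [coeff_polyOf _ 0 rfl]
      by_cases hi : i < k
      · simp [hi]
      · rw [List.drop_of_length_le (by simpa using hi)]
        simp only [List.headD_nil]
        rw [degree_lt_iff_coeff_zero] at hf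
        exact (hf i (by omega)).symm
    refine ⟨_, List.mem_filter.2 ⟨h3 f hf0, ?_⟩, hfg⟩
    rw [hz, hfg, hf0]

end ListAlg

namespace ListAlg

open KoetterVardy

variable {F : Type} [Field F] [DecidableEq F]

/-! ### Correctness of the program -/

theorem ltU_iff (m n : List Unit) : ltU m n = true ↔ m.length < n.length := by
  simp [ltU]

/-- Entries with the same word as `x` are exempt from the comparison, so one word may occur several
times in the list. -/
theorem uniqueMax_eq_singleton {l : List (List F × List Unit)} {x : List F × List Unit}
    (hx : x ∈ l) (h : ∀ y ∈ l, y.1 = x.1 ∨ y.2.length < x.2.length) : uniqueMax l = [x.1] := by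
  rw [uniqueMax, PolyTime.takeU_eq]
  have hmem : ∀ z, z ∈ l.filter (fun x => l.all fun y => eqW y.1 x.1 || ltU y.2 x.2) ↔
      z ∈ l ∧ ∀ y ∈ l, y.1 = z.1 ∨ y.2.length < z.2.length := by
    intro z
    simp only [List.mem_filter, List.all_eq_true, Bool.or_eq_true, eqW_iff, ltU_iff]
  obtain ⟨z, L, hL⟩ := List.exists_cons_of_ne_nil (List.ne_nil_of_mem ((hmem x).2 ⟨hx, h⟩))
  have hz := (hmem z).1 (by rw [hL]; simp)
  have : z.1 = x.1 := by
    rcases hz.2 x hx with h1 | h1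
    · exact h1.symm
    · rcases h z hz.1 with h2 | h2
      · exact h2
      · omega
  simp [hL, this]

theorem uniqueMax_eq_nil {l : List (List F × List Unit)}
    (h : ∀ x ∈ l, ∃ y ∈ l, y.1 ≠ x.1 ∧ x.2.length ≤ y.2.length) : uniqueMax l = [] := by
  rw [uniqueMax, PolyTime.takeU_eq]
  have : l.filter (fun x => l.all fun y => eqW y.1 x.1 || ltU y.2 x.2) = [] := by
    rw [List.filter_eq_nil_iff]
    intro x hx
    obtain ⟨y, hy, h1, h2⟩ := h x hx
    simp only [List.all_eq_true, Bool.or_eq_true, eqW_iff, ltU_iff]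
    intro h3
    rcases h3 y hy with h4 | h4
    · exact h1 h4
    · omega
  rw [this]
  rfl

theorem length_filter_ofFn {A : Type} {K : ℕ} (f : Fin K → A) (p : A → Prop) [DecidablePred p] :
    ((List.ofFn f).filter fun a => decide (p a)).length =
      (Finset.univ.filter fun i => p (f i)).card := by
  rw [List.ofFn_eq_map, List.filter_map, List.length_map, Fin.univ_def, Finset.card_def,
    Finset.filter_val]
  simp [Multiset.filter_coe, Function.comp_def]

section reads

variable [Fintype F] {n K : ℕ} (μ : ℕ) (Y : Fin K → Fin n → F)

theorem length_count (j : Fin n) (v : F) :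
    (count (List.replicate μ ()) (List.ofFn fun i => Y i j) v).length = countMatrix μ Y v j := by
  have := length_filter_ofFn (fun i => Y i j) (fun u => u = v)
  simp only [count, List.length_flatMap, countMatrix, ← this]
  simp [mul_comm]

variable (δ : Fin (Fintype.card F) ≃ F)

theorem mem_ofFn_equiv (v : F) : v ∈ List.ofFn δ := by
  rw [List.mem_ofFn]
  exact ⟨δ.symm v, by simp⟩

theorem length_mult (j : Fin n) (v : F) :
    (mult (List.ofFn δ) (List.replicate μ ()) (List.ofFn fun i => Y i j) v).length =
      multMatrix μ Y v j := by
  have hc := length_count μ Y j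
  set l := (List.ofFn δ).map fun u =>
    ([u], count (List.replicate μ ()) (List.ofFn fun i => Y i j) u) with hl
  have hle : ∀ w, countMatrix μ Y w j ≤ colMax (countMatrix μ Y) j := fun w =>
    Finset.le_sup (f := fun v => countMatrix μ Y v j) (Finset.mem_univ w)
  by_cases h : ∃ u, ∀ w, w = u ∨ countMatrix μ Y w j < countMatrix μ Y u j
  · obtain ⟨u, hu⟩ := h
    have h1 : uniqueMax l = [[u]] := by
      refine uniqueMax_eq_singleton
        (x := ([u], count (List.replicate μ ()) (List.ofFn fun i => Y i j) u))
        (List.mem_map.2 ⟨u, mem_ofFn_equiv δ u, rfl⟩) ?_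
      intro y hy
      obtain ⟨w, -, rfl⟩ := List.mem_map.1 hy
      simp only [hc]
      rcases hu w with rfl | hw
      · exact Or.inl rfl
      · exact Or.inr hw
    have h2 : colMax (countMatrix μ Y) j = countMatrix μ Y u j := by
      refine le_antisymm (Finset.sup_le fun w _ => ?_) (hle u)
      rcases hu w with rfl | hw
      · exact le_rfl
      · exact hw.le
    have h3 : colArgmax (countMatrix μ Y) j = {u} := by
      ext w
      simp only [colArgmax, Finset.mem_filter, Finset.mem_univ, true_and, Finset.mem_singleton, h2]
      rcases hu w with rfl | hw
      · simp
      · exact ⟨fun h => absurd h hw.ne, fun h => by rw [h]⟩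
    rw [mult, ← hl, h1, multMatrix, h3, h2]
    simp only [List.headD_cons, Finset.card_singleton, and_true, Finset.mem_singleton]
    -- In unary, an empty tail means an entry at most `1`; such a column is left unchanged.
    have h4 : (count (List.replicate μ ()) (List.ofFn fun i => Y i j) u).tail.isEmpty = true ↔
        ¬ 1 < countMatrix μ Y u j := by
      rw [← hc, List.isEmpty_iff, ← List.length_eq_zero_iff, List.length_tail]
      omega
    by_cases h5 : 1 < countMatrix μ Y u j
    · have h6 : (count (List.replicate μ ()) (List.ofFn fun i => Y i j) u).tail.isEmpty = false := by
        rw [Bool.eq_false_iff, ne_eq, h4]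
        exact not_not.2 h5
      rw [if_pos h5, h6]
      by_cases h7 : v = u
      · have : eqW [v] [u] = true := by rw [eqW_iff, h7]
        rw [if_pos h7, this]
        simp [List.length_flatMap, List.sum_ofFn, mul_comm]
      · have : eqW [v] [u] = false := by rw [Bool.eq_false_iff, ne_eq, eqW_iff]; simpa using h7
        rw [if_neg h7, this]
        simp
    · rw [if_neg h5, h4.2 h5, cond_true, hc]
  · push Not at h
    have h1 : uniqueMax l = [] := by
      refine uniqueMax_eq_nil fun x hx => ?_
      obtain ⟨u, -, rfl⟩ := List.mem_map.1 hx
      obtain ⟨w, hw, hw2⟩ := h u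
      refine ⟨_, List.mem_map.2 ⟨w, mem_ofFn_equiv δ w, rfl⟩, by simpa using hw, ?_⟩
      simpa only [hc] using hw2
    have h2 : ¬ (colArgmax (countMatrix μ Y) j).card = 1 := by
      intro hcard
      obtain ⟨u, hu⟩ := Finset.card_eq_one.1 hcard
      obtain ⟨w, hw, hw2⟩ := h u
      have h3 : u ∈ colArgmax (countMatrix μ Y) j := by rw [hu]; simp
      simp only [colArgmax, Finset.mem_filter, Finset.mem_univ, true_and] at h3
      have h4 : w ∈ colArgmax (countMatrix μ Y) j := by
        simp only [colArgmax, Finset.mem_filter, Finset.mem_univ, true_and]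
        have := hle w
        omega
      rw [hu, Finset.mem_singleton] at h4
      exact hw h4
    rw [mult, ← hl, h1, multMatrix, if_neg fun h => h2 h.2]
    exact hc v

theorem points_ofFn (α : Fin n → F) :
    points (List.ofFn α) (List.ofFn fun i => List.ofFn (Y i)) =
      List.ofFn fun j => (α j, List.ofFn fun i => Y i j) := by
  induction K with
  | zero => simp [points, List.map_ofFn, Function.comp_def]
  | succ K ih =>
    have := ih fun i => Y i.succ
    rw [List.ofFn_succ]
    change ((List.ofFn (Y 0)).zip (points (List.ofFn α)
      (List.ofFn fun i : Fin K => List.ofFn (Y i.succ)))).map _ = _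
    rw [this]
    apply List.ext_getElem
    · simp
    · intro i h1 h2
      simp [List.ofFn_succ]

theorem rangeU_mem {A : Type} (l : List A) (r : List Unit) :
    r ∈ rangeU l ↔ r.length < l.length := by
  simp only [rangeU, List.mem_map, List.mem_range]
  constructor
  · rintro ⟨i, hi, rfl⟩
    simpa using hi
  · intro h
    exact ⟨r.length, h, (List.eq_replicate_iff.2 ⟨rfl, fun _ _ => rfl⟩).symm⟩

theorem constraints_iff (α : Fin n ↪ F) (Q : F[X][X]) :
    (∀ c ∈ constraints (List.ofFn δ) (List.replicate μ ())
        (List.ofFn fun j => (α j, List.ofFn fun i => Y i j)), constraintFun c Q = 0) ↔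
      ∀ v j, HasZeroOfMult Q (α j) v (multMatrix μ Y v j) := by
  simp only [hasZeroOfMult_iff, constraints, constraintsAt, List.mem_flatMap, List.mem_ofFn,
    List.mem_map, rangeU_mem, List.length_drop]
  constructor
  · intro h v j r s hrs
    have := h (α j, v, List.replicate r (), List.replicate s ())
      ⟨_, ⟨j, rfl⟩, v, ⟨δ.symm v, by simp⟩, List.replicate r (), by
        rw [length_mult, List.length_replicate]; omega, List.replicate s (), by
        rw [length_mult, List.length_replicate, List.length_replicate]; omega, rfl⟩
    simpa [constraintFun] using this
  · rintro h c ⟨_, ⟨j, rfl⟩, v, -, r, hr, s, hs, rfl⟩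
    rw [length_mult] at hr hs
    refine h v j _ _ ?_
    dsimp only
    omega

theorem length_scoreU (α : Fin n ↪ F) (f : List F) :
    (scoreU (List.ofFn δ) (List.replicate μ ())
      (List.ofFn fun j => (α j, List.ofFn fun i => Y i j)) f).length =
      score (multMatrix μ Y) (evalWord α (toPoly f)) := by
  rw [scoreU, List.length_flatMap, List.map_ofFn, List.sum_ofFn, score]
  refine Finset.sum_congr rfl fun j _ => ?_
  simp only [Function.comp, length_mult, peval_eq]
  rfl

/-- A unique maximiser exists exactly when some word strictly beats every word different from it,
which is what `uniqueMax` tests. Only the set of words given by `L` matters, not repetitions. -/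
theorem select_spec (α : Fin n ↪ F) (L : List (List F)) (S : Set (Fin n → F))
    (hS : ∀ c, c ∈ S ↔ ∃ g ∈ L, evalWord α (toPoly g) = c) :
    select (List.ofFn δ) (List.replicate μ ())
      (List.ofFn fun j => (α j, List.ofFn fun i => Y i j)) L =
      encodeOutput (selectArgmax (multMatrix μ Y) S) := by
  have hword : ∀ f : List F, (List.ofFn fun j => (α j, List.ofFn fun i => Y i j)).map
      (fun pt => peval f pt.1) = List.ofFn (evalWord α (toPoly f)) := by
    intro f
    rw [List.map_ofFn]
    congr 1
    funext j
    simp only [Function.comp, peval_eq]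
    rfl
  rw [select]
  simp only [hword]
  unfold selectArgmax
  split_ifs with h
  · have hc := h.choose_spec
    generalize h.choose = c at hc
    obtain ⟨⟨hcS, hmax⟩, huniq⟩ := hc
    obtain ⟨g, hg, hgc⟩ := (hS c).1 hcS
    have := uniqueMax_eq_singleton (x := (List.ofFn (evalWord α (toPoly g)),
      scoreU (List.ofFn δ) (List.replicate μ ())
        (List.ofFn fun j => (α j, List.ofFn fun i => Y i j)) g))
      (List.mem_map.2 ⟨g, hg, rfl⟩) (l := L.map fun f => (List.ofFn (evalWord α (toPoly f)),
      scoreU (List.ofFn δ) (List.replicate μ ())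
        (List.ofFn fun j => (α j, List.ofFn fun i => Y i j)) f)) ?_
    · rw [this, hgc]
      rfl
    · intro y hy
      obtain ⟨f, hf, rfl⟩ := List.mem_map.1 hy
      simp only [length_scoreU, hgc]
      have hfS := (hS _).2 ⟨f, hf, rfl⟩
      by_cases hlt : score (multMatrix μ Y) (evalWord α (toPoly f)) <
          score (multMatrix μ Y) c
      · exact Or.inr hlt
      · left
        rw [huniq _ ⟨hfS, fun c' hc' => (hmax c' hc').trans (not_lt.1 hlt)⟩]
  · refine uniqueMax_eq_nil fun x hx => ?_
    obtain ⟨g, hg, rfl⟩ := List.mem_map.1 hx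
    by_contra! hno
    apply h
    have key : ∀ c ∈ S, c = evalWord α (toPoly g) ∨ score (multMatrix μ Y) c <
        score (multMatrix μ Y) (evalWord α (toPoly g)) := by
      intro c hc
      obtain ⟨f, hf, rfl⟩ := (hS c).1 hc
      by_cases heq : evalWord α (toPoly f) = evalWord α (toPoly g)
      · exact Or.inl heq
      · right
        have := hno _ (List.mem_map.2 ⟨f, hf, rfl⟩)
          (fun h0 => heq (List.ofFn_injective h0))
        simpa only [length_scoreU] using this
    refine ⟨_, ⟨(hS _).2 ⟨g, hg, rfl⟩, fun c hc => ?_⟩, ?_⟩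
    · rcases key c hc with rfl | hlt
      · exact le_rfl
      · exact hlt.le
    · rintro c ⟨hc, hmax⟩
      rcases key c hc with rfl | hlt
      · rfl
      · exact absurd (hmax _ ((hS _).2 ⟨g, hg, rfl⟩)) (not_le.2 hlt)

theorem reconstruct_spec (α : Fin n ↪ F) (k : ℕ) :
    ∃ out, IsReconstruction k μ α Y out ∧
      reconstruct (List.ofFn α) (List.ofFn δ) (List.ofFn fun i => List.ofFn (Y i))
        (List.replicate k ()) (List.replicate μ ()) = encodeOutput out := by
  rw [reconstruct, points_ofFn]
  set cs := constraints (List.ofFn δ) (List.replicate μ ())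
    (List.ofFn fun j => (α j, List.ofFn fun i => Y i j)) with hcs
  obtain ⟨h1, h2, h3, h4⟩ := interpolate_spec cs k
  set Q := interpolate cs (List.replicate k ()) with hQ
  have hint : ∀ Q' : F[X][X], Interpolates α (multMatrix μ Y) Q' ↔
      Q' ≠ 0 ∧ ∀ c ∈ cs, constraintFun c Q' = 0 := fun Q' => by
    rw [hcs, constraints_iff, Interpolates]
  refine ⟨_, ⟨termsSum Q, ⟨(hint _).2 ⟨h1, h2⟩, fun Q' hQ' => ?_⟩, rfl⟩, ?_⟩
  · exact h3 Q' ((hint _).1 hQ').1 ((hint _).1 hQ').2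
  · refine select_spec μ Y δ α _ _ fun c => ?_
    have hfac := factors_spec (List.ofFn δ) (List.nodup_ofFn.2 δ.injective) (mem_ofFn_equiv δ)
      Q h1 (() :: cs.map fun _ => ()) (by simpa using Nat.lt_succ_of_le h4) k
    rw [candidates]
    constructor
    · rintro ⟨f, hf, hdvd, rfl⟩
      obtain ⟨g, hg, rfl⟩ := (hfac f).2 ⟨hf, hdvd⟩
      exact ⟨g, hg, rfl⟩
    · rintro ⟨g, hg, rfl⟩
      obtain ⟨hf, hdvd⟩ := (hfac _).1 ⟨g, hg, rfl⟩
      exact ⟨_, hf, hdvd, rfl⟩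

end reads

end ListAlg

/-- The five lists contribute the constant `5`, and the matrix of reads gives the product. The bound
`k ≤ n` accounts for `k`, which is not part of the argument of the polynomial. -/
theorem Ty.size_encodeInput_le {F : Type} [Field F] [Fintype F] {n k K μ : ℕ} (hk : k ≤ n)
    (δ : Fin (Fintype.card F) ≃ F) (α : Fin n ↪ F) (Y : Fin K → Fin n → F) :
    Ty.size inputTy (encodeInput δ α Y k μ) ≤
      ((5 + 3 * Polynomial.X + Polynomial.X * (1 + Polynomial.X) : Polynomial ℕ)).eval
        (Fintype.card F + n + K + μ) := by
  have h1 : ∀ {m : ℕ} (f : Fin m → F), Ty.size (F := F) (.list .fld) (List.ofFn f) = 1 + m := by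
    intro m f
    rw [Ty.size_list_of_flat .fld fun _ => rfl, List.length_ofFn]
  have h2 : ∀ m : ℕ, Ty.size (F := F) (.list .unit) (List.replicate m ()) = 1 + m := by
    intro m
    rw [Ty.size_list_of_flat .unit fun _ => rfl, List.length_replicate]
  have h3 : Ty.size (F := F) (.list (.list .fld)) (List.ofFn fun i => List.ofFn (Y i)) ≤
      1 + K * (1 + n) := by
    have := Ty.size_list_le (F := F) (.list .fld) (List.ofFn fun i => List.ofFn (Y i)) (1 + n) ?_
    · rwa [List.length_ofFn] at this
    · intro y hy
      obtain ⟨i, rfl⟩ := List.mem_ofFn.1 hy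
      exact (h1 _).le
  change Ty.size (F := F) (.list .fld) (List.ofFn δ) + (Ty.size (F := F) (.list .fld) (List.ofFn α) +
    (Ty.size (F := F) (.list (.list .fld)) (List.ofFn fun i => List.ofFn (Y i)) +
      (Ty.size (F := F) (.list .unit) (List.replicate k ()) +
        Ty.size (F := F) (.list .unit) (List.replicate μ ())))) ≤ _
  rw [h1, h1, h2, h2]
  simp only [eval_add, eval_mul, eval_X, eval_one, eval_ofNat]
  have h4 : K * (1 + n) ≤ (Fintype.card F + n + K + μ) * (1 + (Fintype.card F + n + K + μ)) := by
    gcongr <;> omega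
  omega

/-- One program performs the reconstruction algorithm in polynomial time. -/
theorem exists_prog_reconstruction :
    ∃ (P : Prog inputTy outputTy) (T : Polynomial ℕ),
      ∀ (F : Type) [Field F] [Fintype F] [DecidableEq F] (n k K μ : ℕ),
        2 ≤ K → 1 ≤ μ → 1 ≤ k → k ≤ n →
        ∀ (δ : Fin (Fintype.card F) ≃ F) (α : Fin n ↪ F) (Y : Fin K → Fin n → F),
          (∃ out : Option (Fin n → F), IsReconstruction k μ α Y out ∧
            P.eval (encodeInput δ α Y k μ) = encodeOutput out) ∧
          P.time (encodeInput δ α Y k μ) ≤ T.eval (Fintype.card F + n + K + μ) := by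
  obtain ⟨P, T, hP⟩ := PolyTime.reconstruct
  refine ⟨P, T.comp (5 + 3 * Polynomial.X + Polynomial.X * (1 + Polynomial.X)), ?_⟩
  intro F _ _ _ n k K μ _ _ _ hk δ α Y
  obtain ⟨h1, h2, -⟩ := hP F (encodeInput δ α Y k μ)
  constructor
  · obtain ⟨out, ho1, ho2⟩ := ListAlg.reconstruct_spec μ Y δ α k
    exact ⟨out, ho1, h1.trans ho2⟩
  · rw [eval_comp]
    exact h2.trans (natPoly_mono T (Ty.size_encodeInput_le hk δ α Y))

/-! ### Success of the decoder -/

namespace KoetterVardy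

/-- The exponents `(i, j)` with `i + k j < S`. -/
def triangle (k S : ℕ) : Finset (ℕ × ℕ) :=
  (Finset.range S ×ˢ Finset.range S).filter fun m => m.1 + k * m.2 < S

theorem card_triangle (k S : ℕ) : (triangle k S).card = ∑ j ∈ Finset.range S, (S - k * j) := by
  rw [triangle, Finset.card_filter, Finset.sum_product_right]
  refine Finset.sum_congr rfl fun j _ => ?_
  rw [← Finset.card_filter]
  have : (Finset.range S).filter (fun i => i + k * j < S) = Finset.range (S - k * j) := by
    ext i
    simp only [Finset.mem_filter, Finset.mem_range]
    omega
  simp only [this, Finset.card_range]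

theorem two_mul_card_triangle_one (m : ℕ) : 2 * (triangle 1 m).card = m * (m + 1) := by
  rw [card_triangle]
  induction m with
  | zero => simp
  | succ m ih =>
    rw [Finset.sum_range_succ']
    simp only [one_mul, Nat.add_sub_add_right, mul_zero, Nat.sub_zero] at ih ⊢
    rw [mul_add, ih]
    ring

/-- The triangle with legs `S` and `S / k` has area `S² / (2k)`, and the lattice points number at
least that. Weight `k` in place of `k - 1` avoids the degenerate case `k = 1` and can only
overestimate the weighted degree. -/
theorem sq_le_card_triangle (k : ℕ) (hk : 1 ≤ k) (S : ℕ) :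
    S ^ 2 ≤ 2 * k * (triangle k S).card := by
  rw [card_triangle]
  have key : ∀ N S : ℕ, S ≤ N → S ^ 2 ≤ 2 * k * ∑ j ∈ Finset.range N, (S - k * j) := by
    intro N
    induction N with
    | zero => intro S hS; simp [Nat.le_zero.1 hS]
    | succ N ih =>
      intro S hS
      rw [Finset.sum_range_succ']
      simp only [mul_zero, Nat.sub_zero]
      -- The row `j = 0` has `S` points, and removing it leaves the triangle for `S - k`. The
      -- induction closes with `(S - k)² + 2 k S ≥ S²`.
      have h1 := ih (S - k) (by omega)
      have h2 : ∀ j, S - k * (j + 1) = S - k - k * j := fun j => by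
        rw [mul_add, mul_one, Nat.sub_sub, add_comm]
      simp only [h2]
      rw [mul_add]
      rcases le_total k S with h | h
      · obtain ⟨d, rfl⟩ := Nat.exists_eq_add_of_le h
        rw [Nat.add_sub_cancel_left] at h1 ⊢
        nlinarith
      · nlinarith
  exact key S S le_rfl

variable {F : Type} [Field F] [Fintype F] {n : ℕ}

/-- Twice the cost of a multiplicity matrix. -/
def cost (M : Matrix F (Fin n) ℕ) : ℕ := ∑ j, ∑ v, M v j * (M v j + 1)

/-- A zero of multiplicity `m` imposes `m (m + 1) / 2` conditions, so there are `cost M / 2`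
conditions in all. They are fewer than the at least `S² / (2k)` monomials. -/
theorem exists_interpolates (k : ℕ) (hk : 1 ≤ k) (α : Fin n ↪ F) (M : Matrix F (Fin n) ℕ) (S : ℕ)
    (h : k * cost M < S ^ 2) : ∃ Q, Interpolates α M Q ∧ weightedDegree k Q < S := by
  let ι := Σ p : Fin n × F, {m // m ∈ triangle 1 (M p.2 p.1)}
  have hι : 2 * Fintype.card ι = cost M := by
    rw [Fintype.card_sigma, Finset.mul_sum, cost, ← Finset.univ_product_univ, Finset.sum_product]
    refine Finset.sum_congr rfl fun j _ => Finset.sum_congr rfl fun v _ => ?_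
    rw [Fintype.card_coe, two_mul_card_triangle_one]
  obtain ⟨Q, hQ, hQ0, hφ⟩ := exists_ne_zero
    (fun x : ι => shiftCoeff (α x.1.1) x.1.2 x.2.1.1 x.2.1.2) (triangle k S) (by
      have := sq_le_card_triangle k hk S
      by_contra! hle
      have h2 : 2 * k * (triangle k S).card ≤ 2 * k * Fintype.card ι := by gcongr
      have h3 : 2 * k * Fintype.card ι = k * cost M := by rw [← hι]; ring
      omega)
  rw [mem_span_bimon] at hQ
  have hmem : ∀ i j, (Q.coeff j).coeff i ≠ 0 → i + k * j < S := fun i j hij =>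
    (Finset.mem_filter.1 (Finset.mem_coe.1 (hQ i j hij))).2
  refine ⟨Q, ⟨hQ0, fun v j r s hrs => ?_⟩, ?_⟩
  · refine hφ ⟨(j, v), ⟨(r, s), ?_⟩⟩
    simp only [triangle, Finset.mem_filter, Finset.mem_product, Finset.mem_range]
    omega
  · have hS : 0 < S := by
      rcases Nat.eq_zero_or_pos S with rfl | h0
      · simp at h
      · exact h0
    have : weightedDegree k Q ≤ S - 1 := by
      rw [weightedDegree_le_iff]
      intro i j hij
      have h1 := hmem i j hij
      have h2 : (k - 1) * j ≤ k * j := by gcongr; omega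
      omega
    omega

/-- A codeword whose score is large in comparison with the cost, and larger than the score of any
other codeword, is the output. -/
theorem reconstruction_eq [DecidableEq F] {K : ℕ} {k μ : ℕ} (hk : 1 ≤ k) (α : Fin n ↪ F)
    (Y : Fin K → Fin n → F) (out : Option (Fin n → F)) (hout : IsReconstruction k μ α Y out)
    (c : Fin n → F) (hc : c ∈ rsCode k α)
    (hcost : k * cost (multMatrix μ Y) < score (multMatrix μ Y) c ^ 2)
    (huniq : ∀ c' ∈ rsCode k α, c' ≠ c → score (multMatrix μ Y) c' < score (multMatrix μ Y) c) :
    out = some c := by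
  obtain ⟨Q, ⟨hQ, hmin⟩, rfl⟩ := hout
  obtain ⟨f, hf, rfl⟩ := hc
  obtain ⟨Q', hQ', hlt⟩ := exists_interpolates k hk α _ _ hcost
  -- The dimension count yields some `Q'` below the score; minimality carries this over to whichever
  -- `Q` was chosen.
  have hdvd : X - C f ∣ Q :=
    X_sub_C_dvd k α _ Q hQ.2 f hf ((hmin Q' hQ').trans_lt hlt)
  have hmem : evalWord α f ∈ candidates k α Q := ⟨f, hf, hdvd, rfl⟩
  have hsub : ∀ c' ∈ candidates k α Q, c' ∈ rsCode k α := by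
    rintro c' ⟨g, hg, -, rfl⟩
    exact ⟨g, hg, rfl⟩
  have harg : IsArgmax (multMatrix μ Y) (candidates k α Q) (evalWord α f) := by
    refine ⟨hmem, fun c' hc' => ?_⟩
    by_cases h : c' = evalWord α f
    · rw [h]
    · exact (huniq c' (hsub c' hc') h).le
  have hex : ∃! c, IsArgmax (multMatrix μ Y) (candidates k α Q) c := by
    refine ⟨_, harg, fun c' hc' => ?_⟩
    by_contra h
    exact absurd (hc'.2 _ hmem) (not_le.2 (huniq c' (hsub c' hc'.1) h))
  rw [selectArgmax, dif_pos hex]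
  exact congrArg some (hex.unique hex.choose_spec.1 harg)

end KoetterVardy

/-! ### Columns of reads -/

section columns

variable {F : Type} [Field F] [DecidableEq F] {K : ℕ}

/-- The number of correct reads in a column. -/
def numCorrect (x : F) (y : Fin K → F) : ℕ := (Finset.univ.filter fun i => y i = x).card

/-- Two erroneous reads coincide. -/
def Collision (x : F) (y : Fin K → F) : Prop := ∃ i i', i ≠ i' ∧ y i = y i' ∧ y i ≠ x

variable [Fintype F] {n : ℕ} (μ : ℕ) (Y : Fin K → Fin n → F)

theorem countMatrix_eq (v : F) (j : Fin n) :
    countMatrix μ Y v j = μ * numCorrect v fun i => Y i j := rfl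

theorem sum_numCorrect (y : Fin K → F) : ∑ v, numCorrect v y = K := by
  have := Finset.card_eq_sum_card_fiberwise (f := y) (s := Finset.univ) (t := Finset.univ)
    (fun _ _ => Finset.mem_coe.2 (Finset.mem_univ _))
  rw [Finset.card_univ, Fintype.card_fin] at this
  exact this.symm

theorem numCorrect_le (x : F) (y : Fin K → F) : numCorrect x y ≤ K :=
  (Finset.card_filter_le _ _).trans (by simp)

theorem numCorrect_eq_zero (x : F) (y : Fin K → F) (h : ¬ ∃ i, y i = x) : numCorrect x y = 0 := by
  rw [numCorrect, Finset.card_eq_zero, Finset.filter_eq_empty_iff]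
  exact fun i _ hi => h ⟨i, hi⟩

theorem numCorrect_le_one (x : F) (y : Fin K → F) (hc : ¬ Collision x y) (v : F) (hv : v ≠ x) :
    numCorrect v y ≤ 1 := by
  rw [numCorrect, Finset.card_le_one]
  intro i hi i' hi'
  simp only [Finset.mem_filter, Finset.mem_univ, true_and] at hi hi'
  by_contra hne
  exact hc ⟨i, i', hne, hi.trans hi'.symm, by rwa [hi]⟩

theorem multMatrix_eq_or (j : Fin n) :
    (∃ u, (∃ i, Y i j = u) ∧ ∀ v, multMatrix μ Y v j = if v = u then μ * K else 0) ∨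
      ∀ v, multMatrix μ Y v j = countMatrix μ Y v j := by
  by_cases h : 1 < colMax (countMatrix μ Y) j ∧ (colArgmax (countMatrix μ Y) j).card = 1
  · left
    obtain ⟨u, hu⟩ := Finset.card_eq_one.1 h.2
    refine ⟨u, ?_, fun v => ?_⟩
    · by_contra h0
      have h1 := numCorrect_eq_zero u (fun i => Y i j) h0
      have h2 : u ∈ colArgmax (countMatrix μ Y) j := by rw [hu]; simp
      have h3 := (Finset.mem_filter.1 h2).2
      rw [countMatrix_eq, h1] at h3
      omega
    · rw [multMatrix, if_pos h, hu]
      simp only [Finset.mem_singleton]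
  · right
    intro v
    rw [multMatrix, if_neg h]

theorem multMatrix_le (v : F) (j : Fin n) : multMatrix μ Y v j ≤ μ * K := by
  rcases multMatrix_eq_or μ Y j with ⟨u, -, h⟩ | h
  · rw [h]
    split_ifs <;> simp
  · rw [h, countMatrix_eq]
    exact Nat.mul_le_mul_left _ (numCorrect_le _ _)

/-- Concentrating a column preserves its sum. This reduces bounds on sums of squares to bounds on
the largest entry. -/
theorem sum_multMatrix (j : Fin n) : ∑ v, multMatrix μ Y v j = μ * K := by
  rcases multMatrix_eq_or μ Y j with ⟨u, -, h⟩ | h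
  · simp only [h, Finset.sum_ite_eq', Finset.mem_univ, if_true]
  · simp only [h, countMatrix_eq, ← Finset.mul_sum, sum_numCorrect]

/-- Without a collision every wrong symbol is read at most once, so the sent symbol is the unique
maximum, and its entry is at least `2 μ > 1`. -/
theorem multMatrix_of_two_le (hμ : 1 ≤ μ) (x : F) (j : Fin n)
    (hc : ¬ Collision x fun i => Y i j) (h2 : 2 ≤ numCorrect x fun i => Y i j) (v : F) :
    multMatrix μ Y v j = if v = x then μ * K else 0 := by
  have hlt : ∀ w, w ≠ x → countMatrix μ Y w j < countMatrix μ Y x j := by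
    intro w hw
    have := numCorrect_le_one x _ hc w hw
    rw [countMatrix_eq, countMatrix_eq]
    exact Nat.mul_lt_mul_of_pos_left (by omega) hμ
  have hmax : colMax (countMatrix μ Y) j = countMatrix μ Y x j := by
    refine le_antisymm (Finset.sup_le fun w _ => ?_)
      (Finset.le_sup (f := fun v => countMatrix μ Y v j) (Finset.mem_univ x))
    by_cases hw : w = x
    · rw [hw]
    · exact (hlt w hw).le
  have harg : colArgmax (countMatrix μ Y) j = {x} := by
    ext w
    simp only [colArgmax, Finset.mem_filter, Finset.mem_univ, true_and, Finset.mem_singleton, hmax]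
    constructor
    · intro h
      by_contra hw
      exact (hlt w hw).ne h
    · rintro rfl
      rfl
  have h1 : 1 < countMatrix μ Y x j := by
    rw [countMatrix_eq]
    nlinarith
  rw [multMatrix, hmax, harg, if_pos ⟨h1, by simp⟩]
  simp only [Finset.mem_singleton]

/-- All reads are distinct, so `K ≥ 2` symbols tie for the maximum and the column is not modified.
-/
theorem multMatrix_of_le_one (hK : 2 ≤ K) (x : F) (j : Fin n)
    (hc : ¬ Collision x fun i => Y i j) (h1 : numCorrect x (fun i => Y i j) ≤ 1) :
    (∀ v, numCorrect v (fun i => Y i j) ≤ 1) ∧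
      ∀ v, multMatrix μ Y v j = μ * numCorrect v fun i => Y i j := by
  have hle : ∀ v, numCorrect v (fun i => Y i j) ≤ 1 := by
    intro v
    by_cases hv : v = x
    · rwa [hv]
    · exact numCorrect_le_one x _ hc v hv
  refine ⟨hle, fun v => ?_⟩
  rw [multMatrix, if_neg, countMatrix_eq]
  rintro ⟨h2, hcard⟩
  have hone : ∀ i, numCorrect (Y i j) (fun i => Y i j) = 1 := by
    intro i
    refine le_antisymm (hle _) ?_
    rw [numCorrect, Nat.one_le_iff_ne_zero, ← Nat.pos_iff_ne_zero, Finset.card_pos]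
    exact ⟨i, by simp⟩
  have hmax : colMax (countMatrix μ Y) j = μ := by
    refine le_antisymm (Finset.sup_le fun w _ => ?_) ?_
    · rw [countMatrix_eq]
      exact (Nat.mul_le_mul_left _ (hle w)).trans (by simp)
    · refine le_trans (le_of_eq ?_) (Finset.le_sup (f := fun v => countMatrix μ Y v j)
        (Finset.mem_univ (Y ⟨0, by omega⟩ j)))
      simp only [countMatrix_eq, hone, mul_one]
  obtain ⟨u, hu⟩ := Finset.card_eq_one.1 hcard
  have hmem : ∀ i, Y i j = u := by
    intro i
    rw [← Finset.mem_singleton, ← hu, colArgmax, Finset.mem_filter, hmax, countMatrix_eq, hone]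
    simp
  have := hone ⟨0, by omega⟩
  rw [numCorrect, Finset.card_eq_one] at this
  obtain ⟨i, hi⟩ := this
  have h3 : ∀ i', i' = i := by
    intro i'
    rw [← Finset.mem_singleton, ← hi]
    simp [hmem]
  have h4 := (h3 ⟨0, by omega⟩).trans (h3 ⟨1, by omega⟩).symm
  simp at h4

open Classical in
-- Columns without collision are computed exactly: weight `μ K = μ ((K - 1) + 1)` on the sent symbol
-- if it is read twice, and otherwise `K` entries `μ`. The collision terms are large enough to make
-- the bounds trivial in the other columns.
theorem column_bounds (hK : 2 ≤ K) (hμ : 1 ≤ μ) (x : F) (j : Fin n) :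
    μ * ((K - 1) * (if 2 ≤ numCorrect x (fun i => Y i j) then 1 else 0) +
        (if numCorrect x (fun i => Y i j) = 0 then 0 else 1)) ≤
      multMatrix μ Y x j + μ * K * (if Collision x (fun i => Y i j) then 1 else 0) ∧
    (∀ v, multMatrix μ Y v j ≤ μ * ((if ∃ i, Y i j = v then 1 else 0) +
      (K - 1) * (if 2 ≤ numCorrect x (fun i => Y i j) then 1 else 0) +
      K * (if Collision x (fun i => Y i j) then 1 else 0))) ∧
    ∑ v, multMatrix μ Y v j * (multMatrix μ Y v j + 1) ≤ μ * K + μ ^ 2 * (K + K * (K - 1) *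
      ((if 2 ≤ numCorrect x (fun i => Y i j) then 1 else 0) +
        (if Collision x (fun i => Y i j) then 1 else 0))) := by
  obtain ⟨K, rfl⟩ := Nat.exists_eq_add_of_le' (show 1 ≤ K by omega)
  rw [Nat.add_sub_cancel]
  have hsq : ∑ v, multMatrix μ Y v j * (multMatrix μ Y v j + 1) =
      ∑ v, multMatrix μ Y v j * multMatrix μ Y v j + μ * (K + 1) := by
    simp only [mul_add, mul_one, Finset.sum_add_distrib, sum_multMatrix]
  -- The sum of squares is at most the column sum times the largest entry: `B = μ K` for
  -- concentrated columns, `B = μ` when all reads differ.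
  have hsq2 : ∀ B, (∀ v, multMatrix μ Y v j ≤ B) →
      ∑ v, multMatrix μ Y v j * multMatrix μ Y v j ≤ μ * (K + 1) * B := by
    intro B hB
    rw [← sum_multMatrix μ Y j, Finset.sum_mul]
    exact Finset.sum_le_sum fun v _ => Nat.mul_le_mul_left _ (hB v)
  rw [hsq]
  by_cases hc : Collision x fun i => Y i j
  · simp only [hc, if_true]
    refine ⟨?_, fun v => ?_, ?_⟩
    · split_ifs <;> nlinarith
    · refine (multMatrix_le μ Y v j).trans (Nat.mul_le_mul_left _ ?_)
      split_ifs <;> omega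
    · have := hsq2 _ fun v => multMatrix_le μ Y v j
      split_ifs <;> nlinarith
  · simp only [hc, if_false]
    by_cases h2 : 2 ≤ numCorrect x fun i => Y i j
    · have hM := multMatrix_of_two_le μ Y hμ x j hc h2
      simp only [h2, if_true]
      refine ⟨?_, fun v => ?_, ?_⟩
      · rw [hM, if_pos rfl, if_neg (by omega)]
        nlinarith
      · rw [hM]
        split_ifs with h3 h4
        · nlinarith
        · exact absurd (numCorrect_eq_zero x _ (h3 ▸ h4)) (by omega)
        · omega
        · omega
      · have := hsq2 _ fun v => multMatrix_le μ Y v j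
        nlinarith
    · obtain ⟨hle, hM⟩ := multMatrix_of_le_one μ Y hK x j hc (by omega)
      simp only [h2, if_false]
      refine ⟨?_, fun v => ?_, ?_⟩
      · rw [hM]
        split_ifs with h3
        · simp
        · simp only [mul_zero, zero_add, mul_one, add_zero]
          exact Nat.le_mul_of_pos_right μ (by omega)
      · rw [hM]
        refine Nat.mul_le_mul_left _ ?_
        split_ifs with h3
        · exact (hle v).trans (by omega)
        · rw [numCorrect_eq_zero v _ h3]; omega
      · have := hsq2 μ fun v => by
          rw [hM]
          exact (Nat.mul_le_mul_left _ (hle v)).trans (by simp)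
        nlinarith

open Classical in
/-- Bounds for scores and cost in terms of numbers of columns. -/
theorem score_cost_bounds (hK : 2 ≤ K) (hμ : 1 ≤ μ) (c : Fin n → F) :
    let n₂ := (Finset.univ.filter fun j => 2 ≤ numCorrect (c j) fun i => Y i j).card
    let n₀ := (Finset.univ.filter fun j => numCorrect (c j) (fun i => Y i j) = 0).card
    let b := (Finset.univ.filter fun j => Collision (c j) fun i => Y i j).card
    μ * ((K - 1) * n₂ + n) ≤ score (multMatrix μ Y) c + μ * K * b + μ * n₀ ∧
    (∀ c' : Fin n → F, score (multMatrix μ Y) c' ≤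
      μ * ((Finset.univ.filter fun j => ∃ i, Y i j = c' j).card + (K - 1) * n₂ + K * b)) ∧
    KoetterVardy.cost (multMatrix μ Y) ≤ n * (μ * K) + μ ^ 2 * (n * K + K * (K - 1) * (n₂ + b)) := by
  intro n₂ n₀ b
  have hcol := fun j => column_bounds μ Y hK hμ (c j) j
  simp only [n₂, n₀, b, Finset.card_filter, score, KoetterVardy.cost]
  refine ⟨?_, fun c' => ?_, ?_⟩
  · have h0 : ∀ j : Fin n, (1 : ℕ) = (if numCorrect (c j) (fun i => Y i j) = 0 then 0 else 1) +
        (if numCorrect (c j) (fun i => Y i j) = 0 then 1 else 0) := fun j => by split_ifs <;> rfl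
    have hn : μ * ∑ j : Fin n, ((if numCorrect (c j) (fun i => Y i j) = 0 then 0 else 1) +
        (if numCorrect (c j) (fun i => Y i j) = 0 then 1 else 0)) = μ * n := by
      rw [← Finset.sum_congr rfl fun j _ => h0 j]
      simp
    have := Finset.sum_le_sum fun j (_ : j ∈ Finset.univ) => (hcol j).1
    simp only [mul_add, Finset.sum_add_distrib, ← Finset.mul_sum] at this hn ⊢
    omega
  · have := Finset.sum_le_sum fun j (_ : j ∈ Finset.univ) => (hcol j).2.1 (c' j)
    simp only [mul_add, Finset.sum_add_distrib, ← Finset.mul_sum] at this ⊢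
    exact this
  · have := Finset.sum_le_sum fun j (_ : j ∈ Finset.univ) => (hcol j).2.2
    simp only [mul_add, Finset.sum_add_distrib, ← Finset.mul_sum, Finset.sum_const,
      Finset.card_univ, Fintype.card_fin, smul_eq_mul] at this ⊢
    refine this.trans (le_of_eq ?_)
    ring

end columns

/-! ### Product weights on finite sets -/

section mass

variable {Ω Ω' : Type*} [Fintype Ω] [Fintype Ω']

open Classical in
/-- The total weight of an event. -/
noncomputable def mass (f : Ω → ℝ) (E : Ω → Prop) : ℝ := ∑ x, if E x then f x else 0

theorem mass_eq_sum_filter (f : Ω → ℝ) (E : Ω → Prop) [DecidablePred E] :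
    mass f E = ∑ x ∈ Finset.univ.filter E, f x := by
  rw [Finset.sum_filter, mass]
  exact Finset.sum_congr rfl fun _ _ => by congr

theorem mass_nonneg {f : Ω → ℝ} (hf : ∀ x, 0 ≤ f x) (E : Ω → Prop) : 0 ≤ mass f E :=
  Finset.sum_nonneg fun x _ => by split_ifs; exacts [hf x, le_rfl]

theorem mass_mono {f : Ω → ℝ} (hf : ∀ x, 0 ≤ f x) {E E' : Ω → Prop} (h : ∀ x, E x → E' x) :
    mass f E ≤ mass f E' := by
  refine Finset.sum_le_sum fun x _ => ?_
  have := h x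
  have := hf x
  split_ifs <;> tauto

theorem mass_exists_le {ι : Type*} {f : Ω → ℝ} (hf : ∀ x, 0 ≤ f x) (s : Finset ι)
    (E : ι → Ω → Prop) : mass f (fun x => ∃ i ∈ s, E i x) ≤ ∑ i ∈ s, mass f (E i) := by
  classical
  simp only [mass]
  rw [Finset.sum_comm]
  refine Finset.sum_le_sum fun x _ => ?_
  have h0 : ∀ i ∈ s, 0 ≤ if E i x then f x else 0 := fun i _ => by
    split_ifs; exacts [hf x, le_rfl]
  split_ifs with h
  · obtain ⟨i, hi, hE⟩ := h
    refine le_trans (le_of_eq ?_) (Finset.single_le_sum h0 hi)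
    rw [if_pos hE]
  · exact Finset.sum_nonneg h0

theorem mass_or_le {f : Ω → ℝ} (hf : ∀ x, 0 ≤ f x) (E E' : Ω → Prop) :
    mass f (fun x => E x ∨ E' x) ≤ mass f E + mass f E' := by
  simp only [mass, ← Finset.sum_add_distrib]
  refine Finset.sum_le_sum fun x _ => ?_
  have := hf x
  split_ifs <;> first | tauto | linarith

theorem mass_add_mass_not (f : Ω → ℝ) (E : Ω → Prop) :
    mass f E + mass f (fun x => ¬ E x) = ∑ x, f x := by
  simp only [mass, ← Finset.sum_add_distrib]
  refine Finset.sum_congr rfl fun x _ => ?_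
  split_ifs <;> simp

theorem mass_equiv (e : Ω ≃ Ω') (f : Ω' → ℝ) (E : Ω' → Prop) :
    mass (fun x => f (e x)) (fun x => E (e x)) = mass f E :=
  Fintype.sum_equiv e _ _ fun _ => rfl

variable {ι A : Type*} [Fintype ι] [Fintype A] [DecidableEq ι]

theorem mass_prod_forall (u : ι → A → ℝ) (G : ι → A → Prop) :
    mass (fun Z : ι → A => ∏ j, u j (Z j)) (fun Z => ∀ j, G j (Z j)) = ∏ j, mass (u j) (G j) := by
  classical
  simp only [mass]
  rw [Finset.prod_univ_sum, Fintype.piFinset_univ]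
  refine Finset.sum_congr rfl fun Z _ => ?_
  split_ifs with h
  · exact Finset.prod_congr rfl fun j _ => (if_pos (h j)).symm
  · obtain ⟨j, hj⟩ := not_forall.1 h
    exact (Finset.prod_eq_zero (Finset.mem_univ j) (if_neg hj)).symm

theorem sum_prod_eq_one (u : ι → A → ℝ) (h1 : ∀ j, ∑ a, u j a = 1) :
    ∑ Z : ι → A, ∏ j, u j (Z j) = 1 := by
  have := Finset.prod_univ_sum (fun _ : ι => (Finset.univ : Finset A)) u
  rw [Fintype.piFinset_univ] at this
  rw [← this]
  simp [h1]

open Classical in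
/-- Markov's inequality for the moment generating function of a number of events. -/
theorem mul_mass_le_prod (u : ι → A → ℝ) (h0 : ∀ j a, 0 ≤ u j a) (h1 : ∀ j, ∑ a, u j a = 1)
    (G : ι → A → Prop) (π : ι → ℝ) (hπ : ∀ j, mass (u j) (G j) ≤ π j) (z : ℝ) (hz : 1 ≤ z)
    (E : (ι → A) → Prop) (w : ℝ)
    (hw : ∀ Z, E Z → w ≤ z ^ (Finset.univ.filter fun j => G j (Z j)).card) :
    w * mass (fun Z => ∏ j, u j (Z j)) E ≤ ∏ j, (1 + (z - 1) * π j) := by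
  have hp : ∀ Z : ι → A, 0 ≤ ∏ j, u j (Z j) := fun Z => Finset.prod_nonneg fun j _ => h0 j _
  have hz0 : (0 : ℝ) ≤ z := by linarith
  calc w * mass (fun Z => ∏ j, u j (Z j)) E
      ≤ ∑ Z ∈ Finset.univ.filter E,
          z ^ (Finset.univ.filter fun j => G j (Z j)).card * ∏ j, u j (Z j) := by
        rw [mass_eq_sum_filter, Finset.mul_sum]
        exact Finset.sum_le_sum fun Z hZ =>
          mul_le_mul_of_nonneg_right (hw Z (Finset.mem_filter.1 hZ).2) (hp Z)
    _ ≤ ∑ Z : ι → A, z ^ (Finset.univ.filter fun j => G j (Z j)).card * ∏ j, u j (Z j) :=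
        Finset.sum_le_sum_of_subset_of_nonneg (Finset.filter_subset _ _) fun Z _ _ =>
          mul_nonneg (pow_nonneg hz0 _) (hp Z)
    _ = ∑ Z : ι → A, ∏ j, ((if G j (Z j) then z else 1) * u j (Z j)) := by
        refine Finset.sum_congr rfl fun Z _ => ?_
        rw [Finset.prod_mul_distrib, Finset.prod_ite]
        simp
    _ = ∏ j, ∑ a, (if G j a then z else 1) * u j a := by
        have := Finset.prod_univ_sum (fun _ : ι => (Finset.univ : Finset A))
          fun j a => (if G j a then z else 1) * u j a
        rw [Fintype.piFinset_univ] at this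
        exact this.symm
    _ ≤ ∏ j, (1 + (z - 1) * π j) := by
        refine Finset.prod_le_prod (fun j _ => Finset.sum_nonneg fun a _ => ?_) fun j _ => ?_
        · exact mul_nonneg (by split_ifs <;> linarith) (h0 j a)
        · have : ∑ a, (if G j a then z else 1) * u j a = 1 + (z - 1) * mass (u j) (G j) := by
            rw [mass, Finset.mul_sum]
            nth_rewrite 2 [← h1 j]
            rw [← Finset.sum_add_distrib]
            refine Finset.sum_congr rfl fun a _ => ?_
            split_ifs <;> ring
          rw [this]
          have := mul_le_mul_of_nonneg_left (hπ j) (sub_nonneg.2 hz)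
          linarith

theorem exp_sub_one_le {t : ℝ} (h0 : 0 ≤ t) (h1 : t ≤ 1) : Real.exp t - 1 ≤ t + t ^ 2 := by
  have := Real.abs_exp_sub_one_sub_id_le (x := t) (by rwa [abs_of_nonneg h0])
  have := (abs_le.1 this).2
  linarith

open Classical in
/-- A Chernoff bound. -/
theorem mass_count_le (u : ι → A → ℝ) (h0 : ∀ j a, 0 ≤ u j a) (h1 : ∀ j, ∑ a, u j a = 1)
    (G : ι → A → Prop) (π : ℝ) (hπ0 : 0 ≤ π) (hπ1 : π ≤ 1) (hπ : ∀ j, mass (u j) (G j) ≤ π)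
    (δ : ℝ) (hδ0 : 0 < δ) (hδ1 : δ ≤ 1) :
    mass (fun Z => ∏ j, u j (Z j))
      (fun Z : ι → A => (π + δ) * Fintype.card ι < (Finset.univ.filter fun j => G j (Z j)).card) ≤
      Real.exp (-(δ ^ 2 / 4 * Fintype.card ι)) := by
  -- Markov's inequality with `z = exp t`, `t = δ / 2`. The exponent per index is at most `(t + t²)
  -- π - t (π + δ) = t² π - t δ`, which is at most `-δ² / 4` because `π ≤ 1`.
  set n : ℝ := ((Fintype.card ι : ℕ) : ℝ)
  have hn : 0 ≤ n := Nat.cast_nonneg _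
  have h := mul_mass_le_prod u h0 h1 G (fun _ => π) hπ (Real.exp (δ / 2))
    (Real.one_le_exp (by positivity))
    (fun Z : ι → A => (π + δ) * n < (Finset.univ.filter fun j => G j (Z j)).card)
    (Real.exp (δ / 2 * ((π + δ) * n))) (fun Z hZ => by
      rw [← Real.exp_nat_mul, mul_comm]
      exact Real.exp_le_exp.2 (mul_le_mul_of_nonneg_right hZ.le (by positivity)))
  rw [Finset.prod_const, Finset.card_univ] at h
  have h2 : (1 + (Real.exp (δ / 2) - 1) * π) ^ Fintype.card ι ≤
      Real.exp (n * ((δ / 2 + (δ / 2) ^ 2) * π)) := by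
    rw [Real.exp_nat_mul]
    have h3 := exp_sub_one_le (t := δ / 2) (by linarith) (by linarith)
    have h4 : 0 ≤ Real.exp (δ / 2) - 1 := sub_nonneg.2 (Real.one_le_exp (by positivity))
    refine pow_le_pow_left₀ (by positivity) ?_ _
    have h5 := Real.add_one_le_exp ((δ / 2 + (δ / 2) ^ 2) * π)
    nlinarith [mul_le_mul_of_nonneg_right h3 hπ0]
  rw [← le_div_iff₀' (Real.exp_pos _)] at h
  refine h.trans ?_
  rw [div_le_iff₀ (Real.exp_pos _), ← Real.exp_add]
  refine h2.trans (Real.exp_le_exp.2 ?_)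
  have : 0 ≤ n * δ ^ 2 * (1 - π) := mul_nonneg (by positivity) (by linarith)
  nlinarith

end mass

/-! ### Column probabilities -/

section channel

variable {F : Type} [Field F] [Fintype F] [DecidableEq F] {K n : ℕ} {p : ℝ}

theorem one_lt_card_cast : (0 : ℝ) < (Fintype.card F : ℝ) - 1 := by
  have : 1 < Fintype.card F := Fintype.one_lt_card
  have : (1 : ℝ) < Fintype.card F := by exact_mod_cast this
  linarith

theorem symbolProb_nonneg (hp0 : 0 ≤ p) (hp1 : p ≤ 1) (x y : F) : 0 ≤ symbolProb p x y := by
  rw [symbolProb]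
  have := one_lt_card_cast (F := F)
  split_ifs
  · linarith
  · positivity

theorem mass_symbolProb_eq (x v : F) : mass (symbolProb p x) (fun y => y = v) = symbolProb p x v := by
  rw [mass_eq_sum_filter, Finset.filter_eq' Finset.univ v, if_pos (Finset.mem_univ v),
    Finset.sum_singleton]

theorem sum_symbolProb (x : F) : ∑ y, symbolProb p x y = 1 := by
  have h := one_lt_card_cast (F := F)
  rw [← Finset.add_sum_erase _ _ (Finset.mem_univ x)]
  have : ∀ y ∈ Finset.univ.erase x, symbolProb p x y = p / ((Fintype.card F : ℝ) - 1) := by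
    intro y hy
    rw [symbolProb, if_neg (Finset.ne_of_mem_erase hy)]
  rw [Finset.sum_congr rfl this, Finset.sum_const, Finset.card_erase_of_mem (Finset.mem_univ x),
    Finset.card_univ, nsmul_eq_mul, Nat.cast_sub Fintype.card_pos, symbolProb, if_pos rfl,
    Nat.cast_one, mul_div_cancel₀ _ h.ne']
  ring

theorem mass_symbolProb_ne (x : F) : mass (symbolProb p x) (fun y => ¬ y = x) = p := by
  have := mass_add_mass_not (symbolProb p x) (fun y => y = x)
  rw [mass_symbolProb_eq, sum_symbolProb, symbolProb, if_pos rfl] at this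
  linarith

/-- The probability of a column of reads. -/
noncomputable def columnProb (p : ℝ) (x : F) (y : Fin K → F) : ℝ := ∏ i, symbolProb p x (y i)

theorem columnProb_nonneg (hp0 : 0 ≤ p) (hp1 : p ≤ 1) (x : F) (y : Fin K → F) :
    0 ≤ columnProb p x y :=
  Finset.prod_nonneg fun i _ => symbolProb_nonneg hp0 hp1 x (y i)

theorem sum_columnProb (x : F) : ∑ y : Fin K → F, columnProb p x y = 1 :=
  sum_prod_eq_one (fun _ => symbolProb p x) fun _ => sum_symbolProb x

theorem mass_columnProb_forall (x : F) (G : Fin K → F → Prop) :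
    mass (columnProb p x) (fun y => ∀ i, G i (y i)) = ∏ i, mass (symbolProb p x) (G i) :=
  mass_prod_forall (fun _ => symbolProb p x) G

theorem mass_numCorrect_eq_zero (x : F) :
    mass (columnProb p x) (fun y : Fin K → F => numCorrect x y = 0) = p ^ K := by
  have h : ∀ y : Fin K → F, numCorrect x y = 0 ↔ ∀ i, ¬ y i = x := fun y => by
    simp [numCorrect, Finset.filter_eq_empty_iff]
  simp only [h]
  rw [mass_columnProb_forall x fun _ a => ¬ a = x]
  simp [mass_symbolProb_ne]

/-- The event splits disjointly according to the position of the one correct read. -/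
theorem mass_numCorrect_eq_one (x : F) :
    mass (columnProb p x) (fun y : Fin K → F => numCorrect x y = 1) =
      K * ((1 - p) * p ^ (K - 1)) := by
  classical
  have h : ∀ y : Fin K → F, (if numCorrect x y = 1 then columnProb p x y else 0) =
      ∑ i, if ∀ i', (y i' = x ↔ i' = i) then columnProb p x y else 0 := by
    intro y
    have h2 : ∀ i, (∀ i', (y i' = x ↔ i' = i)) ↔ (Finset.univ.filter fun i => y i = x) = {i} :=
      fun i => by simp [Finset.ext_iff]
    simp only [h2]
    split_ifs with h1
    · obtain ⟨i₀, hi₀⟩ := Finset.card_eq_one.1 h1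
      simp [hi₀]
    · symm
      refine Finset.sum_eq_zero fun i _ => if_neg fun hi => h1 ?_
      rw [numCorrect, hi, Finset.card_singleton]
  have h3 : ∀ i : Fin K, mass (columnProb p x) (fun y => ∀ i', (y i' = x ↔ i' = i)) =
      (1 - p) * p ^ (K - 1) := by
    intro i
    rw [mass_columnProb_forall x fun i' a => (a = x ↔ i' = i),
      ← Finset.mul_prod_erase _ _ (Finset.mem_univ i)]
    congr 1
    · simp [mass_symbolProb_eq, symbolProb]
    · rw [Finset.prod_congr rfl (g := fun _ => p), Finset.prod_const,
        Finset.card_erase_of_mem (Finset.mem_univ _), Finset.card_univ, Fintype.card_fin]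
      intro i' hi'
      simp only [Finset.ne_of_mem_erase hi', iff_false, mass_symbolProb_ne]
  have h4 : mass (columnProb p x) (fun y : Fin K → F => numCorrect x y = 1) =
      ∑ i, mass (columnProb p x) (fun y : Fin K → F => ∀ i', (y i' = x ↔ i' = i)) := by
    simp only [mass]
    rw [Finset.sum_comm]
    refine Finset.sum_congr rfl fun y _ => ?_
    convert h y
  rw [h4, Finset.sum_congr rfl fun i _ => h3 i]
  simp

theorem mass_numCorrect_le_one (x : F) :
    mass (columnProb p x) (fun y : Fin K → F => numCorrect x y ≤ 1) =
      p ^ K + K * ((1 - p) * p ^ (K - 1)) := by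
  classical
  rw [← mass_numCorrect_eq_zero x, ← mass_numCorrect_eq_one x]
  simp only [mass, ← Finset.sum_add_distrib]
  refine Finset.sum_congr rfl fun y _ => ?_
  split_ifs <;> first | omega | simp

theorem mass_two_le_numCorrect (x : F) :
    mass (columnProb p x) (fun y : Fin K → F => 2 ≤ numCorrect x y) =
      1 - p ^ K - K * ((1 - p) * p ^ (K - 1)) := by
  have := mass_add_mass_not (columnProb p x) (fun y : Fin K → F => numCorrect x y ≤ 1)
  rw [mass_numCorrect_le_one, sum_columnProb] at this
  simp only [not_le] at this
  change _ + mass (columnProb p x) (fun y : Fin K → F => 2 ≤ numCorrect x y) = _ at this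
  linarith

theorem mass_columnProb_eq (x : F) (i : Fin K) (G : F → Prop) :
    mass (columnProb p x) (fun y => G (y i)) = mass (symbolProb p x) G := by
  classical
  have := mass_columnProb_forall (p := p) x fun i' a => i' = i → G a
  have h : ∀ y : Fin K → F, (∀ i', i' = i → G (y i')) ↔ G (y i) := fun y => by simp
  simp only [h] at this
  rw [this, Finset.prod_eq_single i]
  · simp
  · intro i' _ hi'
    simp only [hi', false_imp_iff]
    simp [mass, sum_symbolProb]
  · simp

theorem mass_columnProb_eq_eq (x : F) (i i' : Fin K) (hi : i ≠ i') (v : F) :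
    mass (columnProb p x) (fun y => y i = v ∧ y i' = v) = symbolProb p x v ^ 2 := by
  classical
  have := mass_columnProb_forall (p := p) x fun l a => (l = i ∨ l = i') → a = v
  have h : ∀ y : Fin K → F, (∀ l, (l = i ∨ l = i') → y l = v) ↔ (y i = v ∧ y i' = v) := fun y => by
    simp [or_imp, forall_and]
  simp only [h] at this
  rw [this, ← Finset.mul_prod_erase _ _ (Finset.mem_univ i),
    ← Finset.mul_prod_erase _ _ (Finset.mem_erase.2 ⟨hi.symm, Finset.mem_univ i'⟩),
    Finset.prod_eq_one]
  · simp [mass_symbolProb_eq, sq]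
  · intro l hl
    simp only [Finset.mem_erase, Finset.mem_univ, and_true] at hl
    simp only [hl, or_self, false_imp_iff]
    simp [mass, sum_symbolProb]

theorem mass_exists_read_le (hp0 : 0 ≤ p) (hp1 : p ≤ 1) (x v : F) (hv : v ≠ x) :
    mass (columnProb p x) (fun y : Fin K → F => ∃ i, y i = v) ≤
      K / ((Fintype.card F : ℝ) - 1) := by
  have := mass_exists_le (columnProb_nonneg hp0 hp1 x) Finset.univ
    fun (i : Fin K) (y : Fin K → F) => y i = v
  simp only [Finset.mem_univ, true_and] at this
  refine this.trans ?_
  rw [Finset.sum_congr rfl fun i _ => mass_columnProb_eq x i fun a => a = v]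
  have h := one_lt_card_cast (F := F)
  simp only [mass_symbolProb_eq, symbolProb, if_neg hv, Finset.sum_const, Finset.card_univ,
    Fintype.card_fin, nsmul_eq_mul]
  rw [mul_div_assoc']
  gcongr
  exact mul_le_of_le_one_right (Nat.cast_nonneg _) hp1

/-- Union bound over at most `K²` pairs of reads and `q - 1` wrong symbols, each with probability at
most `1 / (q - 1)²`. -/
theorem mass_collision_le (hp0 : 0 ≤ p) (hp1 : p ≤ 1) (x : F) :
    mass (columnProb p x) (fun y : Fin K → F => Collision x y) ≤
      K ^ 2 / ((Fintype.card F : ℝ) - 1) := by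
  have h := one_lt_card_cast (F := F)
  set N := (Fintype.card F : ℝ) - 1 with hN
  have hf := columnProb_nonneg (K := K) hp0 hp1 x
  have h1 := mass_exists_le hf
    ((Finset.univ.filter fun l : Fin K × Fin K => l.1 ≠ l.2) ×ˢ Finset.univ.erase x)
    fun l y => y l.1.1 = l.2 ∧ y l.1.2 = l.2
  refine (mass_mono hf ?_).trans (h1.trans ?_)
  · rintro y ⟨i, i', hne, heq, hx⟩
    exact ⟨((i, i'), y i), by simp [hne, hx], rfl, heq.symm⟩
  · have h2 : ∀ l ∈ (Finset.univ.filter fun l : Fin K × Fin K => l.1 ≠ l.2) ×ˢ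
        Finset.univ.erase x, mass (columnProb p x) (fun y : Fin K → F => y l.1.1 = l.2 ∧
          y l.1.2 = l.2) ≤ (1 / N) ^ 2 := by
      intro l hl
      simp only [Finset.mem_product, Finset.mem_filter, Finset.mem_univ, true_and,
        Finset.mem_erase, and_true] at hl
      rw [mass_columnProb_eq_eq x _ _ hl.1, symbolProb, if_neg hl.2, ← hN]
      gcongr
    refine (Finset.sum_le_sum h2).trans ?_
    rw [Finset.sum_const, Finset.card_product, Finset.card_erase_of_mem (Finset.mem_univ x),
      nsmul_eq_mul, Nat.cast_mul, Finset.card_univ, Nat.cast_sub Fintype.card_pos, Nat.cast_one,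
      ← hN]
    have h3 : ((Finset.univ.filter fun l : Fin K × Fin K => l.1 ≠ l.2).card : ℝ) ≤ K ^ 2 := by
      have := Finset.card_filter_le (Finset.univ : Finset (Fin K × Fin K)) fun l => l.1 ≠ l.2
      rw [Finset.card_univ, Fintype.card_prod, Fintype.card_fin, ← sq] at this
      exact_mod_cast this
    rw [mul_assoc, show N * (1 / N) ^ 2 = 1 / N by field_simp, mul_one_div]
    gcongr

theorem readsProb_nonneg (hp0 : 0 ≤ p) (hp1 : p ≤ 1) (c : Fin n → F) (Y : Fin K → Fin n → F) :
    0 ≤ readsProb p c Y :=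
  Finset.prod_nonneg fun _ _ => Finset.prod_nonneg fun _ _ => symbolProb_nonneg hp0 hp1 _ _

/-- Transposing the reads turns the channel into a product of independent columns. -/
theorem mass_readsProb (c : Fin n → F) (E : (Fin n → Fin K → F) → Prop) :
    mass (readsProb p c) (fun Y => E fun j i => Y i j) =
      mass (fun Z : Fin n → Fin K → F => ∏ j, columnProb p (c j) (Z j)) E := by
  rw [← mass_equiv (Equiv.piComm fun (_ : Fin K) (_ : Fin n) => F)]
  congr 1
  funext Y
  rw [readsProb, Finset.prod_comm]
  rfl

open Classical in
theorem mass_readsProb_count_le (hp0 : 0 ≤ p) (hp1 : p ≤ 1) (c : Fin n → F)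
    (G : F → (Fin K → F) → Prop) (π : ℝ) (hπ0 : 0 ≤ π) (hπ1 : π ≤ 1)
    (hπ : ∀ x, mass (columnProb p x) (G x) ≤ π) (δ : ℝ) (hδ0 : 0 < δ) (hδ1 : δ ≤ 1) :
    mass (readsProb p c) (fun Y =>
      (π + δ) * n < (Finset.univ.filter fun j => G (c j) fun i => Y i j).card) ≤
      Real.exp (-(δ ^ 2 / 4 * n)) := by
  have := mass_count_le (fun j => columnProb (K := K) p (c j))
    (fun j => columnProb_nonneg hp0 hp1 (c j)) (fun j => sum_columnProb (c j)) (fun j => G (c j))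
    π hπ0 hπ1 (fun j => hπ (c j)) δ hδ0 hδ1
  rw [← mass_readsProb, Fintype.card_fin] at this
  exact this

end channel

/-! ### The other codewords -/

section code

variable {F : Type} [Field F] {n k : ℕ} {α : Fin n ↪ F}

theorem rsCode_eq_of_agree {c c' : Fin n → F} (hc : c ∈ rsCode k α) (hc' : c' ∈ rsCode k α)
    (B : Finset (Fin n)) (hB : k ≤ B.card) (h : ∀ j ∈ B, c j = c' j) : c = c' := by
  obtain ⟨f, hf, rfl⟩ := hc
  obtain ⟨g, hg, rfl⟩ := hc'
  have hk : (k : WithBot ℕ) ≤ B.card := by exact_mod_cast hB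
  rw [Polynomial.eq_of_degrees_lt_of_eval_index_eq B (v := α) (α.injective.injOn)
    (hf.trans_le hk) (hg.trans_le hk) h]

variable [Fintype F] [DecidableEq F] {K : ℕ} {p : ℝ}

open Classical in
-- Extend `A` to a set `B` of `k` positions. A codeword is determined by its values on `B`, and
-- those on `A` are prescribed.
theorem card_rsCode_agree_le (hkn : k ≤ n) (c : Fin n → F) (A : Finset (Fin n)) (hA : A.card ≤ k) :
    (Finset.univ.filter fun c' => c' ∈ rsCode k α ∧ ∀ j ∈ A, c j = c' j).card ≤
      Fintype.card F ^ (k - A.card) := by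
  obtain ⟨B, hAB, hB⟩ := Finset.exists_superset_card_eq hA (by simpa using hkn)
  have h : Fintype.card F ^ (k - A.card) =
      (Finset.univ : Finset ({j // j ∈ B \ A} → F)).card := by
    rw [Finset.card_univ, Fintype.card_fun, Fintype.card_coe, Finset.card_sdiff_of_subset hAB, hB]
  rw [h]
  refine Finset.card_le_card_of_injOn (fun c' j => c' j.1) (fun _ _ => Finset.mem_univ _) ?_
  intro c₁ h₁ c₂ h₂ heq
  simp only [Finset.coe_filter, Finset.mem_univ, true_and, Set.mem_ofPred_eq] at h₁ h₂
  refine rsCode_eq_of_agree h₁.1 h₂.1 B hB.ge fun j hj => ?_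
  by_cases hjA : j ∈ A
  · rw [← h₁.2 j hjA, h₂.2 j hjA]
  · exact congrFun heq ⟨j, Finset.mem_sdiff.2 ⟨hj, hjA⟩⟩

open Classical in
theorem card_rsCode_le (hkn : k ≤ n) :
    (Finset.univ.filter fun c => c ∈ rsCode k α).card ≤ Fintype.card F ^ k := by
  simpa using card_rsCode_agree_le (α := α) hkn 0 ∅ (by simp)

open Classical in
-- Group the codewords by the set `A` on which they agree with `c`. Two distinct codewords agree in
-- fewer than `k` places, and at most `q ^ (k - |A|)` of them agree on `A`. With `q ≤ 2 (q - 1)`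
-- each group contributes at most `2 ^ n (q - 1) ^ k`, and there are `2 ^ n` sets.
theorem sum_pow_agree_le (hkn : k ≤ n) (c : Fin n → F) (hc : c ∈ rsCode k α) :
    ∑ c' ∈ Finset.univ.filter (fun c' => c' ∈ rsCode k α ∧ c' ≠ c),
        ((Fintype.card F : ℝ) - 1) ^ (Finset.univ.filter fun j => c j = c' j).card ≤
      4 ^ n * ((Fintype.card F : ℝ) - 1) ^ k := by
  have hN1 : (1 : ℝ) ≤ (Fintype.card F : ℝ) - 1 := by
    have : 2 ≤ Fintype.card F := Fintype.one_lt_card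
    have : (2 : ℝ) ≤ Fintype.card F := by exact_mod_cast this
    linarith
  obtain ⟨N, hN⟩ : ∃ N, (Fintype.card F : ℝ) - 1 = N := ⟨_, rfl⟩
  rw [hN] at hN1 ⊢
  have hq : (Fintype.card F : ℝ) ≤ 2 * N := by linarith
  rw [← Finset.sum_fiberwise _ fun c' => Finset.univ.filter fun j => c j = c' j]
  have key : ∀ A : Finset (Fin n), ∑ c' ∈ (Finset.univ.filter fun c' => c' ∈ rsCode k α ∧
      c' ≠ c).filter (fun c' => (Finset.univ.filter fun j => c j = c' j) = A),
        N ^ (Finset.univ.filter fun j => c j = c' j).card ≤ 2 ^ n * N ^ k := by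
    intro A
    rcases le_or_gt k A.card with hA | hA
    · rw [Finset.sum_eq_zero]
      · positivity
      · intro c' hc'
        simp only [Finset.mem_filter, Finset.mem_univ, true_and] at hc'
        refine absurd (rsCode_eq_of_agree hc'.1.1 hc A hA fun j hj => ?_) hc'.1.2
        rw [← hc'.2] at hj
        exact (Finset.mem_filter.1 hj).2.symm
    · calc _ = ∑ c' ∈ (Finset.univ.filter fun c' => c' ∈ rsCode k α ∧
            c' ≠ c).filter (fun c' => (Finset.univ.filter fun j => c j = c' j) = A),
            N ^ A.card := Finset.sum_congr rfl fun c' hc' => by rw [(Finset.mem_filter.1 hc').2]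
        _ ≤ ∑ c' ∈ Finset.univ.filter fun c' => c' ∈ rsCode k α ∧ ∀ j ∈ A, c j = c' j,
              N ^ A.card := by
            refine Finset.sum_le_sum_of_subset_of_nonneg (fun c' hc' => ?_)
              fun _ _ _ => by positivity
            simp only [Finset.mem_filter, Finset.mem_univ, true_and] at hc' ⊢
            refine ⟨hc'.1.1, fun j hj => ?_⟩
            rw [← hc'.2] at hj
            exact (Finset.mem_filter.1 hj).2
        _ ≤ (2 * N) ^ (k - A.card) * N ^ A.card := by
            rw [Finset.sum_const, nsmul_eq_mul]
            have := card_rsCode_agree_le (α := α) hkn c A hA.le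
            have : ((Finset.univ.filter fun c' => c' ∈ rsCode k α ∧ ∀ j ∈ A, c j = c' j).card : ℝ)
              ≤ (Fintype.card F : ℝ) ^ (k - A.card) := by exact_mod_cast this
            gcongr
            exact this.trans (pow_le_pow_left₀ (Nat.cast_nonneg _) hq _)
        _ = 2 ^ (k - A.card) * N ^ k := by
            rw [mul_pow, mul_assoc, ← pow_add, Nat.sub_add_cancel hA.le]
        _ ≤ 2 ^ n * N ^ k := by
            gcongr
            · norm_num
            · omega
  refine (Finset.sum_le_sum fun A _ => key A).trans ?_
  rw [Finset.sum_const, Finset.card_univ, Fintype.card_finset, Fintype.card_fin, nsmul_eq_mul,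
    ← mul_assoc]
  push_cast
  rw [← mul_pow]
  norm_num

open Classical in
-- Moment bound with `z = q - 1`. Positions where `c` and `c'` agree contribute a factor at most `q
-- - 1`. The others match with probability at most `K / (q - 1)`, which this `z` just compensates,
-- and contribute at most `1 + K`.
theorem mass_matches_le (hp0 : 0 ≤ p) (hp1 : p ≤ 1) (c c' : Fin n → F) (t : ℕ) :
    ((Fintype.card F : ℝ) - 1) ^ t * mass (readsProb (K := K) p c)
        (fun Y => t ≤ (Finset.univ.filter fun j => ∃ i, Y i j = c' j).card) ≤
      (1 + K) ^ n * ((Fintype.card F : ℝ) - 1) ^ (Finset.univ.filter fun j => c j = c' j).card := by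
  have hN1 : (1 : ℝ) ≤ (Fintype.card F : ℝ) - 1 := by
    have : 2 ≤ Fintype.card F := Fintype.one_lt_card
    have : (2 : ℝ) ≤ Fintype.card F := by exact_mod_cast this
    linarith
  rw [mass_readsProb c fun Z => t ≤ (Finset.univ.filter fun j => ∃ i, Z j i = c' j).card]
  obtain ⟨N, hN⟩ : ∃ N, (Fintype.card F : ℝ) - 1 = N := ⟨_, rfl⟩
  rw [hN] at hN1 ⊢
  have h0 := mul_mass_le_prod (fun j => columnProb (K := K) p (c j))
    (fun j => columnProb_nonneg hp0 hp1 (c j)) (fun j => sum_columnProb (c j))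
    (fun j y => ∃ i, y i = c' j) (fun j => if c j = c' j then 1 else K / N) ?_ N hN1
    (fun Z => t ≤ (Finset.univ.filter fun j => ∃ i, Z j i = c' j).card) (N ^ t)
    (fun Z hZ => pow_le_pow_right₀ hN1 (hZ.trans (le_of_eq (by congr))))
  · refine h0.trans ?_
    have hK : (0 : ℝ) ≤ K := Nat.cast_nonneg _
    have h1 : ∀ j ∈ Finset.univ, 1 + (N - 1) * (if c j = c' j then (1 : ℝ) else K / N) ≤
        (1 + K) * if c j = c' j then N else 1 := by
      intro j _
      split_ifs
      · nlinarith
      · have : (N - 1) * (K / N) ≤ K := by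
          rw [mul_div_assoc', div_le_iff₀ (by linarith)]
          nlinarith
        linarith
    refine (Finset.prod_le_prod (fun j _ => ?_) h1).trans (le_of_eq ?_)
    · have : 0 ≤ if c j = c' j then (1 : ℝ) else K / N := by
        split_ifs
        · exact zero_le_one
        · exact div_nonneg hK (by linarith)
      have := mul_nonneg (sub_nonneg.2 hN1) this
      linarith
    · rw [Finset.prod_mul_distrib, Finset.prod_ite]
      simp
  · intro j
    split_ifs with h
    · rw [← sum_columnProb (K := K) (p := p) (c j)]
      have := mass_add_mass_not (columnProb p (c j)) (fun y : Fin K → F => ∃ i, y i = c' j)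
      have := mass_nonneg (columnProb_nonneg hp0 hp1 (c j))
        (fun y : Fin K → F => ¬ ∃ i, y i = c' j)
      linarith
    · rw [← hN]
      exact mass_exists_read_le hp0 hp1 _ _ (Ne.symm h)

open Classical in
/-- With high probability no other codeword occurs in many columns of the reads. -/
theorem mass_other_codeword_le (hp0 : 0 ≤ p) (hp1 : p ≤ 1) (hkn : k ≤ n) (c : Fin n → F)
    (hc : c ∈ rsCode k α) (m : ℕ) :
    ((Fintype.card F : ℝ) - 1) ^ m * mass (readsProb (K := K) p c)
      (fun Y => ∃ c' ∈ rsCode k α, c' ≠ c ∧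
        k + m ≤ (Finset.univ.filter fun j => ∃ i, Y i j = c' j).card) ≤ (4 * (1 + K)) ^ n := by
  have hN : (0 : ℝ) < (Fintype.card F : ℝ) - 1 := one_lt_card_cast
  have h := mass_exists_le (readsProb_nonneg (K := K) hp0 hp1 c)
    (Finset.univ.filter fun c' => c' ∈ rsCode k α ∧ c' ≠ c)
    fun c' Y => k + m ≤ (Finset.univ.filter fun j => ∃ i, Y i j = c' j).card
  simp only [Finset.mem_filter, Finset.mem_univ, true_and, and_assoc] at h
  have h2 : ((Fintype.card F : ℝ) - 1) ^ (k + m) * mass (readsProb (K := K) p c)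
      (fun Y => ∃ c' ∈ rsCode k α, c' ≠ c ∧
        k + m ≤ (Finset.univ.filter fun j => ∃ i, Y i j = c' j).card) ≤
      (4 * (1 + K)) ^ n * ((Fintype.card F : ℝ) - 1) ^ k := by
    refine (mul_le_mul_of_nonneg_left h (by positivity)).trans ?_
    rw [Finset.mul_sum]
    refine (Finset.sum_le_sum fun c' _ => mass_matches_le hp0 hp1 c c' (k + m)).trans ?_
    rw [← Finset.mul_sum]
    refine (mul_le_mul_of_nonneg_left (a := (1 + K : ℝ) ^ n) (sum_pow_agree_le hkn c hc)
      (by positivity)).trans (le_of_eq ?_)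
    rw [mul_pow]
    ring
  rw [pow_add, mul_assoc, mul_comm] at h2
  exact le_of_mul_le_mul_right h2 (by positivity)

end code

/-! ### The rate threshold -/

section threshold

variable {K : ℕ} {p : ℝ}

/-- The probability of at least two correct reads. -/
noncomputable def probTwoLe (K : ℕ) (p : ℝ) : ℝ := 1 - p ^ K - K * ((1 - p) * p ^ (K - 1))

theorem probTwoLe_nonneg (hp0 : 0 ≤ p) (hp1 : p ≤ 1) : 0 ≤ probTwoLe K p := by
  rcases K with - | K
  · simp [probTwoLe]
  induction K with
  | zero => simp [probTwoLe]
  | succ K ih =>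
    have h1 : probTwoLe (K + 1 + 1) p = p * probTwoLe (K + 1) p + (1 - p) * (1 - p ^ (K + 1)) := by
      simp only [probTwoLe, Nat.add_sub_cancel]
      push_cast
      ring
    rw [h1]
    have h2 : p ^ (K + 1) ≤ 1 := pow_le_one₀ hp0 hp1
    exact add_nonneg (mul_nonneg hp0 ih) (mul_nonneg (by linarith) (by linarith))

theorem probTwoLe_le (hp0 : 0 ≤ p) (hp1 : p ≤ 1) : probTwoLe K p ≤ 1 - p ^ K := by
  have : 0 ≤ (K : ℝ) * ((1 - p) * p ^ (K - 1)) :=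
    mul_nonneg (Nat.cast_nonneg _) (mul_nonneg (by linarith) (pow_nonneg hp0 _))
  rw [probTwoLe]
  linarith

/-- The numerator is the square of the typical score of the sent word and the denominator the
typical leading cost, per column and in units of `μ` and `μ²`. -/
theorem rateThreshold_eq (hK : 2 ≤ K) (hp0 : 0 ≤ p) (hp1 : p ≤ 1) : rateThreshold K p =
    ((K - 1) * probTwoLe K p + (1 - p ^ K)) ^ 2 / (K * (1 + (K - 1) * probTwoLe K p)) := by
  have hK' : (2 : ℝ) ≤ K := by exact_mod_cast hK
  have hD : 0 < 1 + ((K : ℝ) - 1) * probTwoLe K p :=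
    add_pos_of_pos_of_nonneg one_pos (mul_nonneg (by linarith) (probTwoLe_nonneg hp0 hp1))
  have h1 : 1 + ((K : ℝ) - 1) * (1 - p ^ K - K * (1 - p) * p ^ (K - 1)) =
      1 + (K - 1) * probTwoLe K p := by
    rw [probTwoLe, mul_assoc (K : ℝ)]
  have h2 : ((K : ℝ) - 1) * probTwoLe K p + (1 - p ^ K) =
      K * (1 - p ^ K - (K - 1) * (1 - p) * p ^ (K - 1)) := by
    rw [probTwoLe]
    ring
  rw [rateThreshold, h1, h2, div_eq_div_iff hD.ne' (by positivity)]
  ring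

/-- Ensures that at rates below the threshold a wrong codeword, which occurs in little more than `k`
columns, scores less than the sent word, which occurs in about `(1 - p ^ K) n` columns. -/
theorem rateThreshold_lt (hK : 2 ≤ K) (hp0 : 0 < p) (hp1 : p < 1) :
    rateThreshold K p < 1 - p ^ K := by
  have hK' : (2 : ℝ) ≤ K := by exact_mod_cast hK
  have hx0 := probTwoLe_nonneg (K := K) hp0.le hp1.le
  have hxa := probTwoLe_le (K := K) hp0.le hp1.le
  have ha0 : p ^ K < 1 := pow_lt_one₀ hp0.le hp1 (by omega)
  have ha1 : 0 < p ^ K := pow_pos hp0 _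
  rw [rateThreshold_eq hK hp0.le hp1.le]
  set x := probTwoLe K p
  set a := 1 - p ^ K
  set m : ℝ := (K : ℝ) - 1 with hm
  have hKm : (K : ℝ) = m + 1 := by rw [hm]; ring
  have hm1 : 1 ≤ m := by linarith
  have ha : 0 < a := by linarith
  have ha' : a < 1 := by linarith
  rw [hKm, div_lt_iff₀ (by positivity)]
  -- The difference `a (m + 1) (1 + m x) - (m x + a)²` equals `m² x (a - x) + a (1 - a) + m a (1 -
  -- x)`.
  have h1 : 0 ≤ m ^ 2 * x * (a - x) := by
    have : 0 ≤ a - x := by linarith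
    positivity
  have h2 : 0 < a * (1 - a) := mul_pos ha (by linarith)
  have h3 : 0 ≤ m * a * (1 - x) := by
    have : 0 ≤ 1 - x := by linarith
    positivity
  nlinarith

/-- All inequalities are strict at `δ = 0`, so continuity gives a positive `δ`. The coefficients
collect the deviations allowed by `Typical`. The score loses `(K - 1) + 2 K + 1 = 3 K` times `δ`.
The cost gains at most `3 K²` times `δ`, and one more for its part linear in `μ`. The comparison
with another codeword needs `1 + 4 K + 1`. -/
theorem exists_slack (hK : 2 ≤ K) (hp0 : 0 < p) (hp1 : p < 1) {R : ℝ}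
    (hR : R < rateThreshold K p) : ∃ δ : ℝ, 0 < δ ∧ δ ≤ 1 ∧
      0 < (K - 1) * probTwoLe K p + (1 - p ^ K) - 3 * K * δ ∧
      R * (K * (1 + (K - 1) * probTwoLe K p) + (3 * K ^ 2 + 1) * δ) <
        ((K - 1) * probTwoLe K p + (1 - p ^ K) - 3 * K * δ) ^ 2 ∧
      R + (2 + 4 * K) * δ < 1 - p ^ K := by
  have hK' : (2 : ℝ) ≤ K := by exact_mod_cast hK
  have hx0 := probTwoLe_nonneg (K := K) hp0.le hp1.le
  have ha0 : p ^ K < 1 := pow_lt_one₀ hp0.le hp1 (by omega)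
  have hR1 := hR.trans (rateThreshold_lt hK hp0 hp1)
  have hK1 : 0 ≤ (K : ℝ) - 1 := by linarith
  have hD : 0 < K * (1 + (K - 1) * probTwoLe K p) := by positivity
  have hs : 0 < (K - 1) * probTwoLe K p + (1 - p ^ K) :=
    add_pos_of_nonneg_of_pos (mul_nonneg hK1 hx0) (by linarith)
  rw [rateThreshold_eq hK hp0.le hp1.le, lt_div_iff₀ hD] at hR
  generalize (K - 1) * probTwoLe K p + (1 - p ^ K) = s at *
  generalize K * (1 + (K - 1) * probTwoLe K p) = D at *
  have key : ∀ f g : ℝ → ℝ, Continuous f → Continuous g → f 0 < g 0 →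
      ∀ᶠ δ in nhdsWithin (0 : ℝ) (Set.Ioi 0), f δ < g δ := fun f g hf hg h =>
    ((hf.tendsto 0).eventually_lt (hg.tendsto 0) h).filter_mono nhdsWithin_le_nhds
  have h1 := key (fun δ => 0) (fun δ => s - 3 * K * δ) (by fun_prop) (by fun_prop) (by simpa)
  have h2 := key (fun δ => R * (D + (3 * K ^ 2 + 1) * δ)) (fun δ => (s - 3 * K * δ) ^ 2)
    (by fun_prop) (by fun_prop) (by simpa)
  have h3 := key (fun δ => R + (2 + 4 * K) * δ) (fun δ => 1 - p ^ K)
    (by fun_prop) (by fun_prop) (by simpa)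
  have h4 := key (fun δ => δ) (fun δ => 1) (by fun_prop) (by fun_prop) (by norm_num)
  obtain ⟨δ, ⟨⟨⟨h1, h2⟩, h3⟩, h4⟩, h5⟩ :=
    ((((h1.and h2).and h3).and h4).and self_mem_nhdsWithin).exists
  exact ⟨δ, h5, h4.le, h1, h2, h3⟩

end threshold

/-! ### The error probability -/

section error

variable {F : Type} [Field F] [Fintype F] [DecidableEq F] {K n k : ℕ} {p : ℝ}

open Classical in
/-- The reads of `c` are typical. -/
def Typical (δ : ℝ) (k : ℕ) (p : ℝ) (α : Fin n ↪ F) (c : Fin n → F) (Y : Fin K → Fin n → F) :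
    Prop :=
  ((Finset.univ.filter fun j => 2 ≤ numCorrect (c j) fun i => Y i j).card : ℝ) ≤
    (probTwoLe K p + δ) * n ∧
  ((Finset.univ.filter fun j => numCorrect (c j) (fun i => Y i j) ≤ 1).card : ℝ) ≤
    (1 - probTwoLe K p + δ) * n ∧
  ((Finset.univ.filter fun j => numCorrect (c j) (fun i => Y i j) = 0).card : ℝ) ≤
    (p ^ K + δ) * n ∧
  ((Finset.univ.filter fun j => Collision (c j) fun i => Y i j).card : ℝ) ≤ (δ + δ) * n ∧
  ∀ c' ∈ rsCode k α, c' ≠ c →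
    (Finset.univ.filter fun j => ∃ i, Y i j = c' j).card < k + ⌈δ * n⌉₊

theorem cast_lt_add_of_lt_add_ceil {m k : ℕ} {r : ℝ} (hr : 0 < r) (h : m < k + ⌈r⌉₊) :
    (m : ℝ) < k + r := by
  have h1 : (m : ℝ) + 1 ≤ k + ⌈r⌉₊ := by exact_mod_cast h
  linarith [Nat.ceil_lt_add_one hr.le]

theorem reconstruction_eq_of_typical (hK : 2 ≤ K) (hk : 1 ≤ k) (hn : 1 ≤ n) {μ : ℕ} {δ R : ℝ}
    (hδ : 0 < δ) (h1 : 0 < (K - 1) * probTwoLe K p + (1 - p ^ K) - 3 * K * δ)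
    (h2 : R * (K * (1 + (K - 1) * probTwoLe K p) + (3 * K ^ 2 + 1) * δ) <
        ((K - 1) * probTwoLe K p + (1 - p ^ K) - 3 * K * δ) ^ 2)
    (h3 : R + (2 + 4 * K) * δ < 1 - p ^ K) (hμ : (K : ℝ) ≤ δ * μ) (hR : (k : ℝ) ≤ R * n)
    (α : Fin n ↪ F) (c : Fin n → F) (hc : c ∈ rsCode k α) (Y : Fin K → Fin n → F)
    (hY : Typical δ k p α c Y) (out : Option (Fin n → F)) (hout : IsReconstruction k μ α Y out) :
    out = some c := by
  classical
  have hK' : (2 : ℝ) ≤ K := by exact_mod_cast hK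
  have hμ1 : 1 ≤ μ := by
    by_contra h
    have : μ = 0 := by omega
    simp [this] at hμ
    linarith
  have hμ0 : (0 : ℝ) < μ := by exact_mod_cast hμ1
  have hn0 : (0 : ℝ) < n := by exact_mod_cast hn
  obtain ⟨ht2, ht1, ht0, htb, htm⟩ := hY
  obtain ⟨hb1, hb2, hb3⟩ := score_cost_bounds μ Y hK hμ1 c
  have hcompl : (Finset.univ.filter fun j => 2 ≤ numCorrect (c j) fun i => Y i j).card +
      (Finset.univ.filter fun j => numCorrect (c j) (fun i => Y i j) ≤ 1).card = n := by
    have := Finset.card_filter_add_card_filter_not (s := (Finset.univ : Finset (Fin n)))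
      fun j => 2 ≤ numCorrect (c j) fun i => Y i j
    simp only [not_le, Nat.lt_succ_iff, Finset.card_univ, Fintype.card_fin] at this
    exact this
  set n₂ := (Finset.univ.filter fun j => 2 ≤ numCorrect (c j) fun i => Y i j).card
  set n₁ := (Finset.univ.filter fun j => numCorrect (c j) (fun i => Y i j) ≤ 1).card
  set n₀ := (Finset.univ.filter fun j => numCorrect (c j) (fun i => Y i j) = 0).card
  have hb : ((Finset.univ.filter fun j => Collision (c j) fun i => Y i j).card : ℝ) ≤ 2 * δ * n := by
    refine (le_of_eq ?_).trans (htb.trans (le_of_eq (by ring)))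
    congr
  set b := (Finset.univ.filter fun j => Collision (c j) fun i => Y i j).card
  obtain ⟨m, rfl⟩ := Nat.exists_eq_add_of_le' (show 1 ≤ K by omega)
  rw [Nat.add_sub_cancel] at hb1 hb2 hb3
  set x := probTwoLe (m + 1) p
  set a := p ^ (m + 1)
  have hm1 : ((m + 1 : ℕ) : ℝ) = m + 1 := by push_cast; ring
  simp only [hm1, add_sub_cancel_right] at h1 h2 h3 hμ hK'
  set s := (m : ℝ) * x + (1 - a) - 3 * (m + 1) * δ with hs
  have hm0 : (1 : ℝ) ≤ m := by linarith
  -- The lower bound for `n₂` comes from the upper bound for the complementary columns, so only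
  -- upper-tail estimates are needed.
  have hn2 : (x - δ) * n ≤ n₂ := by
    have : (n₂ : ℝ) + n₁ = n := by exact_mod_cast hcompl
    nlinarith
  have hb1' : (μ : ℝ) * (m * n₂ + n) ≤ score (multMatrix μ Y) c + μ * (m + 1) * b + μ * n₀ := by
    exact_mod_cast hb1
  have hscore : μ * (n * s) ≤ score (multMatrix μ Y) c := by
    have h4 : n * s ≤ m * n₂ + n - (m + 1) * b - n₀ := by
      have e1 := mul_le_mul_of_nonneg_left hn2 (show (0 : ℝ) ≤ m by linarith)
      have e2 := mul_le_mul_of_nonneg_left hb (show (0 : ℝ) ≤ m + 1 by linarith)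
      rw [hs]
      linear_combination e1 + e2 + ht0
    have := mul_le_mul_of_nonneg_left h4 hμ0.le
    linear_combination this + hb1'
  refine KoetterVardy.reconstruction_eq hk α Y out hout c hc ?_ fun c' hc' hne => ?_
  · have hb3' : (KoetterVardy.cost (multMatrix μ Y) : ℝ) ≤
        n * (μ * (m + 1)) + μ ^ 2 * (n * (m + 1) + (m + 1) * m * (n₂ + b)) := by
      exact_mod_cast hb3
    have hcost : (KoetterVardy.cost (multMatrix μ Y) : ℝ) ≤
        μ ^ 2 * (n * ((m + 1) * (1 + m * x) + (3 * (m + 1) ^ 2 + 1) * δ)) := by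
      refine hb3'.trans ?_
      -- Here a large `μ` is needed: `K ≤ δ μ` absorbs the linear part of `M (M + 1)` into the
      -- quadratic one.
      have e1 : (n : ℝ) * (μ * (m + 1)) ≤ μ ^ 2 * (n * δ) := by
        have := mul_le_mul_of_nonneg_left hμ (mul_nonneg hn0.le hμ0.le)
        linear_combination this
      have e2 : (m + 1 : ℝ) * m * (n₂ + b) ≤ (m + 1) * m * ((x + δ) * n + 2 * δ * n) := by
        gcongr
      have e3 : (n : ℝ) * (m + 1) + (m + 1) * m * (n₂ + b) ≤
          n * ((m + 1) * (1 + m * x) + 3 * (m + 1) ^ 2 * δ) := by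
        have : 0 ≤ (m + 1 : ℝ) * n * δ := by positivity
        linear_combination e2 + 3 * this
      have := mul_le_mul_of_nonneg_left e3 (sq_nonneg (μ : ℝ))
      linear_combination e1 + this
    have hfin : (k : ℝ) * KoetterVardy.cost (multMatrix μ Y) <
        (score (multMatrix μ Y) c : ℝ) ^ 2 := by
      calc (k : ℝ) * KoetterVardy.cost (multMatrix μ Y)
          ≤ (R * n) * (μ ^ 2 * (n * ((m + 1) * (1 + m * x) + (3 * (m + 1) ^ 2 + 1) * δ))) :=
            mul_le_mul hR hcost (Nat.cast_nonneg _) ((Nat.cast_nonneg _).trans hR)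
        _ = (μ * n) ^ 2 * (R * ((m + 1) * (1 + m * x) + (3 * (m + 1) ^ 2 + 1) * δ)) := by ring
        _ < (μ * n) ^ 2 * s ^ 2 := mul_lt_mul_of_pos_left h2 (by positivity)
        _ = (μ * (n * s)) ^ 2 := by ring
        _ ≤ _ := pow_le_pow_left₀ (by positivity) hscore 2
    exact_mod_cast hfin
  · have hb2' : (score (multMatrix μ Y) c' : ℝ) ≤ μ *
        ((Finset.univ.filter fun j => ∃ i, Y i j = c' j).card + m * n₂ + (m + 1) * b) := by
      exact_mod_cast hb2 c'
    have hmatch : ((Finset.univ.filter fun j => ∃ i, Y i j = c' j).card : ℝ) < k + δ * n := by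
      exact lt_of_eq_of_lt (by congr) (cast_lt_add_of_lt_add_ceil (by positivity) (htm c' hc' hne))
    have hlt : (score (multMatrix μ Y) c' : ℝ) < score (multMatrix μ Y) c := by
      refine hb2'.trans_lt ?_
      -- The common contribution `m * n₂` cancels: both words are credited with the full bonus of
      -- the concentrated columns.
      have e1 : ((Finset.univ.filter fun j => ∃ i, Y i j = c' j).card : ℝ) + m * n₂ +
          (m + 1) * b < m * n₂ + n - (m + 1) * b - n₀ := by
        have e2 := mul_le_mul_of_nonneg_left hb (show (0 : ℝ) ≤ m + 1 by linarith)
        have e3 := mul_lt_mul_of_pos_right h3 hn0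
        linear_combination hmatch + hR + 2 * e2 + e3 + ht0
      have := mul_lt_mul_of_pos_left e1 hμ0
      linear_combination this + hb1'
    exact_mod_cast hlt

theorem mass_not_typical_le (hp0 : 0 ≤ p) (hp1 : p ≤ 1) (hkn : k ≤ n) {δ : ℝ} (hδ0 : 0 < δ)
    (hδ1 : δ ≤ 1) (α : Fin n ↪ F) (c : Fin n → F) (hc : c ∈ rsCode k α)
    (hcol : K ^ 2 / ((Fintype.card F : ℝ) - 1) ≤ δ) (L : ℕ) (hL : 1 ≤ δ * L)
    (hq : (8 * (1 + K) : ℝ) ^ L ≤ (Fintype.card F : ℝ) - 1) :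
    mass (readsProb p c) (fun Y : Fin K → Fin n → F => ¬ Typical δ k p α c Y) ≤
      4 * Real.exp (-(δ ^ 2 / 4 * n)) + (1 / 2) ^ n := by
  classical
  have hf := readsProb_nonneg (K := K) hp0 hp1 c
  have hpK : p ^ K ≤ 1 := pow_le_one₀ hp0 hp1
  have hpK0 : 0 ≤ p ^ K := pow_nonneg hp0 _
  have hx0 := probTwoLe_nonneg (K := K) hp0 hp1
  have hx1 := probTwoLe_le (K := K) hp0 hp1
  have m1 := mass_readsProb_count_le hp0 hp1 c (fun x (y : Fin K → F) => 2 ≤ numCorrect x y)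
    (probTwoLe K p) hx0 (by linarith) (fun x => (mass_two_le_numCorrect x).le) δ hδ0 hδ1
  have m2 := mass_readsProb_count_le hp0 hp1 c (fun x (y : Fin K → F) => numCorrect x y ≤ 1)
    (1 - probTwoLe K p) (by linarith) (by linarith) (fun x => by
      rw [mass_numCorrect_le_one, probTwoLe]; linarith) δ hδ0 hδ1
  have m3 := mass_readsProb_count_le hp0 hp1 c (fun x (y : Fin K → F) => numCorrect x y = 0)
    (p ^ K) hpK0 hpK (fun x => (mass_numCorrect_eq_zero x).le) δ hδ0 hδ1
  have m4 := mass_readsProb_count_le hp0 hp1 c (fun x (y : Fin K → F) => Collision x y)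
    δ hδ0.le hδ1 (fun x => (mass_collision_le hp0 hp1 x).trans hcol) δ hδ0 hδ1
  have m5 := mass_other_codeword_le (K := K) hp0 hp1 hkn c hc ⌈δ * n⌉₊
  have m5' : mass (readsProb (K := K) p c) (fun Y => ∃ c' ∈ rsCode k α, c' ≠ c ∧
      k + ⌈δ * n⌉₊ ≤ (Finset.univ.filter fun j => ∃ i, Y i j = c' j).card) ≤ (1 / 2) ^ n := by
    -- With `δ L ≥ 1` and `q - 1 ≥ (8 (1 + K)) ^ L`, the factor `(q - 1) ^ ⌈δ n⌉` is at least `(8 (1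
    -- + K)) ^ n`, which beats `(4 (1 + K)) ^ n` by `2 ^ n`.
    have hnL : n ≤ L * ⌈δ * n⌉₊ := by
      have h1 : (n : ℝ) ≤ L * ⌈δ * n⌉₊ := by
        have h2 := mul_le_mul_of_nonneg_left (Nat.le_ceil (δ * n)) (Nat.cast_nonneg (α := ℝ) L)
        have h3 := mul_le_mul_of_nonneg_right hL (Nat.cast_nonneg (α := ℝ) n)
        nlinarith
      exact_mod_cast h1
    have h8 : (1 : ℝ) ≤ 8 * (1 + K) := by
      have := Nat.cast_nonneg (α := ℝ) K
      linarith
    have h9 : (8 * (1 + K) : ℝ) ^ n ≤ ((Fintype.card F : ℝ) - 1) ^ ⌈δ * n⌉₊ :=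
      (pow_le_pow_right₀ h8 hnL).trans
        (by rw [pow_mul]; exact pow_le_pow_left₀ (by positivity) hq _)
    have h10 := (mul_le_mul_of_nonneg_right h9 (mass_nonneg hf _)).trans m5
    have h11 : (4 * (1 + K) : ℝ) ^ n = (8 * (1 + K)) ^ n * (1 / 2) ^ n := by
      rw [← mul_pow]
      congr 1
      ring
    rw [h11] at h10
    refine (le_of_eq ?_).trans (le_of_mul_le_mul_left h10 (by positivity))
    rfl
  refine (mass_mono hf fun Y hY => ?_).trans ((mass_or_le hf _ _).trans (add_le_add m1
    ((mass_or_le hf _ _).trans (add_le_add m2 ((mass_or_le hf _ _).trans (add_le_add m3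
      ((mass_or_le hf _ _).trans (add_le_add m4 m5')))))))) |>.trans (le_of_eq (by ring))
  rw [Typical] at hY
  by_contra! h
  refine hY ⟨?_, ?_, ?_, ?_, ?_⟩
  · exact (le_of_eq (by congr)).trans h.1
  · exact (le_of_eq (by congr)).trans h.2.1
  · exact (le_of_eq (by congr)).trans h.2.2.1
  · exact (le_of_eq (by congr)).trans h.2.2.2.1
  · intro c' hc' hne
    exact lt_of_eq_of_lt (by congr) (h.2.2.2.2 c' hc' hne)

theorem errorProb_le_of_forall (hkn : k ≤ n) (α : Fin n ↪ F)
    (dec : (Fin K → Fin n → F) → Option (Fin n → F)) {ε : ℝ} (hε : 0 ≤ ε)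
    (h : ∀ c ∈ rsCode k α, mass (readsProb p c) (fun Y => ¬ dec Y = some c) ≤ ε) :
    errorProb p k α dec ≤ ε := by
  classical
  have hq : (0 : ℝ) < (Fintype.card F : ℝ) ^ k := pow_pos (by exact_mod_cast Fintype.card_pos) _
  rw [errorProb, div_le_iff₀ hq]
  have hle : ∀ c ∈ Finset.univ.filter (· ∈ rsCode k α),
      ∑ Y ∈ Finset.univ.filter (fun Y => dec Y ≠ some c), readsProb p c Y ≤ ε := by
    intro c hc
    refine le_trans (le_of_eq ?_) (h c (Finset.mem_filter.1 hc).2)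
    rw [mass_eq_sum_filter]
  refine le_trans (le_of_eq ?_) ((Finset.sum_le_sum hle).trans ?_)
  · congr!
  · rw [Finset.sum_const, nsmul_eq_mul, mul_comm]
    refine mul_le_mul_of_nonneg_left ?_ hε
    have := card_rsCode_le (α := α) hkn
    exact_mod_cast this

end error

/-- Below the threshold the error probability tends to zero, uniformly in the codes. -/
theorem errorProb_le {K : ℕ} {p : ℝ} (hK : 2 ≤ K) (hp0 : 0 < p) (hp1 : p < 1) {R : ℝ}
    (hR : R < rateThreshold K p) : ∃ μ₀ : ℕ, ∀ μ ≥ μ₀, ∀ ε > (0 : ℝ), ∃ n₀ : ℕ, ∀ n ≥ n₀,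
      ∀ (F : Type) [Field F] [Fintype F] [DecidableEq F] (α : Fin n ↪ F) (k : ℕ),
        1 ≤ k → (k : ℝ) / n ≤ R → ∀ dec : (Fin K → Fin n → F) → Option (Fin n → F),
          ImplementsReconstruction k μ α dec → errorProb p k α dec ≤ ε := by
  obtain ⟨δ, hδ0, hδ1, h1, h2, h3⟩ := exists_slack hK hp0 hp1 hR
  -- This choice guarantees `K ≤ δ μ`, the condition on `μ` in `reconstruction_eq_of_typical`.
  refine ⟨⌈K / δ⌉₊, fun μ hμ ε hε => ?_⟩
  obtain ⟨L, hL⟩ := exists_nat_ge (1 / δ)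
  rw [div_le_iff₀' hδ0] at hL
  have hcast : Filter.Tendsto (fun n : ℕ => (n : ℝ)) Filter.atTop Filter.atTop :=
    tendsto_natCast_atTop_atTop
  have e1 := hcast.eventually_ge_atTop (K ^ 2 / δ + 1)
  have e2 := hcast.eventually_ge_atTop ((8 * (1 + K) : ℝ) ^ L + 1)
  have e3 : ∀ᶠ n : ℕ in Filter.atTop,
      4 * Real.exp (-(δ ^ 2 / 4 * n)) + (1 / 2) ^ n < ε := by
    have t1 : Filter.Tendsto (fun n : ℕ => Real.exp (-(δ ^ 2 / 4 * n))) Filter.atTop (nhds 0) :=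
      Real.tendsto_exp_neg_atTop_nhds_zero.comp (hcast.const_mul_atTop (by positivity))
    have t2 : Filter.Tendsto (fun n : ℕ => (1 / 2 : ℝ) ^ n) Filter.atTop (nhds 0) :=
      tendsto_pow_atTop_nhds_zero_of_lt_one (by norm_num) (by norm_num)
    have t3 := (t1.const_mul 4).add t2
    rw [mul_zero, add_zero] at t3
    exact t3.eventually_lt_const hε
  obtain ⟨n₀, hn₀⟩ := Filter.eventually_atTop.1
    (((e1.and e2).and e3).and (Filter.eventually_ge_atTop 1))
  refine ⟨n₀, fun n hn F _ _ _ α k hk hkR dec hdec => ?_⟩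
  obtain ⟨⟨⟨e1, e2⟩, e3⟩, hn1⟩ := hn₀ n hn
  have hn0 : (0 : ℝ) < n := by exact_mod_cast hn1
  have hkR' : (k : ℝ) ≤ R * n := (div_le_iff₀ hn0).1 hkR
  have hkn : k ≤ n := by
    have : R ≤ 1 := by
      have : 0 ≤ p ^ K := by positivity
      have : 0 ≤ (2 + 4 * K) * δ := by positivity
      linarith
    have : (k : ℝ) ≤ n := hkR'.trans (mul_le_of_le_one_left hn0.le this)
    exact_mod_cast this
  -- The `n` distinct evaluation points force `q ≥ n`, so lower bounds on `n` serve as lower bounds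
  -- on the field size.
  have hnq : (n : ℝ) ≤ Fintype.card F := by
    have := Fintype.card_le_of_embedding α
    rw [Fintype.card_fin] at this
    exact_mod_cast this
  refine errorProb_le_of_forall hkn α dec hε.le fun c hc => ?_
  refine (mass_mono (readsProb_nonneg hp0.le hp1.le c) fun Y hY => ?_).trans
    ((mass_not_typical_le (K := K) hp0.le hp1.le hkn hδ0 hδ1 α c hc ?_ L hL ?_).trans e3.le)
  · intro hT
    refine hY (reconstruction_eq_of_typical hK hk hn1 hδ0 h1 h2 h3 ?_ hkR' α c hc Y hT _ (hdec Y))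
    rw [← div_le_iff₀' hδ0]
    exact (Nat.le_ceil _).trans (by exact_mod_cast hμ)
  · rw [div_le_iff₀ one_lt_card_cast, ← div_le_iff₀' hδ0]
    linarith
  · linarith

/-- A slowly growing index for diagonal arguments: take the largest `m ≤ n` whose requirement `N m`
is already met at `n`. -/
theorem exists_tendsto_forall_le (N : ℕ → ℕ) : ∃ m : ℕ → ℕ,
    Filter.Tendsto m Filter.atTop Filter.atTop ∧ ∀ᶠ n in Filter.atTop, N (m n) ≤ n := by
  refine ⟨fun n => Nat.findGreatest (fun m => N m ≤ n) n, Filter.tendsto_atTop.2 fun M => ?_, ?_⟩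
  · filter_upwards [Filter.eventually_ge_atTop (max M (N M))] with n hn
    exact Nat.le_findGreatest ((le_max_left _ _).trans hn) ((le_max_right _ _).trans hn)
  · filter_upwards [Filter.eventually_ge_atTop (N 0)] with n hn
    exact Nat.findGreatest_spec (P := fun m => N m ≤ n) (Nat.zero_le n) hn

/-- Every rate up to the threshold is achieved. -/
theorem exists_rates_errorProb_le {K : ℕ} {p : ℝ} (hK : 2 ≤ K) (hp0 : 0 < p) (hp1 : p < 1) {R : ℝ}
    (hR0 : 0 < R) (hR : R ≤ rateThreshold K p) : ∃ k μ : ℕ → ℕ,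
      (∀ n ≥ 1, 1 ≤ k n ∧ k n ≤ n ∧ 1 ≤ μ n ∧ μ n ≤ n) ∧
      Filter.Tendsto (fun n => (k n : ℝ) / n) Filter.atTop (nhds R) ∧
      ∀ ε > (0 : ℝ), ∃ n₀ : ℕ, ∀ n ≥ n₀,
        ∀ (F : Type) [Field F] [Fintype F] [DecidableEq F] (α : Fin n ↪ F)
          (dec : (Fin K → Fin n → F) → Option (Fin n → F)),
          ImplementsReconstruction (k n) (μ n) α dec → errorProb p (k n) α dec ≤ ε := by
  -- Positive rates strictly below `R` that tend to `R`, so that the result below the threshold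
  -- applies to each of them.
  let r : ℕ → ℝ := fun m => R * (1 - 1 / ((m : ℝ) + 1 + 1))
  have hpos : ∀ m : ℕ, 0 < 1 / ((m : ℝ) + 1 + 1) := fun m => by positivity
  have hr1 : ∀ m, r m < R := fun m => mul_lt_of_lt_one_right hR0 (by linarith [hpos m])
  have hr0 : ∀ m, 0 < r m := fun m => by
    refine mul_pos hR0 (sub_pos.2 ?_)
    rw [div_lt_one (by positivity)]
    have := Nat.cast_nonneg (α := ℝ) m
    linarith
  have hrR : Filter.Tendsto r Filter.atTop (nhds R) := by
    have h := (tendsto_one_div_add_atTop_nhds_zero_nat (𝕜 := ℝ)).comp (Filter.tendsto_add_atTop_nat 1)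
    have h2 := (h.const_sub 1).const_mul R
    rw [sub_zero, mul_one] at h2
    refine h2.congr fun m => ?_
    simp [r]
  choose μ₀ hμ₀ using fun m => errorProb_le hK hp0 hp1 ((hr1 m).trans_le hR)
  choose n₀ hn₀ using fun m => hμ₀ m (max 1 (μ₀ m)) (le_max_right _ _) (1 / ((m : ℝ) + 1))
    (by positivity)
  -- At length `n` the stage `m n` is used once `n` exceeds its `n₀`, its multiplicity, which gives
  -- `μ n ≤ n`, and `1 / r (m n)`, which makes the rounded-down dimension at least `1`.
  obtain ⟨m, hm, hN⟩ := exists_tendsto_forall_le fun m =>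
    max (max (n₀ m) (max 1 (μ₀ m))) ⌈1 / r m⌉₊
  let G : ℕ → Prop := fun n =>
    max (max (n₀ (m n)) (max 1 (μ₀ (m n)))) ⌈1 / r (m n)⌉₊ ≤ n
  classical
  have hG : ∀ n, G n → n₀ (m n) ≤ n ∧ max 1 (μ₀ (m n)) ≤ n ∧ 1 ≤ r (m n) * n := by
    intro n h
    simp only [G, max_le_iff] at h
    refine ⟨h.1.1, max_le h.1.2.1 h.1.2.2, ?_⟩
    rw [← div_le_iff₀' (hr0 _)]
    exact Nat.ceil_le.1 h.2
  have hlt1 : R < 1 := by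
    have := rateThreshold_lt hK hp0 hp1
    have : 0 < p ^ K := by positivity
    linarith
  refine ⟨fun n => if G n then ⌊r (m n) * n⌋₊ else 1,
    fun n => if G n then max 1 (μ₀ (m n)) else 1, fun n hn => ?_, ?_, fun ε hε => ?_⟩
  · by_cases h : G n
    · simp only [if_pos h]
      obtain ⟨-, h2, h3⟩ := hG n h
      refine ⟨Nat.le_floor (by exact_mod_cast h3), Nat.floor_le_of_le ?_, le_max_left _ _, h2⟩
      exact mul_le_of_le_one_left (Nat.cast_nonneg _) ((hr1 _).trans hlt1).le
    · simp only [if_neg h]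
      omega
  · have hrm := hrR.comp hm
    have hlow : Filter.Tendsto (fun n : ℕ => r (m n) - 1 / (n : ℝ)) Filter.atTop (nhds R) := by
      simpa using hrm.sub (tendsto_one_div_atTop_nhds_zero_nat (𝕜 := ℝ))
    refine tendsto_of_tendsto_of_tendsto_of_le_of_le' hlow hrm ?_ ?_
    · filter_upwards [hN, Filter.eventually_ge_atTop 1] with n h hn
      have hn0 : (0 : ℝ) < n := by exact_mod_cast hn
      simp only [show G n from h, if_true]
      rw [le_div_iff₀ hn0, sub_mul, one_div, inv_mul_cancel₀ hn0.ne']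
      exact (Nat.sub_one_lt_floor _).le
    · filter_upwards [hN, Filter.eventually_ge_atTop 1] with n h hn
      have hn0 : (0 : ℝ) < n := by exact_mod_cast hn
      simp only [show G n from h, if_true]
      rw [div_le_iff₀ hn0]
      exact Nat.floor_le (mul_nonneg (hr0 _).le hn0.le)
  · have hsmall : ∀ᶠ n in Filter.atTop, 1 / ((m n : ℝ) + 1) < ε :=
      ((tendsto_one_div_add_atTop_nhds_zero_nat (𝕜 := ℝ)).comp hm).eventually_lt_const hε
    obtain ⟨n₁, hn₁⟩ := Filter.eventually_atTop.1
      ((hN.and hsmall).and (Filter.eventually_ge_atTop 1))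
    refine ⟨n₁, fun n hn F _ _ _ α dec hdec => ?_⟩
    obtain ⟨⟨h, hε'⟩, hn1⟩ := hn₁ n hn
    have hn0 : (0 : ℝ) < n := by exact_mod_cast hn1
    obtain ⟨h1, -, h3⟩ := hG n h
    simp only [show G n from h, if_true] at hdec ⊢
    refine (hn₀ (m n) n h1 F α _ (Nat.le_floor (by exact_mod_cast h3)) ?_ dec hdec).trans hε'.le
    rw [div_le_iff₀ hn0]
    exact Nat.floor_le (mul_nonneg (hr0 _).le hn0.le)

theorem theorem4 :
    -- one program performs the reconstruction algorithm, in polynomial time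
    (∃ (P : Prog inputTy outputTy) (T : Polynomial ℕ),
      ∀ (F : Type) [Field F] [Fintype F] [DecidableEq F] (n k K μ : ℕ),
        2 ≤ K → 1 ≤ μ → 1 ≤ k → k ≤ n →
        ∀ (δ : Fin (Fintype.card F) ≃ F) (α : Fin n ↪ F) (Y : Fin K → Fin n → F),
          (∃ out : Option (Fin n → F), IsReconstruction k μ α Y out ∧
            P.eval (encodeInput δ α Y k μ) = encodeOutput out) ∧
          P.time (encodeInput δ α Y k μ) ≤ T.eval (Fintype.card F + n + K + μ)) ∧
    -- the error probability
    (∀ (K : ℕ) (p : ℝ), 2 ≤ K → 0 < p → p < 1 → p ≤ (K : ℝ) ^ (-1 / ((K : ℝ) - 1)) →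
      -- below the threshold: all codes of rate at most `R`, all large `μ`
      (∀ R : ℝ, R < rateThreshold K p →
        ∃ μ₀ : ℕ, ∀ μ ≥ μ₀, ∀ ε > (0 : ℝ), ∃ n₀ : ℕ, ∀ n ≥ n₀,
          ∀ (F : Type) [Field F] [Fintype F] [DecidableEq F] (α : Fin n ↪ F) (k : ℕ),
            1 ≤ k → (k : ℝ) / n ≤ R →
            ∀ dec : (Fin K → Fin n → F) → Option (Fin n → F),
              ImplementsReconstruction k μ α dec → errorProb p k α dec ≤ ε) ∧
      -- up to and including the threshold: rates tending to `R`, multiplicities at most `n`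
      (∀ R : ℝ, 0 < R → R ≤ rateThreshold K p →
        ∃ k μ : ℕ → ℕ,
          (∀ n ≥ 1, 1 ≤ k n ∧ k n ≤ n ∧ 1 ≤ μ n ∧ μ n ≤ n) ∧
          Filter.Tendsto (fun n => (k n : ℝ) / n) Filter.atTop (nhds R) ∧
          ∀ ε > (0 : ℝ), ∃ n₀ : ℕ, ∀ n ≥ n₀,
            ∀ (F : Type) [Field F] [Fintype F] [DecidableEq F] (α : Fin n ↪ F)
              (dec : (Fin K → Fin n → F) → Option (Fin n → F)),
              ImplementsReconstruction (k n) (μ n) α dec → errorProb p (k n) α dec ≤ ε)) := by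
  refine ⟨exists_prog_reconstruction, fun K p hK hp0 hp1 _ => ⟨fun R hR => ?_, fun R hR0 hR => ?_⟩⟩
  · exact errorProb_le hK hp0 hp1 hR
  · exact exists_rates_errorProb_le hK hp0 hp1 hR0 hR
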